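/- **Setting.** Let $n,m\ge 1$ and $x_{t+1}=Ax_t+Bu_t+w_t$ with $x_t\in\mathbb R^n$, $u_t\in\mathbb R^m$, where $(w_t)$ is i.i.d. with finite fourth moment, mean $\bar w$ and covariance $W>0$, and $x_0$ is square integrable and independent of $(w_t)$. Let $Q\ge 0$, $R>0$, $(A,B)$ controllable, $(A,Q^{1/2})$ observable, and $\rho>0$. Put $M_3=\mathbb E[(w_t-\bar w)(w_t-\bar w)^\top Q(w_t-\bar w)]$, $m_4=\mathbb E[((w_t-\bar w)^\top Q(w_t-\bar w)-\operatorname{tr}(WQ))^2]$, $\bar\rho=\rho-m_4+4\operatorname{tr}((WQ)^2)$ and $Q_\mu=Q+4\mu QWQ$. A policy $X=[K,l]$ acts by $u_t=-Kx_t+l$; $\mathcal S$ is the set of policies for which $A-BK$ has spectral radius less than $1$. For $X\in\mathcal S$ let $$J(X)=\lim_{T\to\infty}\tfrac1T\,\mathbb E\sum_{t<T}(x_t^\top Qx_t+u_t^\top Ru_t),\qquad J_c(X)=\lim_{T\to\infty}\tfrac1T\,\mathbb E\sum_{t<T}(4x_t^\top QWQx_t+4x_t^\top QM_3),$$ $$\mathcal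 L(X,\mu)=J(X)+\mu(J_c(X)-\bar\rho),\qquad \Phi_X=\lim_{T\to\infty}\tfrac1T\,\mathbb E\sum_{t<T}\begin{bmatrix}x_t\\-1\end{bmatrix}\begin{bmatrix}x_t\\-1\end{bmatrix}^\top ,$$ let $P_K\ge0$ be the solution of $P_K=Q_\mu+K^\top RK+(A-BK)^\top P_K(A-BK)$, and let $R_K=R+B^\top P_KB$. Write $\underline\sigma$ for the minimum eigenvalue of a symmetric matrix, $\|\cdot\|$ for the spectral norm of a matrix and the Euclidean norm of a vector, and $\nabla_X\mathcal L$ for the gradient of $\mathcal L(\cdot,\mu)$. With stepsize $\eta$, one step of policy gradient (PG), natural policy gradient (NPG) and Gauss-Newton (GN) is, respectively, $$X'=X-\eta\nabla_X\mathcal L,\qquad X'=X-\eta\nabla_X\mathcal L\,\Phi_X^{-1},\qquad X'=X-\eta R_K^{-1}\nabla_X\mathcal L\,\Phi_X^{-1}.$$ **Theorem.** Fix $\mu\ge0$ and $X^{(0)}\in\mathcal S$, and let $\mathcal S_0=\{X\in\mathcal S:\mathcal L(X,\mu)\le\mathcal L(X^{(0)},\mu)\}$. On $\mathcal S$ all the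 objects above are well defined: the limits exist, $\mathcal L(\cdot,\mu)$ is differentiable, $P_K$ is unique, and $\Phi_X,R_K>0$. The set $\mathcal S_0$ is compact. The function $\mathcal L(\cdot,\mu)$ has exactly one critical point $X^*$ in $\mathcal S$, and it is a global minimizer over $\mathcal S$. The minimum $\sigma_0=\min_{X\in\mathcal S_0}\underline\sigma(\Phi_X)$ is attained and positive. Put $\mathcal L^*=\mathcal L(X^*,\mu)$ and $\Phi^*=\Phi_{X^*}$. Then the following hold. (a) **GN.** Let $0<\eta\le1/2$ and $\beta=2\eta\sigma_0/\|\Phi^*\|$. Then $0<\beta\le1$, and $\beta<1$ unless $\eta=1/2$ and $X^{(0)}$ is already optimal. For every $X\in\mathcal S_0$ the GN step satisfies $X'\in\mathcal S_0$ (so $X'$ is stabilizing) and $$\mathcal L(X',\mu)-\mathcal L^*\le(1-\beta)(\mathcal L(X,\mu)-\mathcal L^*).$$ (b) **NPG.** Start the iteration at any policy $[K_0,l_0]\in\mathcal S_0$ (for instance at $X^{(0)}$), with $0<\eta\le 1/(2\|R_{K_0}\|)$, and let $\beta=2\eta\sigma_0\underline\sigma(R)/\|\Phi^*\|$. Then $\beta\in(0,1)$,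 all NPG iterates stay in $\mathcal S_0$, and the inequality of (a) holds with this $\beta$ for each pair of consecutive iterates $X,X'$. (c) **PG.** There is a polynomial $p$ with nonnegative real coefficients, depending only on $n$ and $m$, such that, with $p$ evaluated at $$\|A\|,\ \|B\|,\ \|Q\|,\ \|R\|,\ \|W\|,\ \|\bar w\|,\ \|M_3\|,\ \mu,\ |\bar\rho|,\ |\mathcal L(X^{(0)},\mu)|,\ \underline\sigma(R)^{-1},\ \underline\sigma(W)^{-1},\ \underline\sigma\Big(\sum_{k<n}(A^k)^\top Q_\mu A^k\Big)^{-1},$$ one has $p>0$, and for every $0<\eta\le1/p$ and $\beta=2\eta\sigma_0^2\underline\sigma(R)/\|\Phi^*\|$: $\beta\in(0,1)$, and for every $X\in\mathcal S_0$ the PG step satisfies $X'\in\mathcal S_0$ and the inequality of (a) with this $\beta$. -/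

import Mathlib

/- Matrix norms are spectral norms; the order on matrices (used by the matrix square root) is the
Loewner order. -/
open scoped Matrix.Norms.L2Operator MatrixOrder Matrix NNReal Topology

noncomputable section

namespace RCLQR

/-- The minimum eigenvalue of a (nonempty) real symmetric matrix. -/
def minEig {ι : Type*} [Fintype ι] [DecidableEq ι] (M : Matrix ι ι ℝ) : ℝ :=
  sInf (spectrum ℝ M)

/-- The Euclidean norm of a real vector. -/
def euclNorm {ι : Type*} [Fintype ι] (v : ι → ℝ) : ℝ := ‖WithLp.toLp 2 v‖

/-- The spectral radius of the real square matrix `D` (over `ℂ`) is smaller than one. -/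
def IsStable {n : ℕ} (D : Matrix (Fin n) (Fin n) ℝ) : Prop :=
  spectralRadius ℂ (D.map (algebraMap ℝ ℂ)) < 1

/-- `(A, B)` is controllable: `[B, AB, …, Aⁿ⁻¹B]` has rank `n`. -/
def Controllable {n m : ℕ} (A : Matrix (Fin n) (Fin n) ℝ) (B : Matrix (Fin n) (Fin m) ℝ) : Prop :=
  (Matrix.of fun (i : Fin n) (kj : Fin n × Fin m) => (A ^ (kj.1 : ℕ) * B) i kj.2).rank = n

/-- `(A, C)` is observable: the stacked matrix `[C; CA; …; CAⁿ⁻¹]` has rank `n`. -/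
def Observable {n p : ℕ} (A : Matrix (Fin n) (Fin n) ℝ) (C : Matrix (Fin p) (Fin n) ℝ) : Prop :=
  (Matrix.of fun (ki : Fin n × Fin p) (j : Fin n) => (C * A ^ (ki.1 : ℕ)) ki.2 j).rank = n

/-- An affine policy `X = [K, l]`, acting by `u = -K x + l`, stored as one `m × (n+1)` matrix. -/
abbrev Policy (n m : ℕ) := Matrix (Fin m) (Fin n ⊕ Unit) ℝ

variable {n m : ℕ}

/-- The gain `K` of the policy `X = [K, l]`. -/
def Policy.gain (X : Policy n m) : Matrix (Fin m) (Fin n) ℝ := Matrix.of fun i j => X i (Sum.inl j)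

/-- The offset `l` of the policy `X = [K, l]`. -/
def Policy.offset (X : Policy n m) : Fin m → ℝ := fun i => X i (Sum.inr ())

/-- The data of a risk-constrained linear quadratic regulator. -/
structure Model (n m : ℕ) (Ω : Type*) [MeasurableSpace Ω] where
  /-- state matrix -/
  A : Matrix (Fin n) (Fin n) ℝ
  /-- input matrix -/
  B : Matrix (Fin n) (Fin m) ℝ
  /-- state weight -/
  Q : Matrix (Fin n) (Fin n) ℝ
  /-- input weight -/
  R : Matrix (Fin m) (Fin m) ℝ
  /-- risk tolerance -/
  tol : ℝ
  /-- probability law on the sample space -/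
  ℙ : MeasureTheory.Measure Ω
  /-- initial state -/
  x₀ : Ω → Fin n → ℝ
  /-- noise sequence -/
  w : ℕ → Ω → Fin n → ℝ

namespace Model

variable {Ω : Type*} [MeasurableSpace Ω] (M : Model n m Ω)

/-- Mean of the noise. -/
def wbar : Fin n → ℝ := fun i => ∫ ω, M.w 0 ω i ∂M.ℙ

/-- Covariance of the noise. -/
def W : Matrix (Fin n) (Fin n) ℝ :=
  Matrix.of fun i j => ∫ ω, (M.w 0 ω - M.wbar) i * (M.w 0 ω - M.wbar) j ∂M.ℙ

/-- `M₃ = E[(w - w̄)(w - w̄)ᵀ Q (w - w̄)]`. -/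
def M₃ : Fin n → ℝ := fun i =>
  ∫ ω, (M.w 0 ω - M.wbar) i * ((M.w 0 ω - M.wbar) ⬝ᵥ (M.Q *ᵥ (M.w 0 ω - M.wbar))) ∂M.ℙ

/-- `m₄ = E[((w - w̄)ᵀ Q (w - w̄) - tr(W Q))²]`. -/
def m₄ : ℝ :=
  ∫ ω, ((M.w 0 ω - M.wbar) ⬝ᵥ (M.Q *ᵥ (M.w 0 ω - M.wbar)) - (M.W * M.Q).trace) ^ 2 ∂M.ℙ

/-- The reshaped risk tolerance `ρ̄ = ρ - m₄ + 4 tr((W Q)²)`. -/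
def tolBar : ℝ := M.tol - M.m₄ + 4 * ((M.W * M.Q) ^ 2).trace

/-- The standing assumptions on the system, the weights, the noise and the initial state. -/
structure Standing : Prop where
  Q_psd : M.Q.PosSemidef
  R_pd : M.R.PosDef
  controllable : Controllable M.A M.B
  observable : Observable M.A (CFC.sqrt M.Q)
  tol_pos : 0 < M.tol
  prob : MeasureTheory.IsProbabilityMeasure M.ℙ
  x₀_meas : Measurable M.x₀
  x₀_sq : MeasureTheory.MemLp M.x₀ 2 M.ℙ
  w_meas : ∀ t, Measurable (M.w t)
  w_fourth : MeasureTheory.MemLp (M.w 0) 4 M.ℙ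
  w_indep : ProbabilityTheory.iIndepFun M.w M.ℙ
  w_ident : ∀ t, ProbabilityTheory.IdentDistrib (M.w t) (M.w 0) M.ℙ M.ℙ
  x₀_indep : ProbabilityTheory.IndepFun M.x₀ (fun ω t => M.w t ω) M.ℙ
  W_pd : M.W.PosDef

/-- The set `𝒮` of stabilizing policies. -/
def stabilizing : Set (Policy n m) := {X | IsStable (M.A - M.B * X.gain)}

/-- The control action `u = -K x + l`. -/
def action (X : Policy n m) (x : Fin n → ℝ) : Fin m → ℝ := -(X.gain *ᵥ x) + X.offset

/-- The state `x_t` of the closed loop under the policy `X`. -/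
def state (X : Policy n m) : ℕ → Ω → Fin n → ℝ
  | 0, ω => M.x₀ ω
  | t + 1, ω => M.A *ᵥ (state X t ω) + M.B *ᵥ (action X (state X t ω)) + M.w t ω

/-- `(1/T) E[∑_{t<T} f(x_t)]` under the policy `X`. -/
def timeAverage (X : Policy n m) (f : (Fin n → ℝ) → ℝ) (T : ℕ) : ℝ :=
  (T : ℝ)⁻¹ * ∫ ω, ∑ t ∈ Finset.range T, f (M.state X t ω) ∂M.ℙ

/-- The long-run average of `f(x_t)` under the policy `X`. -/
def ergodicMean (X : Policy n m) (f : (Fin n → ℝ) → ℝ) : ℝ :=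
  Filter.limUnder Filter.atTop (M.timeAverage X f)

/-- The stage cost `xᵀ Q x + uᵀ R u` with `u = -K x + l`. -/
def stageCost (X : Policy n m) (x : Fin n → ℝ) : ℝ :=
  x ⬝ᵥ (M.Q *ᵥ x) + action X x ⬝ᵥ (M.R *ᵥ action X x)

/-- The stage risk `4 xᵀ Q W Q x + 4 xᵀ Q M₃`. -/
def stageRisk (x : Fin n → ℝ) : ℝ :=
  4 * (x ⬝ᵥ ((M.Q * M.W * M.Q) *ᵥ x)) + 4 * (x ⬝ᵥ (M.Q *ᵥ M.M₃))

/-- The cost `J(X)`. -/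
def J (X : Policy n m) : ℝ := M.ergodicMean X (M.stageCost X)

/-- The risk `J_c(X)`. -/
def Jc (X : Policy n m) : ℝ := M.ergodicMean X M.stageRisk

/-- The Lagrangian `ℒ(X, μ) = J(X) + μ (J_c(X) - ρ̄)`. -/
def lagrangian (μ : ℝ) (X : Policy n m) : ℝ := M.J X + μ * (M.Jc X - M.tolBar)

/-- The gradient of `ℒ(·, μ)`: the matrix of its partial derivatives. -/
def grad (μ : ℝ) (X : Policy n m) : Policy n m :=
  Matrix.of fun i j => fderiv ℝ (M.lagrangian μ) X (Matrix.single i j 1)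

/-- The vector `[x; -1]`. -/
def extend (x : Fin n → ℝ) : Fin n ⊕ Unit → ℝ := Sum.elim x (fun _ => -1)

/-- The ergodic matrix `Φ_X`, the long-run average of `[x_t; -1][x_t; -1]ᵀ`. -/
def Φ (X : Policy n m) : Matrix (Fin n ⊕ Unit) (Fin n ⊕ Unit) ℝ :=
  Matrix.of fun i j => M.ergodicMean X (fun x => extend x i * extend x j)

/-- `Q_μ = Q + 4 μ Q W Q`. -/
def Qμ (μ : ℝ) : Matrix (Fin n) (Fin n) ℝ := M.Q + (4 * μ) • (M.Q * M.W * M.Q)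

/-- `P` is a positive semidefinite solution of the Lyapunov equation of the gain `K`. -/
def IsLyapunovSolution (μ : ℝ) (K : Matrix (Fin m) (Fin n) ℝ) (P : Matrix (Fin n) (Fin n) ℝ) :
    Prop :=
  P.PosSemidef ∧ P = M.Qμ μ + Kᵀ * M.R * K + (M.A - M.B * K)ᵀ * P * (M.A - M.B * K)

/-- The matrix `P_K`, the (unique if `K` is stabilizing) positive semidefinite solution of the
Lyapunov equation. -/
def P (μ : ℝ) (K : Matrix (Fin m) (Fin n) ℝ) : Matrix (Fin n) (Fin n) ℝ :=
  Classical.epsilon (M.IsLyapunovSolution μ K)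

/-- `R_K = R + Bᵀ P_K B`. -/
def RK (μ : ℝ) (K : Matrix (Fin m) (Fin n) ℝ) : Matrix (Fin m) (Fin m) ℝ :=
  M.R + M.Bᵀ * M.P μ K * M.B

/-- One policy gradient step with stepsize `η`. -/
def pgStep (μ η : ℝ) (X : Policy n m) : Policy n m := X - η • M.grad μ X

/-- One natural policy gradient step with stepsize `η`. -/
def npgStep (μ η : ℝ) (X : Policy n m) : Policy n m := X - η • (M.grad μ X * (M.Φ X)⁻¹)

/-- One Gauss-Newton step with stepsize `η`. -/
def gnStep (μ η : ℝ) (X : Policy n m) : Policy n m :=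
  X - η • ((M.RK μ X.gain)⁻¹ * M.grad μ X * (M.Φ X)⁻¹)

/-- The sublevel set `𝒮₀` of the Lagrangian (whose domain is `𝒮`) at the policy `X₀`. -/
def sublevel (μ : ℝ) (X₀ : Policy n m) : Set (Policy n m) :=
  {X | X ∈ M.stabilizing ∧ M.lagrangian μ X ≤ M.lagrangian μ X₀}

/-- All objects attached to `X` in the iterations are well defined: the defining limits of
`J(X)`, `J_c(X)`, `Φ_X` exist, `Φ_X` and `R_K` are positive definite, `P_K` is the unique solution
of its equation, and the Lagrangian is differentiable at `X`. -/
structure WellDefinedAt (μ : ℝ) (X : Policy n m) : Prop where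
  cost : Filter.Tendsto (M.timeAverage X (M.stageCost X)) Filter.atTop (𝓝 (M.J X))
  risk : Filter.Tendsto (M.timeAverage X M.stageRisk) Filter.atTop (𝓝 (M.Jc X))
  ergodic : ∀ i j, Filter.Tendsto (M.timeAverage X (fun x => extend x i * extend x j))
    Filter.atTop (𝓝 (M.Φ X i j))
  Φ_pd : (M.Φ X).PosDef
  lyapunov : ∀ P, M.IsLyapunovSolution μ X.gain P ↔ P = M.P μ X.gain
  RK_pd : (M.RK μ X.gain).PosDef
  diff : DifferentiableAt ℝ (M.lagrangian μ) X

/-- The observability Gramian `∑_{k<n} (Aᵏ)ᵀ Q_μ Aᵏ` (which is at least `Q_μ`). -/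
def gramian (μ : ℝ) : Matrix (Fin n) (Fin n) ℝ :=
  ∑ k ∈ Finset.range n, (M.A ^ k)ᵀ * M.Qμ μ * M.A ^ k

/-- The problem parameters on which the stepsize of the policy gradient method depends. -/
def parameters (μ : ℝ) (X₀ : Policy n m) : Fin 13 → ℝ :=
  ![‖M.A‖, ‖M.B‖, ‖M.Q‖, ‖M.R‖, ‖M.W‖, euclNorm M.wbar, euclNorm M.M₃, μ, |M.tolBar|,
    |M.lagrangian μ X₀|, 1 / minEig M.R, 1 / minEig M.W, 1 / minEig (M.gramian μ)]

end Model

end RCLQR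

end

/-! With the extended state z = [x; -1] the affine policy becomes linear, and the Lagrangian becomes
the trace of (weight + XᵀRX) Φ_X, where Φ_X is the stationary second moment of z. Let E_X be
`natGrad`. Pairing the Bellman equation of X with the stationary law of Y gives the exact identity
`statL_sub`: L(Y) - L(X) = tr(R_K (Y-X) Φ_Y (Y-X)ᵀ) + 2 tr(E_X Φ_Y (Y-X)ᵀ).

No convexity is used; this identity takes its place. Letting Y tend to X gives ∇L = 2 E_X Φ_X. If
E_X = 0, the right side is positive for Y ≠ X, so a critical point is the unique global minimizer.
Completing the square gives gradient dominance, L(X) - L(Y) ≤ ‖Φ_Y‖ tr(R_K⁻¹ E_X E_Xᵀ)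
(`gradient_dominance`). Hence a step that lowers L by at least c tr(R_K⁻¹ E_X E_Xᵀ) contracts the
optimality gap by the factor 1 - c/‖Φ*‖.

Gauss-Newton and natural gradient steps have the form X - 2η N E_X with N = R_K⁻¹ or N = 1. If 2η N
R_K N ≤ N, the old P_K is a Lyapunov certificate for the new gain, so stability needs no
perturbation argument (`preconditioned_step`). Moreover P_K decreases, so the stepsize condition of
the natural gradient persists. The plain gradient step has to be short: all quantities on the
sublevel set are bounded by powers of one number s that dominates the parameters, and Φ then changes
little along the step (`gradient_step`).

These bounds start from the fact that a bound on L bounds tr((Q_μ + KᵀRK) cov) and the stationary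
action. Observability of (A, Q^{1/2}) passes to the closed loop at a price independent of K, because
the stage weight also charges Kx (`observability_ineq`). This bounds the covariance and the mean
and, since W > 0, the Lyapunov matrix of the closed loop (`norm_lyap_one_le`). The last bound is a
uniform stability margin; it keeps the sublevel set away from the boundary of stability and makes it
compact. -/

noncomputable section

namespace RCLQR

open Filter

/-! ### Euclidean and spectral norms, quadratic forms and traces. -/

section Euclid

variable {ι κ : Type*} [Fintype ι] [Fintype κ]

theorem euclNorm_nonneg (v : ι → ℝ) : 0 ≤ euclNorm v := norm_nonneg _

theorem euclNorm_sq (v : ι → ℝ) : euclNorm v ^ 2 = v ⬝ᵥ v := by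
  simp [euclNorm, EuclideanSpace.norm_sq_eq, dotProduct, ← pow_two]

theorem dotProduct_self_nonneg' (v : ι → ℝ) : 0 ≤ v ⬝ᵥ v := by
  rw [← euclNorm_sq]; positivity

theorem dotProduct_self_pos {v : ι → ℝ} (hv : v ≠ 0) : 0 < v ⬝ᵥ v :=
  lt_of_le_of_ne (dotProduct_self_nonneg' v) fun h => hv (dotProduct_self_eq_zero.1 h.symm)

theorem euclNorm_eq_zero {v : ι → ℝ} : euclNorm v = 0 ↔ v = 0 := by
  simp [euclNorm]

theorem abs_dotProduct_le (v w : ι → ℝ) : |v ⬝ᵥ w| ≤ euclNorm v * euclNorm w := by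
  have := abs_real_inner_le_norm (WithLp.toLp 2 v : EuclideanSpace ℝ ι) (WithLp.toLp 2 w)
  simpa [euclNorm, PiLp.inner_apply, dotProduct, mul_comm] using this

theorem euclNorm_add_le (v w : ι → ℝ) : euclNorm (v + w) ≤ euclNorm v + euclNorm w :=
  norm_add_le (WithLp.toLp 2 v) (WithLp.toLp 2 w)

theorem euclNorm_neg (v : ι → ℝ) : euclNorm (-v) = euclNorm v :=
  norm_neg (WithLp.toLp 2 v)

theorem abs_apply_le_euclNorm (v : ι → ℝ) (i : ι) : |v i| ≤ euclNorm v :=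
  PiLp.norm_apply_le (WithLp.toLp 2 v : EuclideanSpace ℝ ι) i

theorem euclNorm_mulVec_le [DecidableEq ι] (M : Matrix κ ι ℝ) (v : ι → ℝ) :
    euclNorm (M *ᵥ v) ≤ ‖M‖ * euclNorm v :=
  M.l2_opNorm_mulVec (WithLp.toLp 2 v)

theorem norm_le_of_mulVec [DecidableEq ι] {M : Matrix κ ι ℝ} {c : ℝ} (hc : 0 ≤ c)
    (h : ∀ v, euclNorm (M *ᵥ v) ≤ c * euclNorm v) : ‖M‖ ≤ c := by
  rw [Matrix.l2_opNorm_def]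
  exact ContinuousLinearMap.opNorm_le_bound _ hc fun v => h v.ofLp

theorem norm_transpose [DecidableEq ι] [DecidableEq κ] (M : Matrix κ ι ℝ) : ‖Mᵀ‖ = ‖M‖ := by
  rw [← Matrix.conjTranspose_eq_transpose_of_trivial, Matrix.l2_opNorm_conjTranspose]

theorem abs_bilin_le [DecidableEq ι] (M : Matrix κ ι ℝ) (v : κ → ℝ) (w : ι → ℝ) :
    |v ⬝ᵥ M *ᵥ w| ≤ ‖M‖ * (euclNorm v * euclNorm w) := by
  calc _ ≤ euclNorm v * euclNorm (M *ᵥ w) := abs_dotProduct_le _ _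
    _ ≤ euclNorm v * (‖M‖ * euclNorm w) := by
      gcongr
      · exact euclNorm_nonneg v
      · exact euclNorm_mulVec_le M w
    _ = _ := by ring

theorem abs_quad_le [DecidableEq ι] (M : Matrix ι ι ℝ) (v : ι → ℝ) :
    |v ⬝ᵥ M *ᵥ v| ≤ ‖M‖ * (v ⬝ᵥ v) := by
  rw [← euclNorm_sq, pow_two]; exact abs_bilin_le M v v

theorem quad_le [DecidableEq ι] (M : Matrix ι ι ℝ) (v : ι → ℝ) :
    v ⬝ᵥ M *ᵥ v ≤ ‖M‖ * (v ⬝ᵥ v) := (le_abs_self _).trans (abs_quad_le M v)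

theorem bilin_symm {M : Matrix ι ι ℝ} (hM : Mᵀ = M) (v w : ι → ℝ) :
    v ⬝ᵥ M *ᵥ w = w ⬝ᵥ M *ᵥ v := by
  rw [Matrix.dotProduct_mulVec, ← Matrix.mulVec_transpose, hM, dotProduct_comm]

theorem quad_conj (M : Matrix ι ι ℝ) (C : Matrix ι κ ℝ) (v : κ → ℝ) :
    v ⬝ᵥ (Cᵀ * M * C) *ᵥ v = (C *ᵥ v) ⬝ᵥ M *ᵥ (C *ᵥ v) := by
  rw [Matrix.mul_assoc, ← Matrix.mulVec_mulVec, Matrix.dotProduct_mulVec, Matrix.vecMul_transpose,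
    ← Matrix.mulVec_mulVec]

/-- Polarization at v + w and v - w turns the bound on the form into 2 vᵀMw ≤ c (|v|² + |w|²).
Taking v = c⁻¹ M w then bounds |Mw|. -/
theorem norm_le_of_quad [DecidableEq ι] {M : Matrix ι ι ℝ} (hM : Mᵀ = M) {c : ℝ} (hc : 0 ≤ c)
    (h : ∀ v, |v ⬝ᵥ M *ᵥ v| ≤ c * (v ⬝ᵥ v)) : ‖M‖ ≤ c := by
  have key : ∀ v w : ι → ℝ, 2 * (v ⬝ᵥ M *ᵥ w) ≤ c * (v ⬝ᵥ v + w ⬝ᵥ w) := by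
    intro v w
    have h1 := (abs_le.1 (h (v + w))).2
    have h2 := (abs_le.1 (h (v - w))).1
    have h3 := bilin_symm hM v w
    simp only [Matrix.mulVec_add, Matrix.mulVec_sub, add_dotProduct, dotProduct_add,
      sub_dotProduct, dotProduct_sub, dotProduct_comm w v] at h1 h2
    linarith
  refine norm_le_of_mulVec hc fun w => ?_
  refine abs_le_of_sq_le_sq' ?_ (mul_nonneg hc (euclNorm_nonneg _)) |>.2
  rw [mul_pow, euclNorm_sq, euclNorm_sq]
  rcases hc.eq_or_lt with rfl | hc'
  · have := key (M *ᵥ w) w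
    linarith
  · have := key (c⁻¹ • (M *ᵥ w)) w
    simp only [smul_dotProduct, dotProduct_smul, smul_eq_mul] at this
    have h1 : c * (c * (c⁻¹ * (c⁻¹ * (M *ᵥ w ⬝ᵥ M *ᵥ w)) + w ⬝ᵥ w))
        = M *ᵥ w ⬝ᵥ M *ᵥ w + c ^ 2 * (w ⬝ᵥ w) := by field_simp
    have h2 : c * (2 * (c⁻¹ * (M *ᵥ w ⬝ᵥ M *ᵥ w))) = 2 * (M *ᵥ w ⬝ᵥ M *ᵥ w) := by field_simp
    have := mul_le_mul_of_nonneg_left this hc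
    linarith

omit [Fintype ι] in
theorem isHermitian_iff_transpose {M : Matrix ι ι ℝ} : M.IsHermitian ↔ Mᵀ = M := by
  rw [Matrix.IsHermitian, Matrix.conjTranspose_eq_transpose_of_trivial]

theorem posSemidef_of_quad {M : Matrix ι ι ℝ} (hM : Mᵀ = M) (h : ∀ v, 0 ≤ v ⬝ᵥ M *ᵥ v) :
    M.PosSemidef :=
  .of_dotProduct_mulVec_nonneg (isHermitian_iff_transpose.2 hM) fun v => by simpa using h v

theorem posDef_of_quad {M : Matrix ι ι ℝ} (hM : Mᵀ = M) (h : ∀ v, v ≠ 0 → 0 < v ⬝ᵥ M *ᵥ v) :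
    M.PosDef :=
  .of_dotProduct_mulVec_pos (isHermitian_iff_transpose.2 hM) fun v hv => by simpa using h v hv

theorem _root_.Matrix.PosSemidef.quad_nonneg {M : Matrix ι ι ℝ} (h : M.PosSemidef) (v : ι → ℝ) :
    0 ≤ v ⬝ᵥ M *ᵥ v := by simpa using h.dotProduct_mulVec_nonneg v

theorem _root_.Matrix.PosDef.quad_pos {M : Matrix ι ι ℝ} (h : M.PosDef) {v : ι → ℝ} (hv : v ≠ 0) :
    0 < v ⬝ᵥ M *ᵥ v := by simpa using h.dotProduct_mulVec_pos hv

omit [Fintype ι] in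
theorem _root_.Matrix.PosSemidef.transpose_eq {M : Matrix ι ι ℝ} (h : M.PosSemidef) : Mᵀ = M :=
  isHermitian_iff_transpose.1 h.1

theorem _root_.Matrix.PosSemidef.conj {M : Matrix ι ι ℝ} (h : M.PosSemidef) (C : Matrix ι κ ℝ) :
    (Cᵀ * M * C).PosSemidef := by
  simpa [Matrix.conjTranspose_eq_transpose_of_trivial] using h.conjTranspose_mul_mul_same C

theorem _root_.Matrix.PosSemidef.conj' {M : Matrix ι ι ℝ} (h : M.PosSemidef) (C : Matrix κ ι ℝ) :
    (C * M * Cᵀ).PosSemidef := by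
  simpa [Matrix.conjTranspose_eq_transpose_of_trivial] using h.mul_mul_conjTranspose_same C

theorem exists_eq_transpose_mul_self [DecidableEq ι] {M : Matrix ι ι ℝ} (h : M.PosSemidef) :
    ∃ C : Matrix ι ι ℝ, Cᵀ = C ∧ M = C * C := by
  refine ⟨CFC.sqrt M, ?_, (CFC.sqrt_mul_sqrt_self M h.nonneg).symm⟩
  exact (Matrix.nonneg_iff_posSemidef.1 (CFC.sqrt_nonneg M)).transpose_eq

theorem trace_mul_nonneg [DecidableEq ι] {M N : Matrix ι ι ℝ} (hM : M.PosSemidef)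
    (hN : N.PosSemidef) : 0 ≤ (M * N).trace := by
  obtain ⟨C, hC, rfl⟩ := exists_eq_transpose_mul_self hN
  rw [← Matrix.mul_assoc, Matrix.trace_mul_comm, ← Matrix.mul_assoc]
  have := (hM.conj C).trace_nonneg
  rwa [hC] at this

theorem trace_mul_conj (E F : Matrix κ ι ℝ) (M : Matrix ι ι ℝ) :
    (E * M * Fᵀ).trace = ∑ i, E i ⬝ᵥ M *ᵥ F i := by
  simp only [Matrix.trace, Matrix.diag_apply]
  refine Finset.sum_congr rfl fun i _ => ?_
  rw [Matrix.dotProduct_mulVec, Matrix.mul_apply]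
  simp [dotProduct, Matrix.vecMul, Matrix.mul_apply]

/-- With M = C C and C symmetric, the form is the sum of the squares of the products of v with the
rows of C, and the trace is the sum of the squared row norms. Cauchy-Schwarz is applied row by row.
-/
theorem quad_le_trace [DecidableEq ι] {M : Matrix ι ι ℝ} (hM : M.PosSemidef) (v : ι → ℝ) :
    v ⬝ᵥ M *ᵥ v ≤ M.trace * (v ⬝ᵥ v) := by
  obtain ⟨C, hC, rfl⟩ := exists_eq_transpose_mul_self hM
  have h1 : v ⬝ᵥ (C * C) *ᵥ v = ∑ i, (C i ⬝ᵥ v) ^ 2 := by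
    have := quad_conj 1 C v
    rw [hC, Matrix.mul_one, Matrix.one_mulVec] at this
    rw [this]
    simp [dotProduct, Matrix.mulVec, pow_two]
  have h2 : (C * C).trace = ∑ i, C i ⬝ᵥ C i := by
    have := trace_mul_conj C C 1
    simpa [hC] using this
  rw [h1, h2, Finset.sum_mul]
  refine Finset.sum_le_sum fun i _ => ?_
  have := abs_dotProduct_le (C i) v
  rw [← euclNorm_sq, ← euclNorm_sq, ← mul_pow]
  exact sq_le_sq' (abs_le.1 this).1 (abs_le.1 this).2

theorem norm_le_trace [DecidableEq ι] {M : Matrix ι ι ℝ} (hM : M.PosSemidef) : ‖M‖ ≤ M.trace :=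
  norm_le_of_quad hM.transpose_eq hM.trace_nonneg fun v => by
    rw [abs_of_nonneg (hM.quad_nonneg v)]; exact quad_le_trace hM v

theorem quad_one [DecidableEq ι] (c : ℝ) (v : ι → ℝ) :
    v ⬝ᵥ (c • (1 : Matrix ι ι ℝ)) *ᵥ v = c * (v ⬝ᵥ v) := by
  simp [Matrix.smul_mulVec]

/-- The trace of a product of two positive semidefinite matrices is nonnegative; here the second
factor is N - c. This lets an eigenvalue bound act inside a trace. -/
theorem mul_trace_le [DecidableEq ι] {M N : Matrix ι ι ℝ} (hM : M.PosSemidef) (hN : Nᵀ = N) {c : ℝ}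
    (h : ∀ v, c * (v ⬝ᵥ v) ≤ v ⬝ᵥ N *ᵥ v) : c * M.trace ≤ (M * N).trace := by
  have : (N - c • 1).PosSemidef := by
    refine posSemidef_of_quad (by simp [hN]) fun v => ?_
    rw [Matrix.sub_mulVec, dotProduct_sub, quad_one]
    linarith [h v]
  have := trace_mul_nonneg hM this
  simp [Matrix.mul_sub, Matrix.trace_sub] at this
  linarith

theorem trace_mul_le [DecidableEq ι] {M N : Matrix ι ι ℝ} (hM : M.PosSemidef) (hN : Nᵀ = N) {c : ℝ}
    (h : ∀ v, v ⬝ᵥ N *ᵥ v ≤ c * (v ⬝ᵥ v)) : (M * N).trace ≤ c * M.trace := by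
  have := mul_trace_le (N := -N) (c := -c) hM (by simp [hN]) fun v => by
    simp [Matrix.neg_mulVec]; exact h v
  simp at this
  linarith

theorem trace_mul_mono [DecidableEq ι] {M N N' : Matrix ι ι ℝ} (hM : M.PosSemidef)
    (h : (N' - N).PosSemidef) : (M * N).trace ≤ (M * N').trace := by
  have := trace_mul_nonneg hM h
  rw [Matrix.mul_sub, Matrix.trace_sub] at this
  linarith

end Euclid

/-! ### The minimum eigenvalue as an optimal constant. -/

section MinEig

variable {ι : Type*} [Fintype ι] [DecidableEq ι] [Nonempty ι] {M N : Matrix ι ι ℝ}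

/-- The spectrum is finite and, as the index type is nonempty, nonempty, so the infimum bounds it
sharply. By the functional calculus, a lower bound c on the spectrum is the Loewner inequality c ≤
M. -/
theorem le_minEig_iff (hM : Mᵀ = M) {c : ℝ} :
    c ≤ minEig M ↔ ∀ v, c * (v ⬝ᵥ v) ≤ v ⬝ᵥ M *ᵥ v := by
  have hH := isHermitian_iff_transpose.2 hM
  have hfin : (spectrum ℝ M).Finite := by
    rw [hH.spectrum_real_eq_range_eigenvalues]; exact Set.finite_range _
  have hne : (spectrum ℝ M).Nonempty := by
    rw [hH.spectrum_real_eq_range_eigenvalues]; exact Set.range_nonempty _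
  rw [minEig, le_csInf_iff hfin.bddBelow hne]
  have h1 : (∀ b ∈ spectrum ℝ M, c ≤ b) ↔ algebraMap ℝ (Matrix ι ι ℝ) c ≤ M :=
    (algebraMap_le_iff_le_spectrum (p := IsSelfAdjoint) hH).symm
  rw [h1, Matrix.le_iff]
  constructor
  · intro h v
    have := h.quad_nonneg v
    rw [Matrix.sub_mulVec, dotProduct_sub, Algebra.algebraMap_eq_smul_one, quad_one] at this
    linarith
  · intro h
    refine posSemidef_of_quad (by simp [hM, Algebra.algebraMap_eq_smul_one]) fun v => ?_
    rw [Matrix.sub_mulVec, dotProduct_sub, Algebra.algebraMap_eq_smul_one, quad_one]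
    linarith [h v]

theorem minEig_mul_le (hM : Mᵀ = M) (v : ι → ℝ) : minEig M * (v ⬝ᵥ v) ≤ v ⬝ᵥ M *ᵥ v :=
  (le_minEig_iff hM).1 le_rfl v

theorem minEig_pos (hM : M.PosDef) : 0 < minEig M := by
  have hH := hM.1
  have hfin : (spectrum ℝ M).Finite := by
    rw [hH.spectrum_real_eq_range_eigenvalues]; exact Set.finite_range _
  have hne : (spectrum ℝ M).Nonempty := by
    rw [hH.spectrum_real_eq_range_eigenvalues]; exact Set.range_nonempty _
  have h1 : minEig M ∈ spectrum ℝ M := hne.csInf_mem hfin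
  rw [hH.spectrum_real_eq_range_eigenvalues] at h1
  obtain ⟨i, hi⟩ := h1
  rw [← hi]
  exact hM.eigenvalues_pos i

theorem minEig_le_of_quad (hM : Mᵀ = M) {c : ℝ} {v : ι → ℝ} (hv : v ≠ 0)
    (h : v ⬝ᵥ M *ᵥ v ≤ c * (v ⬝ᵥ v)) : minEig M ≤ c :=
  le_of_mul_le_mul_right ((minEig_mul_le hM v).trans h) (dotProduct_self_pos hv)

theorem minEig_le_norm (hM : Mᵀ = M) : minEig M ≤ ‖M‖ :=
  minEig_le_of_quad hM (v := 1) one_ne_zero (quad_le M 1)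

/-- Weyl's inequality; used in both directions it makes the minimum eigenvalue 1-Lipschitz. -/
theorem minEig_sub_norm_le (hM : Mᵀ = M) (hN : Nᵀ = N) : minEig M - ‖N - M‖ ≤ minEig N := by
  rw [le_minEig_iff hN]
  intro v
  have h1 := minEig_mul_le hM v
  have h2 := (abs_le.1 (abs_quad_le (N - M) v)).1
  rw [Matrix.sub_mulVec, dotProduct_sub] at h2
  linarith

end MinEig

theorem tendsto_matrix_iff {α 𝕜 ι κ : Type*} [RCLike 𝕜] [Fintype ι] [Fintype κ] [DecidableEq κ]
    {f : α → Matrix ι κ 𝕜} {l : Filter α} {M : Matrix ι κ 𝕜} :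
    Tendsto f l (𝓝 M) ↔ ∀ i j, Tendsto (fun a => f a i j) l (𝓝 (M i j)) :=
  ⟨fun h i j => tendsto_pi_nhds.1 (tendsto_pi_nhds.1 h i) j,
    fun h => tendsto_pi_nhds.2 fun i => tendsto_pi_nhds.2 fun j => h i j⟩

/-! ### Stable matrices and the discrete Lyapunov equation. -/

section Stability

variable {ι : Type*} [Fintype ι] [DecidableEq ι] {D : Matrix ι ι ℝ}

/-- The powers of the matrix tend to zero. -/
def PowStable (D : Matrix ι ι ℝ) : Prop := Tendsto (fun k : ℕ => D ^ k) atTop (𝓝 0)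

/-- Gelfand's formula: if the spectral radius is below r < 1, then eventually ‖Dᵏ‖ ≤ rᵏ. Conversely
one power of norm below 1 suffices, because its root bounds the spectral radius. -/
theorem isStable_iff_powStable {n : ℕ} [NeZero n] {D : Matrix (Fin n) (Fin n) ℝ} :
    IsStable D ↔ PowStable D := by
  have hmap : ∀ k, (D.map (algebraMap ℝ ℂ)) ^ k = (D ^ k).map (algebraMap ℝ ℂ) := fun k => by
    simpa using (map_pow (RingHom.mapMatrix (algebraMap ℝ ℂ)) D k).symm
  constructor
  · intro h
    obtain ⟨r, hr0, hr1⟩ := ENNReal.lt_iff_exists_nnreal_btwn.1 h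
    have hr1' : r < 1 := by exact_mod_cast hr1
    have h1 := spectrum.pow_nnnorm_pow_one_div_tendsto_nhds_spectralRadius
      (D.map (algebraMap ℝ ℂ))
    have h2 : ∀ᶠ k : ℕ in atTop, ‖(D.map (algebraMap ℝ ℂ)) ^ k‖ ≤ (r : ℝ) ^ k := by
      filter_upwards [h1.eventually (gt_mem_nhds hr0), eventually_gt_atTop 0] with k hk hk0
      have hk0' : (k : ℝ) ≠ 0 := by positivity
      have := ENNReal.rpow_le_rpow hk.le (Nat.cast_nonneg (α := ℝ) k)
      rw [← ENNReal.rpow_mul, one_div, inv_mul_cancel₀ hk0', ENNReal.rpow_one,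
        ENNReal.rpow_natCast] at this
      have : ‖(D.map (algebraMap ℝ ℂ)) ^ k‖₊ ≤ r ^ k := by exact_mod_cast this
      exact_mod_cast this
    have h3 : Tendsto (fun k : ℕ => (D.map (algebraMap ℝ ℂ)) ^ k) atTop (𝓝 0) :=
      squeeze_zero_norm' h2 (tendsto_pow_atTop_nhds_zero_of_lt_one r.2 (by exact_mod_cast hr1'))
    rw [PowStable, tendsto_matrix_iff]
    intro i j
    have h4 := ((Complex.continuous_re.tendsto _).comp
      (tendsto_matrix_iff.1 h3 i j))
    simp only [Function.comp_def, hmap] at h4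
    simpa using h4
  · intro h
    have h3 : Tendsto (fun k : ℕ => (D.map (algebraMap ℝ ℂ)) ^ k) atTop (𝓝 0) := by
      rw [tendsto_matrix_iff]
      intro i j
      have h4 := ((Complex.continuous_ofReal.tendsto _).comp
        (tendsto_matrix_iff.1 h i j))
      simp only [hmap]
      simpa [Function.comp_def] using h4
    -- The shift by one avoids the exponent zero, for which no root can be taken.
    have h4 := ((tendsto_norm_zero.comp h3).comp (tendsto_add_atTop_nat 1)).eventually
      (gt_mem_nhds one_pos)
    obtain ⟨k, hk⟩ := h4.exists
    have h5 := spectrum.spectralRadius_le_pow_nnnorm_pow_one_div ℂ (D.map (algebraMap ℝ ℂ)) k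
    have h6 : ‖(1 : Matrix (Fin n) (Fin n) ℂ)‖₊ = 1 := by
      ext; simp
    rw [h6] at h5
    refine h5.trans_lt ?_
    simp only [ENNReal.coe_one, ENNReal.one_rpow, mul_one]
    refine ENNReal.rpow_lt_one ?_ (by positivity)
    have : ‖D.map (algebraMap ℝ ℂ) ^ (k + 1)‖₊ < 1 := by
      rw [← NNReal.coe_lt_coe]; simpa using hk
    exact_mod_cast this

theorem PowStable.transpose (h : PowStable D) : PowStable Dᵀ := by
  have := (continuous_id.matrix_transpose.tendsto _).comp h
  simpa [PowStable, Function.comp_def, Matrix.transpose_pow] using this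

theorem PowStable.tendsto_mulVec (h : PowStable D) (v : ι → ℝ) :
    Tendsto (fun k => (D ^ k) *ᵥ v) atTop (𝓝 0) := by
  have h1 : Continuous fun M : Matrix ι ι ℝ => M *ᵥ v :=
    continuous_id.matrix_mulVec continuous_const
  simpa [Function.comp_def] using (h1.tendsto 0).comp h

theorem PowStable.tendsto_quad (h : PowStable D) (Y : Matrix ι ι ℝ) (v : ι → ℝ) :
    Tendsto (fun k => ((D ^ k) *ᵥ v) ⬝ᵥ Y *ᵥ ((D ^ k) *ᵥ v)) atTop (𝓝 0) := by
  have h2 : Continuous fun w : ι → ℝ => w ⬝ᵥ Y *ᵥ w :=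
    continuous_id.dotProduct (continuous_const.matrix_mulVec continuous_id)
  have h3 := (h2.tendsto 0).comp (h.tendsto_mulVec v)
  rwa [Matrix.mulVec_zero, dotProduct_zero] at h3

/-- Comparison principle: the form of Y does not increase along the orbit Dᵏv and tends to 0 there,
so it is nonnegative at v. -/
theorem PowStable.posSemidef (h : PowStable D) {Y : Matrix ι ι ℝ} (hY : Yᵀ = Y)
    (hD : (Y - Dᵀ * Y * D).PosSemidef) : Y.PosSemidef := by
  refine posSemidef_of_quad hY fun v => ?_
  have hstep : ∀ k, ((D ^ k) *ᵥ v) ⬝ᵥ Y *ᵥ ((D ^ k) *ᵥ v) ≤ v ⬝ᵥ Y *ᵥ v := by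
    intro k
    induction k with
    | zero => simp
    | succ k ih =>
      refine le_trans ?_ ih
      have := hD.quad_nonneg ((D ^ k) *ᵥ v)
      rw [Matrix.sub_mulVec, dotProduct_sub, quad_conj, Matrix.mulVec_mulVec v D, ← pow_succ'] at this
      linarith
  exact le_of_tendsto (h.tendsto_quad Y v) (Eventually.of_forall hstep)

theorem PowStable.eq_zero (h : PowStable D) {Y : Matrix ι ι ℝ} (hY : Y = Dᵀ * Y * D) : Y = 0 := by
  have hk : ∀ k : ℕ, Y = (Dᵀ) ^ k * Y * D ^ k := by
    intro k
    induction k with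
    | zero => simp
    | succ k ih =>
      calc Y = (Dᵀ) ^ k * (Dᵀ * Y * D) * D ^ k := by rw [← hY, ← ih]
        _ = _ := by rw [pow_succ, pow_succ']; simp only [Matrix.mul_assoc]
  have h1 : Tendsto (fun k : ℕ => (Dᵀ) ^ k * Y * D ^ k) atTop (𝓝 0) := by
    have h2 : Tendsto (fun k : ℕ => (Dᵀ) ^ k * Y) atTop (𝓝 (0 * Y)) :=
      (show Tendsto _ _ _ from h.transpose).mul tendsto_const_nhds
    have h3 := h2.mul h
    simpa using h3
  refine tendsto_nhds_unique ?_ h1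
  simp_rw [← hk]
  exact tendsto_const_nhds

theorem PowStable.eq_zero_of_mulVec (h : PowStable D) {y : ι → ℝ} (hy : y = D *ᵥ y) : y = 0 := by
  have hk : ∀ k : ℕ, (D ^ k) *ᵥ y = y := by
    intro k
    induction k with
    | zero => simp
    | succ k ih => rw [pow_succ, ← Matrix.mulVec_mulVec, ← hy, ih]
  refine tendsto_nhds_unique ?_ (h.tendsto_mulVec y)
  simp_rw [hk]
  exact tendsto_const_nhds

theorem PowStable.isUnit_one_sub (h : PowStable D) : IsUnit (1 - D) := by
  rw [← Matrix.mulVec_injective_iff_isUnit]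
  intro v w hvw
  have : v - w = D *ᵥ (v - w) := by
    simp only [Matrix.sub_mulVec, Matrix.one_mulVec] at hvw
    rw [Matrix.mulVec_sub]
    have := congrArg (fun z => z + D *ᵥ v - w) hvw
    simp only [sub_add_cancel] at this
    rw [this]; abel
  exact sub_eq_zero.1 (h.eq_zero_of_mulVec this)

/-- An injective linear endomorphism in finite dimension is surjective, so no series has to be
summed. Injectivity is the uniqueness statement `PowStable.eq_zero`. -/
theorem PowStable.exists_lyap (h : PowStable D) (F : Matrix ι ι ℝ) :
    ∃ Y, Y = F + Dᵀ * Y * D := by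
  let T : Matrix ι ι ℝ →ₗ[ℝ] Matrix ι ι ℝ :=
    { toFun := fun Y => Y - Dᵀ * Y * D
      map_add' := fun Y Z => by simp only [Matrix.mul_add, Matrix.add_mul]; abel
      map_smul' := fun c Y => by simp [smul_sub] }
  have hT : Function.Injective T := by
    rw [← LinearMap.ker_eq_bot, LinearMap.ker_eq_bot']
    intro Y hY
    exact h.eq_zero (sub_eq_zero.1 hY)
  obtain ⟨Y, hY⟩ := LinearMap.injective_iff_surjective.1 hT F
  refine ⟨Y, ?_⟩
  rw [← hY]
  change Y = Y - Dᵀ * Y * D + Dᵀ * Y * D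
  abel

/-- The solution `Y` of the discrete Lyapunov equation `Y = F + Dᵀ Y D`. -/
def lyap (D F : Matrix ι ι ℝ) : Matrix ι ι ℝ := Classical.epsilon fun Y => Y = F + Dᵀ * Y * D

theorem PowStable.lyap_eq (h : PowStable D) (F : Matrix ι ι ℝ) :
    lyap D F = F + Dᵀ * lyap D F * D := Classical.epsilon_spec (h.exists_lyap F)

theorem PowStable.lyap_unique (h : PowStable D) {F Y : Matrix ι ι ℝ} (hY : Y = F + Dᵀ * Y * D) :
    Y = lyap D F := by
  refine sub_eq_zero.1 (h.eq_zero ?_)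
  conv_lhs => rw [hY, h.lyap_eq F]
  simp only [Matrix.mul_sub, Matrix.sub_mul]
  abel

theorem PowStable.lyap_transpose (h : PowStable D) {F : Matrix ι ι ℝ} (hF : Fᵀ = F) :
    (lyap D F)ᵀ = lyap D F := by
  refine h.lyap_unique ?_
  conv_lhs => rw [h.lyap_eq F]
  simp [Matrix.transpose_mul, hF, Matrix.mul_assoc]

/-- A supersolution of the Lyapunov equation dominates the solution. -/
theorem PowStable.sub_lyap_posSemidef (h : PowStable D) {F Y : Matrix ι ι ℝ} (hF : Fᵀ = F)
    (hY : Yᵀ = Y) (hD : (Y - Dᵀ * Y * D - F).PosSemidef) : (Y - lyap D F).PosSemidef := by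
  refine h.posSemidef (by simp [hY, h.lyap_transpose hF]) ?_
  convert hD using 1
  have := h.lyap_eq F
  simp only [Matrix.mul_sub, Matrix.sub_mul]
  nth_rewrite 1 [this]
  abel

theorem PowStable.lyap_posSemidef (h : PowStable D) {F : Matrix ι ι ℝ} (hF : F.PosSemidef) :
    (lyap D F).PosSemidef := by
  refine h.posSemidef (h.lyap_transpose hF.transpose_eq) ?_
  convert hF using 1
  nth_rewrite 1 [h.lyap_eq F]
  abel

theorem PowStable.lyap_sub_self_posSemidef (h : PowStable D) {F : Matrix ι ι ℝ}
    (hF : F.PosSemidef) : (lyap D F - F).PosSemidef := by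
  have := (h.lyap_posSemidef hF).conj D
  convert this using 1
  nth_rewrite 1 [h.lyap_eq F]
  abel

/-- The operators Y ↦ Y - DᵀYD and S ↦ S - DSDᵀ are adjoint for the trace pairing. This duality
exchanges value matrices and covariances. -/
theorem PowStable.trace_lyap_mul (h : PowStable D) (F G : Matrix ι ι ℝ) :
    (lyap D F * G).trace = (F * lyap Dᵀ G).trace := by
  have h1 := h.lyap_eq F
  have h2 := h.transpose.lyap_eq G
  rw [Matrix.transpose_transpose] at h2
  set P := lyap D F
  set S := lyap Dᵀ G
  have h3 : F = P - Dᵀ * P * D := by rw [eq_sub_iff_add_eq, ← h1]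
  have h4 : G = S - D * S * Dᵀ := by rw [eq_sub_iff_add_eq, ← h2]
  rw [h3, h4, Matrix.mul_sub, Matrix.sub_mul, Matrix.trace_sub, Matrix.trace_sub]
  congr 1
  rw [← Matrix.mul_assoc, Matrix.trace_mul_comm]
  simp only [Matrix.mul_assoc]

/-- Both F and -F lie below ‖F‖·1, so ‖F‖ times the solution with right side 1 is a supersolution
for each. -/
theorem PowStable.norm_lyap_le (h : PowStable D) {F : Matrix ι ι ℝ} (hF : Fᵀ = F) :
    ‖lyap D F‖ ≤ ‖F‖ * ‖lyap D 1‖ := by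
  have h1 := h.lyap_posSemidef (F := 1) Matrix.PosSemidef.one
  have hb := fun v => abs_le.1 (abs_quad_le F v)
  have key : ∀ G : Matrix ι ι ℝ, Gᵀ = G → (∀ v, v ⬝ᵥ G *ᵥ v ≤ ‖F‖ * (v ⬝ᵥ v)) →
      (‖F‖ • lyap D 1 - lyap D G).PosSemidef := fun G hG hv => by
    refine h.sub_lyap_posSemidef hG (by simp [h1.transpose_eq]) ?_
    have : ‖F‖ • lyap D 1 - Dᵀ * ‖F‖ • lyap D 1 * D - G = ‖F‖ • 1 - G := by
      nth_rewrite 1 [h.lyap_eq 1]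
      simp [smul_add]
    rw [this]
    refine posSemidef_of_quad (by simp [hG]) fun v => ?_
    rw [Matrix.sub_mulVec, dotProduct_sub, quad_one]
    linarith [hv v]
  have hneg : lyap D (-F) = - lyap D F := by
    refine (h.lyap_unique ?_).symm
    conv_lhs => rw [h.lyap_eq F]
    simp; abel
  refine norm_le_of_quad (h.lyap_transpose hF) (by positivity) fun v => ?_
  have k1 := (key F hF fun v => (hb v).2).quad_nonneg v
  have k2 := (key (-F) (by simp [hF]) fun v => by
    rw [Matrix.neg_mulVec, dotProduct_neg]; linarith [(hb v).1]).quad_nonneg v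
  have k3 := mul_le_mul_of_nonneg_left (quad_le (lyap D 1) v) (norm_nonneg F)
  rw [hneg] at k2
  simp only [Matrix.sub_mulVec, dotProduct_sub, Matrix.smul_mulVec, dotProduct_smul, smul_eq_mul,
    Matrix.neg_mulVec, dotProduct_neg] at k1 k2
  rw [abs_le]
  constructor <;> nlinarith

/-- The weights along an orbit sum to at most vᵀPv and hence tend to 0. A window of N consecutive
weights dominates |Dᵏv|², so the orbit tends to 0 as well. Observability over the window replaces
definiteness of M. -/
theorem powStable_of_lyapunov {P M : Matrix ι ι ℝ} (hP : P.PosSemidef) (hM : M.PosSemidef)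
    (h : (P - Dᵀ * P * D - M).PosSemidef) {N : ℕ} {c : ℝ} (hc : 0 < c)
    (hN : ∀ v, c * (v ⬝ᵥ v) ≤ ∑ j ∈ Finset.range N, (D ^ j *ᵥ v) ⬝ᵥ M *ᵥ (D ^ j *ᵥ v)) :
    PowStable D := by
  have hvec : ∀ v, Tendsto (fun k : ℕ => (D ^ k *ᵥ v) ⬝ᵥ (D ^ k *ᵥ v)) atTop (𝓝 0) := by
    intro v
    set a : ℕ → ℝ := fun k => (D ^ k *ᵥ v) ⬝ᵥ M *ᵥ (D ^ k *ᵥ v) with ha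
    have ha0 : ∀ k, 0 ≤ a k := fun k => hM.quad_nonneg _
    have hsum : ∀ T, ∑ k ∈ Finset.range T, a k + (D ^ T *ᵥ v) ⬝ᵥ P *ᵥ (D ^ T *ᵥ v)
        ≤ v ⬝ᵥ P *ᵥ v := by
      intro T
      induction T with
      | zero => simp
      | succ T ih =>
        have := h.quad_nonneg ((D ^ T) *ᵥ v)
        rw [Matrix.sub_mulVec, Matrix.sub_mulVec, dotProduct_sub, dotProduct_sub, quad_conj,
          Matrix.mulVec_mulVec v D, ← pow_succ'] at this
        rw [Finset.sum_range_succ]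
        simp only [ha] at *
        linarith
    have hs : Summable a := summable_of_sum_range_le (c := v ⬝ᵥ P *ᵥ v) ha0 fun T => by
      linarith [hsum T, hP.quad_nonneg (D ^ T *ᵥ v)]
    have hlim : Tendsto (fun k => ∑ j ∈ Finset.range N, a (j + k)) atTop (𝓝 0) := by
      have : Tendsto (fun k => ∑ j ∈ Finset.range N, a (j + k)) atTop
          (𝓝 (∑ j ∈ Finset.range N, 0)) :=
        tendsto_finsetSum _ fun j _ => by
          simpa [add_comm, Function.comp_def] using hs.tendsto_atTop_zero.comp (tendsto_add_atTop_nat j)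
      simpa using this
    have hlim' : Tendsto (fun k => c⁻¹ * ∑ j ∈ Finset.range N, a (j + k)) atTop (𝓝 0) := by
      simpa using hlim.const_mul c⁻¹
    refine squeeze_zero (fun k => dotProduct_self_nonneg' _) (fun k => ?_) hlim'
    have h1 := hN (D ^ k *ᵥ v)
    have e : ∀ j, D ^ j *ᵥ (D ^ k *ᵥ v) = D ^ (j + k) *ᵥ v := fun j => by
      rw [Matrix.mulVec_mulVec, pow_add]
    simp only [e] at h1
    rw [le_inv_mul_iff₀ hc]
    exact h1
  rw [PowStable, tendsto_matrix_iff]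
  intro i j
  have h2 := (Real.continuous_sqrt.tendsto 0).comp (hvec (Pi.single j 1))
  rw [Real.sqrt_zero] at h2
  refine squeeze_zero_norm (fun k => ?_) h2
  have h3 := abs_apply_le_euclNorm (D ^ k *ᵥ Pi.single j 1) i
  simp only [Function.comp_apply]
  rw [← euclNorm_sq, Real.sqrt_sq (euclNorm_nonneg _)]
  simpa using h3

theorem powStable_of_sub_posDef {P : Matrix ι ι ℝ} (hP : P.PosSemidef) {c : ℝ} (hc : 0 < c)
    (h : ∀ v, (D *ᵥ v) ⬝ᵥ P *ᵥ (D *ᵥ v) ≤ v ⬝ᵥ P *ᵥ v - c * (v ⬝ᵥ v)) : PowStable D := by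
  refine powStable_of_lyapunov (M := c • 1) (N := 1) (c := c) hP
    (Matrix.PosSemidef.one.smul hc.le) ?_ hc fun v => ?_
  · refine posSemidef_of_quad ?_ fun v => ?_
    · simp [hP.transpose_eq, Matrix.mul_assoc]
    · rw [Matrix.sub_mulVec, Matrix.sub_mulVec, dotProduct_sub, dotProduct_sub, quad_conj, quad_one]
      linarith [h v]
  · simp [Matrix.smul_mulVec]

theorem PowStable.quad_lyap_one (h : PowStable D) (v : ι → ℝ) :
    (D *ᵥ v) ⬝ᵥ lyap D 1 *ᵥ (D *ᵥ v) = v ⬝ᵥ lyap D 1 *ᵥ v - v ⬝ᵥ v := by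
  have : v ⬝ᵥ lyap D 1 *ᵥ v = v ⬝ᵥ (1 + Dᵀ * lyap D 1 * D) *ᵥ v := by rw [← h.lyap_eq 1]
  rw [this, Matrix.add_mulVec, dotProduct_add, quad_conj, Matrix.one_mulVec]
  ring

/-- The solution L for the right side 1 satisfies L ≥ 1, so |Dv|² ≤ (Dv)ᵀL(Dv) = vᵀLv - |v|². -/
theorem PowStable.norm_sq_le (h : PowStable D) : ‖D‖ ^ 2 ≤ ‖lyap D 1‖ := by
  have h1 := h.lyap_posSemidef (F := 1) Matrix.PosSemidef.one
  have h2 := h.lyap_sub_self_posSemidef (F := 1) Matrix.PosSemidef.one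
  refine Real.le_sqrt (norm_nonneg _) (norm_nonneg _) |>.1 ?_
  refine norm_le_of_mulVec (Real.sqrt_nonneg _) fun v => ?_
  refine abs_le_of_sq_le_sq' ?_ (mul_nonneg (Real.sqrt_nonneg _) (euclNorm_nonneg _)) |>.2
  rw [mul_pow, euclNorm_sq, euclNorm_sq, Real.sq_sqrt (norm_nonneg _)]
  have h3 := h2.quad_nonneg (D *ᵥ v)
  rw [Matrix.sub_mulVec, dotProduct_sub, Matrix.one_mulVec, h.quad_lyap_one] at h3
  linarith [quad_le (lyap D 1) v, dotProduct_self_nonneg' v]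

/-- Stability is robust: the Lyapunov matrix of `D` certifies the stability of nearby matrices. -/
theorem PowStable.perturb (h : PowStable D) {D' : Matrix ι ι ℝ}
    (hD : ‖D' - D‖ * (2 * ‖D‖ + ‖D' - D‖) * ‖lyap D 1‖ ≤ 1 / 2) :
    PowStable D' ∧ ‖lyap D' 1‖ ≤ 2 * ‖lyap D 1‖ := by
  have hS := h.lyap_posSemidef (F := 1) Matrix.PosSemidef.one
  -- Along D the form of L drops by exactly |v|². With y = (D' - D)v, the cross term 2 (Dv)ᵀLy and
  -- the square yᵀLy give back at most half of it.
  have key : ∀ v, (D' *ᵥ v) ⬝ᵥ lyap D 1 *ᵥ (D' *ᵥ v)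
      ≤ v ⬝ᵥ lyap D 1 *ᵥ v - 1 / 2 * (v ⬝ᵥ v) := by
    intro v
    set y := (D' - D) *ᵥ v with hy
    have e1 : D' *ᵥ v = D *ᵥ v + y := by rw [hy, Matrix.sub_mulVec]; abel
    have h1 := h.quad_lyap_one v
    have h2 := (abs_le.1 (abs_bilin_le (lyap D 1) (D *ᵥ v) y)).2
    have h3 := quad_le (lyap D 1) y
    have h4 : euclNorm y ≤ ‖D' - D‖ * euclNorm v := euclNorm_mulVec_le _ _
    have h5 : euclNorm (D *ᵥ v) ≤ ‖D‖ * euclNorm v := euclNorm_mulVec_le _ _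
    have h6 := bilin_symm hS.transpose_eq y (D *ᵥ v)
    rw [e1, Matrix.mulVec_add, dotProduct_add, add_dotProduct, add_dotProduct, h1, h6]
    have b1 : euclNorm (D *ᵥ v) * euclNorm y ≤ (‖D‖ * euclNorm v) * (‖D' - D‖ * euclNorm v) :=
      mul_le_mul h5 h4 (euclNorm_nonneg _) (by have := euclNorm_nonneg v; positivity)
    have b2 : y ⬝ᵥ y ≤ (‖D' - D‖ * euclNorm v) ^ 2 := by
      rw [← euclNorm_sq]; exact pow_le_pow_left₀ (euclNorm_nonneg _) h4 2
    have b3 := mul_le_mul_of_nonneg_left b1 (norm_nonneg (lyap D 1))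
    have b4 := mul_le_mul_of_nonneg_left b2 (norm_nonneg (lyap D 1))
    have b5 := mul_le_mul_of_nonneg_right hD (dotProduct_self_nonneg' v)
    rw [← euclNorm_sq v] at *
    nlinarith
  have hst : PowStable D' := powStable_of_sub_posDef hS (by norm_num : (0 : ℝ) < 1 / 2) key
  refine ⟨hst, ?_⟩
  have h1 := hst.lyap_posSemidef (F := 1) Matrix.PosSemidef.one
  -- Since L drops by half of |v|² along D', the matrix 2L is a supersolution for D'.
  have h2 : ((2 : ℝ) • lyap D 1 - lyap D' 1).PosSemidef := by
    refine hst.sub_lyap_posSemidef (by simp) (by simp [hS.transpose_eq]) ?_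
    refine posSemidef_of_quad (by simp [hS.transpose_eq, Matrix.mul_assoc]) fun v => ?_
    rw [Matrix.sub_mulVec, Matrix.sub_mulVec, dotProduct_sub, dotProduct_sub, quad_conj]
    simp only [Matrix.smul_mulVec, dotProduct_smul, smul_eq_mul, Matrix.one_mulVec]
    linarith [key v]
  refine norm_le_of_quad h1.transpose_eq (by positivity) fun v => ?_
  have h3 := h2.quad_nonneg v
  rw [Matrix.sub_mulVec, dotProduct_sub, Matrix.smul_mulVec, dotProduct_smul, smul_eq_mul] at h3
  rw [abs_of_nonneg (h1.quad_nonneg v)]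
  linarith [quad_le (lyap D 1) v]

/-- Substituting Dy = y - f in the identity for L gives |y|² = 2 yᵀLf - fᵀLf ≤ 2 ‖L‖ |y| |f|. -/
theorem PowStable.euclNorm_le_of_eq (h : PowStable D) {y f : ι → ℝ} (hy : y = D *ᵥ y + f) :
    euclNorm y ≤ 2 * ‖lyap D 1‖ * euclNorm f := by
  have hS := h.lyap_posSemidef (F := 1) Matrix.PosSemidef.one
  have h1 := h.quad_lyap_one y
  have h2 : D *ᵥ y = y - f := by rw [eq_sub_iff_add_eq, ← hy]
  have h3 := (abs_le.1 (abs_bilin_le (lyap D 1) y f)).2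
  have h4 := bilin_symm hS.transpose_eq f y
  have h5 := hS.quad_nonneg f
  rw [h2, Matrix.mulVec_sub, dotProduct_sub, sub_dotProduct, sub_dotProduct, h4,
    ← euclNorm_sq] at h1
  rcases (euclNorm_nonneg y).eq_or_lt with h0 | h0
  · rw [← h0]; have := euclNorm_nonneg f; positivity
  · refine le_of_mul_le_mul_right ?_ h0
    nlinarith

theorem PowStable.mulVec_inv_eq (h : PowStable D) (b : ι → ℝ) :
    (1 - D)⁻¹ *ᵥ b = D *ᵥ ((1 - D)⁻¹ *ᵥ b) + b := by
  have h1 : (1 - D) *ᵥ ((1 - D)⁻¹ *ᵥ b) = b := by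
    rw [Matrix.mulVec_mulVec, Matrix.mul_nonsing_inv _ ((Matrix.isUnit_iff_isUnit_det _).1
      h.isUnit_one_sub), Matrix.one_mulVec]
  rw [Matrix.sub_mulVec, Matrix.one_mulVec] at h1
  exact (sub_eq_iff_eq_add'.1 h1)

theorem PowStable.trace_lyap_one (h : PowStable D) :
    (lyap Dᵀ (1 : Matrix ι ι ℝ)).trace = (lyap D 1).trace := by
  simpa using (h.trace_lyap_mul 1 1).symm

end Stability

/-! ### The extended state and the exact cost difference. -/

section Blocks

variable {n : ℕ}

/-- The matrix `S` as the upper left block of a matrix of one more dimension. -/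
def hat (S : Matrix (Fin n) (Fin n) ℝ) : Matrix (Fin n ⊕ Unit) (Fin n ⊕ Unit) ℝ :=
  Matrix.fromBlocks S 0 0 0

theorem fromBlocks_sub {ι κ : Type*} (A A' : Matrix ι ι ℝ) (B B' : Matrix ι κ ℝ)
    (C C' : Matrix κ ι ℝ) (D D' : Matrix κ κ ℝ) :
    Matrix.fromBlocks A B C D - Matrix.fromBlocks A' B' C' D'
      = Matrix.fromBlocks (A - A') (B - B') (C - C') (D - D') := by
  ext (i | i) (j | j) <;> rfl

end Blocks

namespace Model

variable {n m : ℕ} {Ω : Type*} [MeasurableSpace Ω] (M : Model n m Ω)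

/-- The closed-loop matrix `A - B K`. -/
def cl (X : Policy n m) : Matrix (Fin n) (Fin n) ℝ := M.A - M.B * X.gain

theorem mem_stabilizing_iff [NeZero n] {X : Policy n m} :
    X ∈ M.stabilizing ↔ PowStable (M.cl X) := isStable_iff_powStable

/-- The constant drift of the closed loop. -/
def drift (X : Policy n m) : Fin n → ℝ := M.B *ᵥ X.offset + M.wbar

/-- The stationary mean of the closed loop. -/
def xbar (X : Policy n m) : Fin n → ℝ := (1 - M.cl X)⁻¹ *ᵥ M.drift X

/-- The stationary covariance of the closed loop. -/
def cov (X : Policy n m) : Matrix (Fin n) (Fin n) ℝ := lyap (M.cl X)ᵀ M.W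

/-- The state matrix of the dynamics of `[x; -1]`. -/
def augA : Matrix (Fin n ⊕ Unit) (Fin n ⊕ Unit) ℝ :=
  Matrix.fromBlocks M.A (Matrix.replicateCol Unit (-M.wbar)) 0 1

/-- The input matrix of the dynamics of `[x; -1]`. -/
def augB : Matrix (Fin n ⊕ Unit) (Fin m) ℝ := Matrix.fromRows M.B 0

/-- The closed-loop matrix of the dynamics of `[x; -1]`. -/
def augCl (X : Policy n m) : Matrix (Fin n ⊕ Unit) (Fin n ⊕ Unit) ℝ := M.augA - M.augB * X

/-- The weight of `[x; -1]` in the Lagrangian. -/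
def augQ (μ : ℝ) : Matrix (Fin n ⊕ Unit) (Fin n ⊕ Unit) ℝ :=
  Matrix.fromBlocks (M.Qμ μ) (Matrix.replicateCol Unit (-(2 * μ) • (M.Q *ᵥ M.M₃)))
    (Matrix.replicateRow Unit (-(2 * μ) • (M.Q *ᵥ M.M₃))) (Matrix.of fun _ _ => -(μ * M.tolBar))

/-- The stationary second moment matrix of `[x; -1]`. -/
def statΦ (X : Policy n m) : Matrix (Fin n ⊕ Unit) (Fin n ⊕ Unit) ℝ :=
  hat (M.cov X) + Matrix.vecMulVec (extend (M.xbar X)) (extend (M.xbar X))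

/-- The stationary value of the Lagrangian. -/
def statL (μ : ℝ) (X : Policy n m) : ℝ :=
  ((M.augQ μ + Xᵀ * M.R * X) * M.statΦ X).trace

theorem policy_eq_fromCols (X : Policy n m) :
    X = Matrix.fromCols X.gain (Matrix.replicateCol Unit X.offset) := by
  ext i (j | j) <;> rfl

theorem augCl_eq (X : Policy n m) : M.augCl X =
    Matrix.fromBlocks (M.cl X) (Matrix.replicateCol Unit (-M.drift X)) 0 1 := by
  unfold augCl augA augB cl drift
  conv_lhs => rw [policy_eq_fromCols X, Matrix.fromRows_mul_fromCols]
  rw [fromBlocks_sub]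
  congr 1
  · rw [← Matrix.replicateCol_mulVec]
    ext i j
    simp [Matrix.replicateCol_apply]
    ring
  · simp
  · simp

theorem augCl_mulVec_extend (X : Policy n m) (x : Fin n → ℝ) :
    M.augCl X *ᵥ extend x = extend (M.cl X *ᵥ x + M.drift X) := by
  rw [augCl_eq, extend, Matrix.fromBlocks_mulVec]
  ext (i | i)
  · simp [extend, Matrix.mulVec, dotProduct, Matrix.replicateCol_apply]
  · simp [extend]

theorem policy_mulVec_extend (X : Policy n m) (x : Fin n → ℝ) :
    X *ᵥ extend x = -action X x := by
  conv_lhs => rw [policy_eq_fromCols X]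
  rw [extend, Matrix.fromCols_mulVec]
  ext i
  simp [action, Matrix.mulVec, dotProduct, Matrix.replicateCol_apply]
  ring

theorem augCl_conj_hat (X : Policy n m) (S : Matrix (Fin n) (Fin n) ℝ) :
    M.augCl X * hat S * (M.augCl X)ᵀ = hat (M.cl X * S * (M.cl X)ᵀ) := by
  rw [augCl_eq, hat, Matrix.fromBlocks_transpose, Matrix.fromBlocks_multiply,
    Matrix.fromBlocks_multiply]
  simp [hat]

theorem conj_vecMulVec {ι : Type*} [Fintype ι] (D : Matrix ι ι ℝ) (e f : ι → ℝ) :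
    D * Matrix.vecMulVec e f * Dᵀ = Matrix.vecMulVec (D *ᵥ e) (D *ᵥ f) := by
  rw [Matrix.mul_vecMulVec, Matrix.vecMulVec_mul, Matrix.vecMul_transpose]

theorem hat_add (S T : Matrix (Fin n) (Fin n) ℝ) : hat (S + T) = hat S + hat T := by
  simp [hat, Matrix.fromBlocks_add]

theorem hat_sub (S T : Matrix (Fin n) (Fin n) ℝ) : hat (S - T) = hat S - hat T := by
  simp [hat, fromBlocks_sub]

theorem xbar_eq {X : Policy n m} (h : PowStable (M.cl X)) :
    M.xbar X = M.cl X *ᵥ M.xbar X + M.drift X := h.mulVec_inv_eq _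

theorem cov_eq {X : Policy n m} (h : PowStable (M.cl X)) :
    M.cov X = M.W + M.cl X * M.cov X * (M.cl X)ᵀ := by
  have := h.transpose.lyap_eq M.W
  rwa [Matrix.transpose_transpose] at this

/-- The extended closed loop has the eigenvalue 1 and is not stable, so the Lyapunov theory does not
apply to it. Its stationary equation is assembled from those of the covariance and the mean. -/
theorem statΦ_eq {X : Policy n m} (h : PowStable (M.cl X)) :
    M.statΦ X = M.augCl X * M.statΦ X * (M.augCl X)ᵀ + hat M.W := by
  conv_rhs => rw [statΦ, Matrix.mul_add, Matrix.add_mul, augCl_conj_hat, conj_vecMulVec,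
    augCl_mulVec_extend, ← M.xbar_eq h]
  conv_lhs => rw [statΦ, M.cov_eq h, hat_add]
  abel

theorem statΦ_inr_inr (X : Policy n m) : M.statΦ X (Sum.inr ()) (Sum.inr ()) = 1 := by
  simp [statΦ, hat, Matrix.vecMulVec, extend]

variable {M}

theorem W_transpose (hM : M.Standing) : M.Wᵀ = M.W := hM.W_pd.posSemidef.transpose_eq

theorem Qμ_posSemidef (hM : M.Standing) {μ : ℝ} (hμ : 0 ≤ μ) : (M.Qμ μ).PosSemidef := by
  refine hM.Q_psd.add (Matrix.PosSemidef.smul ?_ (by positivity))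
  have := hM.W_pd.posSemidef.conj M.Q
  rwa [hM.Q_psd.transpose_eq] at this

theorem Qμ_sub_posSemidef (hM : M.Standing) {μ : ℝ} (hμ : 0 ≤ μ) : (M.Qμ μ - M.Q).PosSemidef := by
  rw [Qμ, add_sub_cancel_left]
  refine Matrix.PosSemidef.smul ?_ (by positivity)
  have := hM.W_pd.posSemidef.conj M.Q
  rwa [hM.Q_psd.transpose_eq] at this

/-- The weight of the state under the gain of `X`. -/
def wt (M : Model n m Ω) (μ : ℝ) (X : Policy n m) : Matrix (Fin n) (Fin n) ℝ :=
  M.Qμ μ + X.gainᵀ * M.R * X.gain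

theorem wt_posSemidef (hM : M.Standing) {μ : ℝ} (hμ : 0 ≤ μ) (X : Policy n m) :
    (M.wt μ X).PosSemidef :=
  (Qμ_posSemidef hM hμ).add (hM.R_pd.posSemidef.conj _)

theorem isLyapunovSolution_iff (hM : M.Standing) {μ : ℝ} (hμ : 0 ≤ μ) {X : Policy n m}
    (h : PowStable (M.cl X)) (P : Matrix (Fin n) (Fin n) ℝ) :
    M.IsLyapunovSolution μ X.gain P ↔ P = lyap (M.cl X) (M.wt μ X) := by
  constructor
  · exact fun hP => h.lyap_unique hP.2
  · rintro rfl
    exact ⟨h.lyap_posSemidef (wt_posSemidef hM hμ X), h.lyap_eq _⟩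

theorem P_eq_lyap (hM : M.Standing) {μ : ℝ} (hμ : 0 ≤ μ) {X : Policy n m}
    (h : PowStable (M.cl X)) : M.P μ X.gain = lyap (M.cl X) (M.wt μ X) := by
  have : ∃ P, M.IsLyapunovSolution μ X.gain P := ⟨_, (isLyapunovSolution_iff hM hμ h _).2 rfl⟩
  exact (isLyapunovSolution_iff hM hμ h _).1 (Classical.epsilon_spec this)

theorem P_posSemidef (hM : M.Standing) {μ : ℝ} (hμ : 0 ≤ μ) {X : Policy n m}
    (h : PowStable (M.cl X)) : (M.P μ X.gain).PosSemidef := by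
  rw [P_eq_lyap hM hμ h]; exact h.lyap_posSemidef (wt_posSemidef hM hμ X)

theorem P_eq (hM : M.Standing) {μ : ℝ} (hμ : 0 ≤ μ) {X : Policy n m}
    (h : PowStable (M.cl X)) :
    M.P μ X.gain = M.wt μ X + (M.cl X)ᵀ * M.P μ X.gain * M.cl X := by
  rw [P_eq_lyap hM hμ h]; exact h.lyap_eq _

theorem RK_posDef (hM : M.Standing) {μ : ℝ} (hμ : 0 ≤ μ) {X : Policy n m}
    (h : PowStable (M.cl X)) : (M.RK μ X.gain).PosDef :=
  hM.R_pd.add_posSemidef ((P_posSemidef hM hμ h).conj _)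

theorem cov_posSemidef (hM : M.Standing) {X : Policy n m} (h : PowStable (M.cl X)) :
    (M.cov X).PosSemidef := h.transpose.lyap_posSemidef hM.W_pd.posSemidef

theorem cov_sub_W_posSemidef (hM : M.Standing) {X : Policy n m} (h : PowStable (M.cl X)) :
    (M.cov X - M.W).PosSemidef := h.transpose.lyap_sub_self_posSemidef hM.W_pd.posSemidef

variable (M)

/-- The linear part of the value function. -/
def valueVec (μ : ℝ) (X : Policy n m) : Fin n → ℝ :=
  (1 - (M.cl X)ᵀ)⁻¹ *ᵥ ((2 * μ) • (M.Q *ᵥ M.M₃) - X.gainᵀ *ᵥ (M.R *ᵥ X.offset)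
    + (M.cl X)ᵀ *ᵥ (M.P μ X.gain *ᵥ M.drift X))

/-- The matrix of the (quadratic) value function in terms of `[x; -1]`. -/
def augP (μ : ℝ) (X : Policy n m) : Matrix (Fin n ⊕ Unit) (Fin n ⊕ Unit) ℝ :=
  Matrix.fromBlocks (M.P μ X.gain) (Matrix.replicateCol Unit (-M.valueVec μ X))
    (Matrix.replicateRow Unit (-M.valueVec μ X)) 0

/-- Half of the natural gradient at `X`. -/
def natGrad (μ : ℝ) (X : Policy n m) : Policy n m :=
  M.RK μ X.gain * X - M.augBᵀ * M.augP μ X * M.augA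

variable {M}

theorem augQ_transpose (hM : M.Standing) {μ : ℝ} (hμ : 0 ≤ μ) : (M.augQ μ)ᵀ = M.augQ μ := by
  rw [augQ, Matrix.fromBlocks_transpose, (Qμ_posSemidef hM hμ).transpose_eq]
  congr 1

theorem augP_transpose (hM : M.Standing) {μ : ℝ} (hμ : 0 ≤ μ) {X : Policy n m}
    (h : PowStable (M.cl X)) : (M.augP μ X)ᵀ = M.augP μ X := by
  rw [augP, Matrix.fromBlocks_transpose, (P_posSemidef hM hμ h).transpose_eq]
  congr 1

theorem augB_conj_augP (M : Model n m Ω) (μ : ℝ) (X : Policy n m) :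
    M.augBᵀ * M.augP μ X * M.augB = M.Bᵀ * M.P μ X.gain * M.B := by
  rw [augB, augP, Matrix.transpose_fromRows, Matrix.fromCols_mul_fromBlocks,
    Matrix.fromCols_mul_fromRows]
  simp

/-- This is the Bellman equation of the average cost. The upper left block is the equation of P_K,
and the off-diagonal block is the linear equation that defines `valueVec`. What remains is a
constant in the corner, which is the freedom to normalize the value function. -/
theorem exists_value_eq (hM : M.Standing) {μ : ℝ} (hμ : 0 ≤ μ) {X : Policy n m}
    (h : PowStable (M.cl X)) : ∃ c : ℝ, M.augP μ X = M.augQ μ + Xᵀ * M.R * X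
      + (M.augCl X)ᵀ * M.augP μ X * M.augCl X
      - c • Matrix.single (Sum.inr ()) (Sum.inr ()) 1 := by
  set Z := M.augQ μ + Xᵀ * M.R * X + (M.augCl X)ᵀ * M.augP μ X * M.augCl X - M.augP μ X with hZ
  have hZt : Zᵀ = Z := by
    rw [hZ]
    simp [Matrix.transpose_mul, augQ_transpose hM hμ, augP_transpose hM hμ h,
      hM.R_pd.posSemidef.transpose_eq, Matrix.mul_assoc]
  have hXRX : Xᵀ * M.R * X = Matrix.fromBlocks (X.gainᵀ * M.R * X.gain)
      (X.gainᵀ * M.R * Matrix.replicateCol Unit X.offset)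
      ((Matrix.replicateCol Unit X.offset)ᵀ * M.R * X.gain)
      ((Matrix.replicateCol Unit X.offset)ᵀ * M.R * Matrix.replicateCol Unit X.offset) := by
    conv_lhs => rw [policy_eq_fromCols X, Matrix.transpose_fromCols, Matrix.fromRows_mul,
      Matrix.fromRows_mul_fromCols]
  have hPP : (M.augCl X)ᵀ * M.augP μ X * M.augCl X = Matrix.fromBlocks
      ((M.cl X)ᵀ * M.P μ X.gain * M.cl X)
      (Matrix.replicateCol Unit ((M.cl X)ᵀ *ᵥ (-(M.P μ X.gain *ᵥ M.drift X) - M.valueVec μ X)))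
      (((M.augCl X)ᵀ * M.augP μ X * M.augCl X).toBlocks₂₁)
      (((M.augCl X)ᵀ * M.augP μ X * M.augCl X).toBlocks₂₂) := by
    conv_lhs => rw [← Matrix.fromBlocks_toBlocks ((M.augCl X)ᵀ * M.augP μ X * M.augCl X)]
    congr 1
    · rw [augCl_eq, augP, Matrix.fromBlocks_transpose, Matrix.mul_assoc,
        Matrix.fromBlocks_multiply, Matrix.fromBlocks_multiply, Matrix.toBlocks_fromBlocks₁₁]
      simp [Matrix.mul_assoc]
    · rw [augCl_eq, augP, Matrix.fromBlocks_transpose, Matrix.mul_assoc,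
        Matrix.fromBlocks_multiply, Matrix.fromBlocks_multiply, Matrix.toBlocks_fromBlocks₁₂]
      simp only [Matrix.transpose_zero, add_zero, Matrix.mul_one,
        ← Matrix.replicateCol_mulVec, ← Matrix.replicateCol_add]
      congr 2
      rw [Matrix.mulVec_neg, Matrix.zero_mulVec, add_zero, ← sub_eq_add_neg]
  have h11 : ∀ i j, Z (Sum.inl i) (Sum.inl j) = 0 := by
    intro i j
    have := congrFun (congrFun (P_eq hM hμ h) i) j
    rw [hZ, hXRX, hPP]
    simp only [Matrix.sub_apply, Matrix.add_apply, augQ, augP, Matrix.fromBlocks_apply₁₁]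
    rw [this]
    simp [wt]
  have h12 : ∀ i j, Z (Sum.inl i) (Sum.inr j) = 0 := by
    intro i j
    have := congrFun (h.transpose.mulVec_inv_eq ((2 * μ) • (M.Q *ᵥ M.M₃)
      - X.gainᵀ *ᵥ (M.R *ᵥ X.offset) + (M.cl X)ᵀ *ᵥ (M.P μ X.gain *ᵥ M.drift X))) i
    rw [← valueVec] at this
    rw [hZ, hXRX, hPP]
    simp only [Matrix.sub_apply, Matrix.add_apply, augQ, augP, Matrix.fromBlocks_apply₁₂,
      ← Matrix.replicateCol_mulVec, Matrix.replicateCol_apply, Matrix.mulVec_sub, Matrix.mulVec_neg,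
      Pi.sub_apply, Pi.neg_apply, Pi.add_apply, Pi.smul_apply, smul_eq_mul,
      Matrix.mulVec_mulVec] at this ⊢
    linarith
  refine ⟨Z (Sum.inr ()) (Sum.inr ()), ?_⟩
  have hZs : Z = Z (Sum.inr ()) (Sum.inr ()) • Matrix.single (Sum.inr ()) (Sum.inr ()) 1 := by
    ext (i | i) (j | j)
    · simp [h11, Matrix.single]
    · simp [h12, Matrix.single]
    · rw [← hZt, Matrix.transpose_apply, h12]; simp [Matrix.single]
    · simp [Matrix.single]
  rw [← hZs, hZ]
  abel

/-- Applied twice: to the extended system for the cost difference, and to the plain system with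
gains for the Lyapunov certificate of a step. -/
theorem completion_of_square {ι κ : Type*} [Fintype ι] [Fintype κ] [DecidableEq ι] [DecidableEq κ]
    {R : Matrix κ κ ℝ} {P : Matrix ι ι ℝ} (hR : Rᵀ = R) (hP : Pᵀ = P) (A : Matrix ι ι ℝ)
    (B : Matrix ι κ ℝ) (X Y : Matrix κ ι ℝ) :
    Yᵀ * R * Y + (A - B * Y)ᵀ * P * (A - B * Y) - (Xᵀ * R * X + (A - B * X)ᵀ * P * (A - B * X))
      = (Y - X)ᵀ * (R + Bᵀ * P * B) * (Y - X)
        + (Y - X)ᵀ * ((R + Bᵀ * P * B) * X - Bᵀ * P * A)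
        + ((R + Bᵀ * P * B) * X - Bᵀ * P * A)ᵀ * (Y - X) := by
  simp only [Matrix.transpose_sub, Matrix.transpose_mul, Matrix.transpose_add,
    Matrix.transpose_transpose, hR, hP, Matrix.mul_add, Matrix.add_mul, Matrix.mul_sub,
    Matrix.sub_mul, Matrix.mul_assoc]
  abel

theorem statΦ_transpose (hM : M.Standing) {X : Policy n m} (h : PowStable (M.cl X)) :
    (M.statΦ X)ᵀ = M.statΦ X := by
  rw [statΦ, Matrix.transpose_add, Matrix.transpose_vecMulVec, hat, Matrix.fromBlocks_transpose,
    (cov_posSemidef hM h).transpose_eq]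
  simp

/-- The cost of Y is evaluated with the value function of X. Only the second moment of the target Y
and the natural gradient of the source X enter, and there is no remainder. -/
theorem statL_sub (hM : M.Standing) {μ : ℝ} (hμ : 0 ≤ μ) {X Y : Policy n m}
    (h : PowStable (M.cl X)) (hY : PowStable (M.cl Y)) :
    M.statL μ Y - M.statL μ X = (M.RK μ X.gain * ((Y - X) * M.statΦ Y * (Y - X)ᵀ)).trace
      + 2 * (M.natGrad μ X * M.statΦ Y * (Y - X)ᵀ).trace := by
  obtain ⟨c, hc⟩ := exists_value_eq hM hμ h
  have hP := augP_transpose hM hμ h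
  -- The Bellman equation of X paired with the stationary moments of Z. By stationarity the value
  -- terms cancel up to the noise contribution, which does not depend on Z, and the corner entry 1
  -- turns the constant matrix into c.
  have key : ∀ {Z : Policy n m}, PowStable (M.cl Z) → M.statL μ Z
      = (M.augP μ X * hat M.W).trace + c
        + ((Zᵀ * M.R * Z + (M.augCl Z)ᵀ * M.augP μ X * M.augCl Z
          - (Xᵀ * M.R * X + (M.augCl X)ᵀ * M.augP μ X * M.augCl X)) * M.statΦ Z).trace := by
    intro Z hZ
    have e1 : M.augQ μ = M.augP μ X - (Xᵀ * M.R * X + (M.augCl X)ᵀ * M.augP μ X * M.augCl X)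
        + c • Matrix.single (Sum.inr ()) (Sum.inr ()) 1 := by
      nth_rewrite 1 [hc]; abel
    have e2 : ((M.augCl Z)ᵀ * M.augP μ X * M.augCl Z * M.statΦ Z).trace
        = (M.augP μ X * M.statΦ Z).trace - (M.augP μ X * hat M.W).trace := by
      rw [← Matrix.trace_sub, ← Matrix.mul_sub]
      have : M.statΦ Z - hat M.W = M.augCl Z * M.statΦ Z * (M.augCl Z)ᵀ := by
        nth_rewrite 1 [M.statΦ_eq hZ]; abel
      rw [this, Matrix.mul_assoc, Matrix.mul_assoc, Matrix.trace_mul_comm]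
      simp only [Matrix.mul_assoc]
    have e3 : (Matrix.single (Sum.inr ()) (Sum.inr ()) (1 : ℝ) * M.statΦ Z).trace = 1 := by
      rw [Matrix.trace_single_mul, statΦ_inr_inr]; simp
    rw [statL, e1]
    simp only [Matrix.add_mul, Matrix.sub_mul, Matrix.trace_add, Matrix.trace_sub,
      Matrix.smul_mul, Matrix.trace_smul, e2, e3, smul_eq_mul]
    ring
  have hsq := completion_of_square hM.R_pd.posSemidef.transpose_eq hP M.augA M.augB X Y
  rw [augB_conj_augP] at hsq
  change Yᵀ * M.R * Y + (M.augCl Y)ᵀ * M.augP μ X * M.augCl Y - _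
    = (Y - X)ᵀ * M.RK μ X.gain * (Y - X) + (Y - X)ᵀ * M.natGrad μ X
      + (M.natGrad μ X)ᵀ * (Y - X) at hsq
  change Yᵀ * M.R * Y + (M.augCl Y)ᵀ * M.augP μ X * M.augCl Y
    - (Xᵀ * M.R * X + (M.augCl X)ᵀ * M.augP μ X * M.augCl X) = _ at hsq
  rw [key hY, key h, hsq]
  simp only [sub_self, Matrix.zero_mul, Matrix.trace_zero, add_zero, add_sub_cancel_left,
    Matrix.add_mul, Matrix.trace_add]
  have t1 : ((Y - X)ᵀ * M.RK μ X.gain * (Y - X) * M.statΦ Y).trace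
      = (M.RK μ X.gain * ((Y - X) * M.statΦ Y * (Y - X)ᵀ)).trace := by
    rw [Matrix.mul_assoc, Matrix.mul_assoc, Matrix.trace_mul_comm]
    simp only [Matrix.mul_assoc]
  have t2 : ((Y - X)ᵀ * M.natGrad μ X * M.statΦ Y).trace
      = (M.natGrad μ X * M.statΦ Y * (Y - X)ᵀ).trace := by
    rw [Matrix.mul_assoc, Matrix.trace_mul_comm]
  have t3 : ((M.natGrad μ X)ᵀ * (Y - X) * M.statΦ Y).trace
      = (M.natGrad μ X * M.statΦ Y * (Y - X)ᵀ).trace := by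
    rw [← Matrix.trace_transpose]
    simp only [Matrix.transpose_mul, Matrix.transpose_transpose, statΦ_transpose hM hY]
    rw [← Matrix.mul_assoc, Matrix.trace_mul_comm, ← Matrix.mul_assoc, Matrix.trace_mul_comm]
  rw [t1, t2, t3]
  ring

end Model

/-! ### Second moments of the process and existence of the long-run averages. -/

section Ergodic

open MeasureTheory ProbabilityTheory

namespace Model

variable {n m : ℕ} {Ω : Type*} [MeasurableSpace Ω] (M : Model n m Ω)

/-- The centered noise, as a disturbance of `[x; -1]`. -/
def noise (t : ℕ) (ω : Ω) : Fin n ⊕ Unit → ℝ := Sum.elim (M.w t ω - M.wbar) 0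

theorem extend_state_succ (X : Policy n m) (t : ℕ) (ω : Ω) :
    extend (M.state X (t + 1) ω) = M.augCl X *ᵥ extend (M.state X t ω) + M.noise t ω := by
  rw [augCl_mulVec_extend]
  ext (i | i)
  · simp only [extend, state, noise, Sum.elim_inl, Pi.add_apply, cl, drift, action, Pi.sub_apply,
      Matrix.sub_mulVec, Matrix.mulVec_add, Matrix.mulVec_neg, Pi.neg_apply, Matrix.mulVec_mulVec]
    ring
  · simp [extend, noise]

variable {M}

theorem integrable_mul_of_memLp {P : Measure Ω} {f g : Ω → ℝ} (hf : MemLp f 2 P)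
    (hg : MemLp g 2 P) : Integrable (fun ω => f ω * g ω) P := hf.integrable_mul hg

theorem memLp_extend {x : Ω → Fin n → ℝ} [IsProbabilityMeasure M.ℙ] (h : MemLp x 2 M.ℙ)
    (i : Fin n ⊕ Unit) : MemLp (fun ω => extend (x ω) i) 2 M.ℙ := by
  rcases i with i | i
  · exact memLp_pi_iff.1 h i
  · exact memLp_const _

theorem memLp_w (hM : M.Standing) (t : ℕ) : MemLp (M.w t) 2 M.ℙ := by
  have := hM.prob
  exact (hM.w_ident t).memLp_iff.2 (hM.w_fourth.mono_exponent (by norm_num))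

theorem memLp_noise (hM : M.Standing) (t : ℕ) (i : Fin n ⊕ Unit) :
    MemLp (fun ω => M.noise t ω i) 2 M.ℙ := by
  have := hM.prob
  rcases i with i | i
  · exact (memLp_pi_iff.1 (memLp_w hM t) i).sub (memLp_const _)
  · exact memLp_const _

theorem memLp_extend_state (hM : M.Standing) (X : Policy n m) (t : ℕ) (i : Fin n ⊕ Unit) :
    MemLp (fun ω => extend (M.state X t ω) i) 2 M.ℙ := by
  have := hM.prob
  induction t generalizing i with
  | zero => exact memLp_extend hM.x₀_sq i
  | succ t ih =>
    simp only [extend_state_succ, Pi.add_apply, Matrix.mulVec, dotProduct]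
    exact (memLp_finsetSum _ fun j _ => (ih j).const_mul _).add (memLp_noise hM t i)

theorem integral_noise (hM : M.Standing) (t : ℕ) (i : Fin n ⊕ Unit) :
    ∫ ω, M.noise t ω i ∂M.ℙ = 0 := by
  have := hM.prob
  rcases i with i | i
  · have h1 := ((hM.w_ident t).comp (measurable_pi_apply i)).integral_eq
    simp only [noise, Sum.elim_inl, Pi.sub_apply]
    rw [integral_sub ((memLp_pi_iff.1 (memLp_w hM t) i).integrable (by norm_num))
      (integrable_const _), integral_const]
    simp only [Function.comp_apply] at h1
    rw [h1]
    simp [wbar]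
  · simp [noise]

theorem integral_noise_mul_noise (hM : M.Standing) (t : ℕ) (i j : Fin n ⊕ Unit) :
    ∫ ω, M.noise t ω i * M.noise t ω j ∂M.ℙ = hat M.W i j := by
  rcases i with i | i <;> rcases j with j | j
  · have h1 := ((hM.w_ident t).comp (u := fun v => (v - M.wbar) i * (v - M.wbar) j)
      (by simp only [Pi.sub_apply]; fun_prop)).integral_eq
    simpa [noise, hat, W, Function.comp_def] using h1
  all_goals simp [noise, hat]

theorem integral_noise_mul_noise_of_ne (hM : M.Standing) {s t : ℕ} (hst : s ≠ t)
    (i j : Fin n ⊕ Unit) : ∫ ω, M.noise s ω i * M.noise t ω j ∂M.ℙ = 0 := by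
  have hmeas : ∀ k : Fin n ⊕ Unit,
      Measurable fun v : Fin n → ℝ => (Sum.elim (v - M.wbar) 0 : Fin n ⊕ Unit → ℝ) k := by
    rintro (k | k)
    · simp only [Sum.elim_inl, Pi.sub_apply]; fun_prop
    · simp only [Sum.elim_inr]; fun_prop
  have h1 := ((hM.w_indep.indepFun hst).comp (hmeas i) (hmeas j)).integral_fun_mul_eq_mul_integral
    (memLp_noise hM s i).aestronglyMeasurable (memLp_noise hM t j).aestronglyMeasurable
  have h2 := integral_noise hM s i
  simp only [Function.comp_apply] at h1
  change _ = (∫ ω, M.noise s ω i ∂M.ℙ) * _ at h1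
  rw [h2, zero_mul] at h1
  exact h1

/-- The time t of the noise stays fixed while the state advances. The state at time s is affine in
the initial state and the earlier noises, each uncorrelated with the noise at t, so pairwise
independence of the noises is enough. -/
theorem integral_extend_state_mul_noise (hM : M.Standing) (X : Policy n m) {s t : ℕ} (hst : s ≤ t)
    (i j : Fin n ⊕ Unit) : ∫ ω, extend (M.state X s ω) i * M.noise t ω j ∂M.ℙ = 0 := by
  have := hM.prob
  induction s generalizing i with
  | zero =>
    have hmeas : ∀ k : Fin n ⊕ Unit,
        Measurable fun v : ℕ → Fin n → ℝ =>
          (Sum.elim (v t - M.wbar) 0 : Fin n ⊕ Unit → ℝ) k := by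
      rintro (k | k)
      · simp only [Sum.elim_inl, Pi.sub_apply]; fun_prop
      · simp only [Sum.elim_inr]; fun_prop
    have hmeas' : Measurable fun v : Fin n → ℝ => extend v i := by
      rcases i with k | k
      · simp only [extend, Sum.elim_inl]; fun_prop
      · simp only [extend, Sum.elim_inr]; fun_prop
    have h1 := (hM.x₀_indep.comp hmeas' (hmeas j)).integral_fun_mul_eq_mul_integral
      (memLp_extend_state hM X 0 i).aestronglyMeasurable
      (memLp_noise hM t j).aestronglyMeasurable
    have h2 := integral_noise hM t j
    simp only [Function.comp_apply] at h1
    change _ = _ * ∫ ω, M.noise t ω j ∂M.ℙ at h1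
    rw [h2, mul_zero] at h1
    exact h1
  | succ s ih =>
    simp only [extend_state_succ, Pi.add_apply, add_mul, Matrix.mulVec, dotProduct,
      Finset.sum_mul]
    have hint : ∀ k, Integrable (fun ω => M.augCl X i k * extend (M.state X s ω) k * M.noise t ω j)
        M.ℙ := fun k =>
      integrable_mul_of_memLp ((memLp_extend_state hM X s k).const_mul _) (memLp_noise hM t j)
    rw [integral_add (integrable_finsetSum _ fun k _ => hint k)
      (integrable_mul_of_memLp (memLp_noise hM s i) (memLp_noise hM t j)),
      integral_finsetSum _ fun k _ => hint k, integral_noise_mul_noise_of_ne hM (by omega),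
      add_zero]
    refine Finset.sum_eq_zero fun k _ => ?_
    simp only [mul_assoc, integral_const_mul]
    rw [ih (by omega), mul_zero]

variable (M)

/-- The second moment matrix of `[x_t; -1]`. -/
def secondMoment (X : Policy n m) (t : ℕ) : Matrix (Fin n ⊕ Unit) (Fin n ⊕ Unit) ℝ :=
  Matrix.of fun i j => ∫ ω, extend (M.state X t ω) i * extend (M.state X t ω) j ∂M.ℙ

variable {M}

theorem secondMoment_succ (hM : M.Standing) (X : Policy n m) (t : ℕ) :
    M.secondMoment X (t + 1)
      = M.augCl X * M.secondMoment X t * (M.augCl X)ᵀ + hat M.W := by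
  have := hM.prob
  ext i j
  simp only [secondMoment, Matrix.of_apply, Matrix.add_apply]
  rw [← integral_noise_mul_noise hM t i j]
  set a : Fin n ⊕ Unit → Ω → ℝ := fun i ω => ∑ k, M.augCl X i k * extend (M.state X t ω) k with ha
  have hz := memLp_extend_state hM X t
  have hν := memLp_noise hM t
  have haL : ∀ i, MemLp (a i) 2 M.ℙ := fun i =>
    memLp_finsetSum _ fun k _ => (hz k).const_mul _
  have e1 : ∀ ω, extend (M.state X (t + 1) ω) i * extend (M.state X (t + 1) ω) j
      = (a i ω * a j ω + a i ω * M.noise t ω j)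
        + (a j ω * M.noise t ω i + M.noise t ω i * M.noise t ω j) := fun ω => by
    simp only [extend_state_succ, Pi.add_apply, Matrix.mulVec, dotProduct, ha]
    ring
  have hzero : ∀ i j, ∫ ω, a i ω * M.noise t ω j ∂M.ℙ = 0 := by
    intro i j
    simp only [ha, Finset.sum_mul, mul_assoc]
    rw [integral_finsetSum _ fun k _ => (integrable_mul_of_memLp (hz k) (hν j)).const_mul _]
    refine Finset.sum_eq_zero fun k _ => ?_
    rw [integral_const_mul, integral_extend_state_mul_noise hM X le_rfl, mul_zero]
  have haa : ∫ ω, a i ω * a j ω ∂M.ℙ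
      = (M.augCl X * M.secondMoment X t * (M.augCl X)ᵀ) i j := by
    have e2 : ∀ ω, a i ω * a j ω = ∑ l, ∑ k, M.augCl X i k * M.augCl X j l *
        (extend (M.state X t ω) k * extend (M.state X t ω) l) := fun ω => by
      simp only [ha, Finset.sum_mul_sum]
      rw [Finset.sum_comm]
      exact Finset.sum_congr rfl fun _ _ => Finset.sum_congr rfl fun _ _ => by ring
    simp only [e2]
    rw [integral_finsetSum _ fun l _ => integrable_finsetSum _ fun k _ =>
      (integrable_mul_of_memLp (hz k) (hz l)).const_mul _]
    rw [Matrix.mul_apply]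
    refine Finset.sum_congr rfl fun l _ => ?_
    rw [integral_finsetSum _ fun k _ => (integrable_mul_of_memLp (hz k) (hz l)).const_mul _,
      Matrix.mul_apply, Finset.sum_mul]
    refine Finset.sum_congr rfl fun k _ => ?_
    rw [integral_const_mul, Matrix.transpose_apply, secondMoment, Matrix.of_apply]
    ring
  simp only [e1]
  have i1 := integrable_mul_of_memLp (haL i) (haL j)
  have i2 := integrable_mul_of_memLp (haL i) (hν j)
  have i3 := integrable_mul_of_memLp (haL j) (hν i)
  have i4 := integrable_mul_of_memLp (hν i) (hν j)
  have i12 : Integrable (fun ω => a i ω * a j ω + a i ω * M.noise t ω j) M.ℙ := i1.add i2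
  have i34 : Integrable (fun ω => a j ω * M.noise t ω i + M.noise t ω i * M.noise t ω j) M.ℙ :=
    i3.add i4
  rw [integral_add i12 i34, integral_add i1 i2, integral_add i3 i4, hzero, hzero,
    haa, add_zero, zero_add]
  rfl

theorem exists_secondMoment_eq (hM : M.Standing) {X : Policy n m} (h : PowStable (M.cl X)) :
    ∃ (C : Matrix (Fin n) (Fin n) ℝ) (v : Fin n → ℝ), ∀ t, M.secondMoment X t
      = hat (M.cov X + M.cl X ^ t * C * (M.cl X ^ t)ᵀ)
        + Matrix.vecMulVec (extend (M.xbar X + M.cl X ^ t *ᵥ v))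
          (extend (M.xbar X + M.cl X ^ t *ᵥ v)) := by
  have := hM.prob
  set m₀ : Fin n → ℝ := fun i => ∫ ω, M.x₀ ω i ∂M.ℙ with hm₀
  -- The witnesses are the deviations at time zero: initial covariance minus stationary covariance,
  -- and initial mean minus stationary mean. The closed loop propagates both linearly.
  refine ⟨(M.secondMoment X 0).toBlocks₁₁ - Matrix.vecMulVec m₀ m₀ - M.cov X, m₀ - M.xbar X,
    fun t => ?_⟩
  induction t with
  | zero =>
    ext (i | i) (j | j)
    · simp [hat, Matrix.toBlocks₁₁, Matrix.vecMulVec, extend]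
    · simp [hat, Matrix.vecMulVec, extend, secondMoment, state, hm₀, integral_neg]
    · simp [hat, Matrix.vecMulVec, extend, secondMoment, state, hm₀, integral_neg]
    · simp [hat, Matrix.vecMulVec, extend, secondMoment]
  | succ t ih =>
    rw [secondMoment_succ hM, ih, Matrix.mul_add, Matrix.add_mul, augCl_conj_hat, conj_vecMulVec,
      augCl_mulVec_extend]
    have e1 : M.cl X *ᵥ (M.xbar X + M.cl X ^ t *ᵥ (m₀ - M.xbar X)) + M.drift X
        = M.xbar X + M.cl X ^ (t + 1) *ᵥ (m₀ - M.xbar X) := by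
      rw [Matrix.mulVec_add, Matrix.mulVec_mulVec, ← pow_succ', add_right_comm, ← M.xbar_eq h]
    rw [e1, add_right_comm, ← hat_add]
    congr 2
    have e2 := M.cov_eq h
    set C := (M.secondMoment X 0).toBlocks₁₁ - Matrix.vecMulVec m₀ m₀ - M.cov X
    conv_rhs => rw [e2]
    rw [pow_succ', Matrix.transpose_mul]
    simp only [Matrix.mul_add, Matrix.add_mul, Matrix.mul_assoc]
    abel

theorem tendsto_secondMoment (hM : M.Standing) {X : Policy n m} (h : PowStable (M.cl X)) :
    Tendsto (M.secondMoment X) atTop (𝓝 (M.statΦ X)) := by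
  obtain ⟨C, v, hCv⟩ := exists_secondMoment_eq hM h
  have h1 : Tendsto (fun t => M.xbar X + M.cl X ^ t *ᵥ v) atTop (𝓝 (M.xbar X)) := by
    simpa using (h.tendsto_mulVec v).const_add (M.xbar X)
  have h2 : Tendsto (fun t : ℕ => M.cov X + M.cl X ^ t * C * (M.cl X ^ t)ᵀ) atTop
      (𝓝 (M.cov X)) := by
    have h3 : Tendsto (fun t : ℕ => M.cl X ^ t * C) atTop (𝓝 (0 * C)) :=
      (show Tendsto _ _ _ from h).mul tendsto_const_nhds
    have h4 := h3.mul h.transpose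
    simp only [zero_mul, ← Matrix.transpose_pow] at h4
    simpa using h4.const_add (M.cov X)
  rw [tendsto_matrix_iff] at h2 ⊢
  rw [tendsto_pi_nhds] at h1
  intro i j
  simp only [hCv, statΦ, Matrix.add_apply, Matrix.vecMulVec_apply]
  have h3 : ∀ k : Fin n ⊕ Unit, Tendsto (fun t => extend (M.xbar X + M.cl X ^ t *ᵥ v) k) atTop
      (𝓝 (extend (M.xbar X) k)) := by
    rintro (k | k)
    · exact h1 k
    · exact tendsto_const_nhds
  refine Tendsto.add ?_ ((h3 i).mul (h3 j))
  rcases i with i | i <;> rcases j with j | j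
  · exact h2 i j
  all_goals exact tendsto_const_nhds

/-- The expectation of a quadratic function of z is a trace against the second moment, which
converges. The Cesàro means have the same limit. -/
theorem tendsto_timeAverage (hM : M.Standing) {X : Policy n m} (h : PowStable (M.cl X))
    (F : Matrix (Fin n ⊕ Unit) (Fin n ⊕ Unit) ℝ) {f : (Fin n → ℝ) → ℝ}
    (hf : ∀ x, f x = extend x ⬝ᵥ F *ᵥ extend x) :
    Tendsto (M.timeAverage X f) atTop (𝓝 (F * M.statΦ X).trace) := by
  have := hM.prob
  have e1 : ∀ x, f x = ∑ i, ∑ j, F i j * (extend x j * extend x i) := fun x => by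
    rw [hf]
    simp only [dotProduct, Matrix.mulVec, Finset.mul_sum]
    exact Finset.sum_congr rfl fun _ _ => Finset.sum_congr rfl fun _ _ => by ring
  have hint : ∀ t i j, Integrable (fun ω => F i j * (extend (M.state X t ω) j *
      extend (M.state X t ω) i)) M.ℙ := fun t i j =>
    (integrable_mul_of_memLp (memLp_extend_state hM X t j) (memLp_extend_state hM X t i)).const_mul _
  have hint' : ∀ t, Integrable (fun ω => f (M.state X t ω)) M.ℙ := fun t => by
    simp only [e1]
    exact integrable_finsetSum _ fun i _ => integrable_finsetSum _ fun j _ => hint t i j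
  have e2 : ∀ t, ∫ ω, f (M.state X t ω) ∂M.ℙ = (F * M.secondMoment X t).trace := fun t => by
    simp only [e1]
    rw [integral_finsetSum _ fun i _ => integrable_finsetSum _ fun j _ => hint t i j]
    refine Finset.sum_congr rfl fun i _ => ?_
    rw [integral_finsetSum _ fun j _ => hint t i j, Matrix.diag_apply, Matrix.mul_apply]
    exact Finset.sum_congr rfl fun j _ => by rw [integral_const_mul]; rfl
  have h1 : Tendsto (fun t => (F * M.secondMoment X t).trace) atTop
      (𝓝 (F * M.statΦ X).trace) := by
    have hc : Continuous fun Z : Matrix (Fin n ⊕ Unit) (Fin n ⊕ Unit) ℝ => (F * Z).trace :=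
      (continuous_const.matrix_mul continuous_id).matrix_trace
    exact (hc.tendsto _).comp (tendsto_secondMoment hM h)
  refine h1.cesaro.congr fun T => ?_
  rw [timeAverage, integral_finsetSum _ fun t _ => hint' t]
  simp only [e2]

/-- The weight of the risk in terms of `[x; -1]`. -/
def riskMat (M : Model n m Ω) : Matrix (Fin n ⊕ Unit) (Fin n ⊕ Unit) ℝ :=
  Matrix.fromBlocks ((4 : ℝ) • (M.Q * M.W * M.Q))
    (Matrix.replicateCol Unit ((-2 : ℝ) • (M.Q *ᵥ M.M₃)))
    (Matrix.replicateRow Unit ((-2 : ℝ) • (M.Q *ᵥ M.M₃))) 0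

theorem stageCost_eq (X : Policy n m) (x : Fin n → ℝ) :
    M.stageCost X x = extend x ⬝ᵥ (hat M.Q + Xᵀ * M.R * X) *ᵥ extend x := by
  rw [Matrix.add_mulVec, dotProduct_add, quad_conj, policy_mulVec_extend, Matrix.mulVec_neg,
    neg_dotProduct_neg, stageCost]
  congr 1
  rw [hat, extend, Matrix.fromBlocks_mulVec]
  simp [dotProduct, Fintype.sum_sum_type]

theorem stageRisk_eq (x : Fin n → ℝ) :
    M.stageRisk x = extend x ⬝ᵥ M.riskMat *ᵥ extend x := by
  rw [stageRisk, riskMat, extend, Matrix.fromBlocks_mulVec, Sum.elim_comp_inl, Sum.elim_comp_inr]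
  have e1 : Matrix.replicateCol Unit ((-2 : ℝ) • (M.Q *ᵥ M.M₃)) *ᵥ (fun _ => (-1 : ℝ))
      = (2 : ℝ) • (M.Q *ᵥ M.M₃) := by
    ext i; simp [Matrix.mulVec, dotProduct, Matrix.replicateCol_apply]
  have e2 : Matrix.replicateRow Unit ((-2 : ℝ) • (M.Q *ᵥ M.M₃)) *ᵥ x
      = fun _ => -2 * (x ⬝ᵥ M.Q *ᵥ M.M₃) := by
    ext i; simp [Matrix.mulVec, dotProduct, Finset.mul_sum, mul_left_comm, mul_comm]
  rw [e1, e2, sumElim_dotProduct_sumElim, dotProduct_add, Matrix.smul_mulVec]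
  simp only [dotProduct_smul, smul_eq_mul, Matrix.zero_mulVec, add_zero]
  have e3 : (fun _ : Unit => (-1 : ℝ)) ⬝ᵥ (fun _ => -2 * (x ⬝ᵥ M.Q *ᵥ M.M₃))
      = 2 * (x ⬝ᵥ M.Q *ᵥ M.M₃) := by
    simp only [dotProduct, Finset.univ_unique, Finset.sum_singleton]; ring
  rw [e3]
  ring

theorem augQ_eq (M : Model n m Ω) (μ : ℝ) : M.augQ μ = hat M.Q + μ • M.riskMat
    - (μ * M.tolBar) • Matrix.single (Sum.inr ()) (Sum.inr ()) 1 := by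
  ext (i | i) (j | j)
  · simp [augQ, hat, riskMat, Qμ, Matrix.single]; ring
  · simp [augQ, hat, riskMat, Matrix.single]; ring
  · simp [augQ, hat, riskMat, Matrix.single]; ring
  · simp [augQ, hat, riskMat, Matrix.single]

theorem tendsto_cost (hM : M.Standing) {X : Policy n m} (h : PowStable (M.cl X)) :
    Tendsto (M.timeAverage X (M.stageCost X)) atTop
      (𝓝 ((hat M.Q + Xᵀ * M.R * X) * M.statΦ X).trace) :=
  tendsto_timeAverage hM h _ (stageCost_eq X)

theorem tendsto_risk (hM : M.Standing) {X : Policy n m} (h : PowStable (M.cl X)) :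
    Tendsto (M.timeAverage X M.stageRisk) atTop (𝓝 (M.riskMat * M.statΦ X).trace) :=
  tendsto_timeAverage hM h _ stageRisk_eq

theorem tendsto_ergodic (hM : M.Standing) {X : Policy n m} (h : PowStable (M.cl X))
    (i j : Fin n ⊕ Unit) :
    Tendsto (M.timeAverage X (fun x => extend x i * extend x j)) atTop (𝓝 (M.statΦ X i j)) := by
  have := tendsto_timeAverage hM h (Matrix.single j i 1)
    (f := fun x => extend x i * extend x j) fun x => by
      rw [Matrix.single_mulVec]
      change _ = extend x ⬝ᵥ Pi.single j (1 * extend x i)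
      rw [dotProduct_single]; ring
  rwa [Matrix.trace_single_mul, one_smul] at this

/-- The constant -μρ̄ sits in the corner of the extended weight and is counted once because the
corner of Φ equals 1. -/
theorem lagrangian_eq (hM : M.Standing) (μ : ℝ) {X : Policy n m} (h : PowStable (M.cl X)) :
    M.lagrangian μ X = M.statL μ X := by
  rw [lagrangian, J, Jc, ergodicMean, ergodicMean, (tendsto_cost hM h).limUnder_eq,
    (tendsto_risk hM h).limUnder_eq, statL, augQ_eq]
  simp only [Matrix.add_mul, Matrix.sub_mul, Matrix.trace_add, Matrix.trace_sub, Matrix.smul_mul,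
    Matrix.trace_smul, smul_eq_mul, Matrix.trace_single_mul, statΦ_inr_inr]
  ring

theorem Φ_eq (hM : M.Standing) {X : Policy n m} (h : PowStable (M.cl X)) :
    M.Φ X = M.statΦ X := by
  ext i j
  exact (tendsto_ergodic hM h i j).limUnder_eq

end Model

end Ergodic

/-! ### Entrywise, row and block estimates. -/

section Rows

variable {ι κ : Type*} [Fintype ι] [Fintype κ] [DecidableEq ι] [DecidableEq κ]

theorem euclNorm_single (i : ι) : euclNorm (Pi.single i (1 : ℝ)) = 1 := by
  have : euclNorm (Pi.single i (1 : ℝ)) ^ 2 = 1 := by rw [euclNorm_sq]; simp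
  nlinarith [euclNorm_nonneg (Pi.single i (1 : ℝ))]

theorem euclNorm_row_le (G : Matrix κ ι ℝ) (i : κ) : euclNorm (G i) ≤ ‖G‖ := by
  have := euclNorm_mulVec_le Gᵀ (Pi.single i 1)
  rw [euclNorm_single, norm_transpose, mul_one, Matrix.mulVec_single_one] at this
  exact this

omit [DecidableEq κ] in
theorem trace_mul_transpose (G H : Matrix κ ι ℝ) : (G * Hᵀ).trace = ∑ i, G i ⬝ᵥ H i := by
  have := trace_mul_conj G H 1
  simpa using this

theorem abs_trace_mul_transpose_le (G H : Matrix κ ι ℝ) :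
    |(G * Hᵀ).trace| ≤ Fintype.card κ * ‖G‖ * ‖H‖ := by
  rw [trace_mul_transpose]
  refine (Finset.abs_sum_le_sum_abs _ _).trans ?_
  have : ∀ i ∈ (Finset.univ : Finset κ), |G i ⬝ᵥ H i| ≤ ‖G‖ * ‖H‖ := fun i _ =>
    (abs_dotProduct_le _ _).trans (mul_le_mul (euclNorm_row_le G i) (euclNorm_row_le H i)
      (euclNorm_nonneg _) (norm_nonneg _))
  refine (Finset.sum_le_sum this).trans ?_
  simp [mul_assoc]

theorem trace_le_card_mul_norm (S : Matrix ι ι ℝ) : S.trace ≤ Fintype.card ι * ‖S‖ := by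
  have : ∀ i ∈ (Finset.univ : Finset ι), S i i ≤ ‖S‖ := fun i _ =>
    (le_abs_self _).trans ((abs_apply_le_euclNorm (S i) i).trans (euclNorm_row_le S i))
  refine (Finset.sum_le_sum this).trans ?_
  simp

omit [DecidableEq ι] in
theorem quad_vecMulVec (e z : ι → ℝ) : z ⬝ᵥ Matrix.vecMulVec e e *ᵥ z = (e ⬝ᵥ z) ^ 2 := by
  rw [Matrix.vecMulVec_mulVec, dotProduct_smul, dotProduct_comm z e]
  simp [pow_two]

omit [DecidableEq ι] in
theorem abs_quad_vecMulVec_sub_le (e f z : ι → ℝ) :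
    |z ⬝ᵥ Matrix.vecMulVec f f *ᵥ z - z ⬝ᵥ Matrix.vecMulVec e e *ᵥ z|
      ≤ euclNorm (f - e) * (2 * euclNorm e + euclNorm (f - e)) * (z ⬝ᵥ z) := by
  rw [quad_vecMulVec, quad_vecMulVec]
  have h1 : (f ⬝ᵥ z) ^ 2 - (e ⬝ᵥ z) ^ 2 = ((f - e) ⬝ᵥ z) * (2 * (e ⬝ᵥ z) + (f - e) ⬝ᵥ z) := by
    rw [sub_dotProduct]; ring
  have h2 := abs_dotProduct_le (f - e) z
  have h3 := abs_dotProduct_le e z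
  have h4 : |2 * (e ⬝ᵥ z) + (f - e) ⬝ᵥ z|
      ≤ 2 * (euclNorm e * euclNorm z) + euclNorm (f - e) * euclNorm z := by
    refine (abs_add_le _ _).trans ?_
    rw [abs_mul, abs_two]
    linarith
  rw [h1, abs_mul, ← euclNorm_sq z]
  refine (mul_le_mul h2 h4 (abs_nonneg _) (mul_nonneg (euclNorm_nonneg _)
    (euclNorm_nonneg _))).trans (le_of_eq ?_)
  ring

end Rows

section Hat

variable {n m : ℕ}

theorem sum_dotProduct_sum (z : Fin n ⊕ Unit → ℝ) :
    z ⬝ᵥ z = (z ∘ Sum.inl) ⬝ᵥ (z ∘ Sum.inl) + z (Sum.inr ()) ^ 2 := by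
  simp [dotProduct, Fintype.sum_sum_type, pow_two]

theorem quad_hat (S : Matrix (Fin n) (Fin n) ℝ) (z : Fin n ⊕ Unit → ℝ) :
    z ⬝ᵥ hat S *ᵥ z = (z ∘ Sum.inl) ⬝ᵥ S *ᵥ (z ∘ Sum.inl) := by
  rw [hat, Matrix.fromBlocks_mulVec]
  simp [dotProduct, Fintype.sum_sum_type]

theorem euclNorm_elim_zero (v : Fin n → ℝ) :
    euclNorm (Sum.elim v (0 : Unit → ℝ)) = euclNorm v := by
  have : euclNorm (Sum.elim v (0 : Unit → ℝ)) ^ 2 = euclNorm v ^ 2 := by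
    rw [euclNorm_sq, euclNorm_sq, sumElim_dotProduct_sumElim]; simp
  exact (pow_left_inj₀ (euclNorm_nonneg _) (euclNorm_nonneg _) two_ne_zero).1 this

theorem Policy.gain_mulVec (X : Policy n m) (v : Fin n → ℝ) :
    X.gain *ᵥ v = X *ᵥ Sum.elim v (0 : Unit → ℝ) := by
  ext i
  simp [Policy.gain, Matrix.mulVec, dotProduct, Fintype.sum_sum_type]

theorem Policy.norm_gain_le (X : Policy n m) : ‖X.gain‖ ≤ ‖X‖ :=
  norm_le_of_mulVec (norm_nonneg _) fun v => by
    rw [Policy.gain_mulVec, ← euclNorm_elim_zero v]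
    exact euclNorm_mulVec_le _ _

theorem extend_sub_extend (x y : Fin n → ℝ) :
    Model.extend x - Model.extend y = Sum.elim (x - y) (0 : Unit → ℝ) := by
  ext (i | i) <;> simp [Model.extend]

theorem euclNorm_extend_sq (x : Fin n → ℝ) :
    euclNorm (Model.extend x) ^ 2 = euclNorm x ^ 2 + 1 := by
  rw [euclNorm_sq, euclNorm_sq, Model.extend, sumElim_dotProduct_sumElim]
  simp [dotProduct]

end Hat

/-! ### Stationary moments: definiteness, perturbation and the gradient. -/

namespace Model

variable {n m : ℕ} {Ω : Type*} [MeasurableSpace Ω] {M : Model n m Ω}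

theorem quad_statΦ (X : Policy n m) (z : Fin n ⊕ Unit → ℝ) :
    z ⬝ᵥ M.statΦ X *ᵥ z = (z ∘ Sum.inl) ⬝ᵥ M.cov X *ᵥ (z ∘ Sum.inl)
      + (M.xbar X ⬝ᵥ (z ∘ Sum.inl) - z (Sum.inr ())) ^ 2 := by
  rw [statΦ, Matrix.add_mulVec, dotProduct_add, quad_hat, quad_vecMulVec]
  congr 2
  simp [extend, dotProduct, Fintype.sum_sum_type, sub_eq_add_neg]

/-- For z = (v, s) the form of Φ is vᵀ cov v + (x̄·v - s)². The bound cov ≥ W controls v; then s is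
controlled by x̄·v and the square. The constant is explicit because polynomial bounds are needed
later. -/
theorem dotProduct_self_le_statΦ [NeZero n] (hM : M.Standing) {X : Policy n m}
    (h : PowStable (M.cl X)) (z : Fin n ⊕ Unit → ℝ) :
    z ⬝ᵥ z ≤ ((1 + 2 * euclNorm (M.xbar X) ^ 2) / minEig M.W + 2) * (z ⬝ᵥ M.statΦ X *ᵥ z) := by
  rw [quad_statΦ, sum_dotProduct_sum]
  set v := z ∘ Sum.inl
  set s := z (Sum.inr ())
  set x := M.xbar X
  have hσ := minEig_pos hM.W_pd
  have h1 := minEig_mul_le (W_transpose hM) v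
  have h2 := (cov_sub_W_posSemidef hM h).quad_nonneg v
  rw [Matrix.sub_mulVec, dotProduct_sub] at h2
  have h3 : (x ⬝ᵥ v) ^ 2 ≤ euclNorm x ^ 2 * (v ⬝ᵥ v) := by
    rw [← euclNorm_sq v, ← mul_pow]
    exact sq_le_sq' (abs_le.1 (abs_dotProduct_le x v)).1 (abs_le.1 (abs_dotProduct_le x v)).2
  have h4 : s ^ 2 ≤ 2 * (x ⬝ᵥ v) ^ 2 + 2 * (x ⬝ᵥ v - s) ^ 2 := by
    nlinarith [sq_nonneg (2 * (x ⬝ᵥ v) - s)]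
  have h5 : v ⬝ᵥ v ≤ (v ⬝ᵥ M.cov X *ᵥ v) / minEig M.W := by
    rw [le_div_iff₀ hσ]; linarith
  have h6 : (1 + 2 * euclNorm x ^ 2) * (v ⬝ᵥ v)
      ≤ (1 + 2 * euclNorm x ^ 2) * ((v ⬝ᵥ M.cov X *ᵥ v) / minEig M.W) :=
    mul_le_mul_of_nonneg_left h5 (by positivity)
  have h7 : 0 ≤ v ⬝ᵥ M.cov X *ᵥ v := (cov_posSemidef hM h).quad_nonneg v
  have h8 : 0 ≤ (1 + 2 * euclNorm x ^ 2) / minEig M.W * (x ⬝ᵥ v - s) ^ 2 := by positivity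
  calc _ ≤ (1 + 2 * euclNorm x ^ 2) * (v ⬝ᵥ v) + 2 * (x ⬝ᵥ v - s) ^ 2 := by nlinarith
    _ ≤ (1 + 2 * euclNorm x ^ 2) * ((v ⬝ᵥ M.cov X *ᵥ v) / minEig M.W)
        + 2 * (x ⬝ᵥ v - s) ^ 2 := by linarith
    _ = (1 + 2 * euclNorm x ^ 2) / minEig M.W * (v ⬝ᵥ M.cov X *ᵥ v)
        + 2 * (x ⬝ᵥ v - s) ^ 2 := by ring
    _ ≤ _ := by nlinarith

theorem statΦ_posDef [NeZero n] (hM : M.Standing) {X : Policy n m} (h : PowStable (M.cl X)) :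
    (M.statΦ X).PosDef := by
  refine posDef_of_quad (statΦ_transpose hM h) fun z hz => ?_
  have h1 := dotProduct_self_le_statΦ hM h z
  have h2 := dotProduct_self_pos hz
  have h3 := minEig_pos hM.W_pd
  have h4 : 0 < (1 + 2 * euclNorm (M.xbar X) ^ 2) / minEig M.W + 2 := by positivity
  exact pos_of_mul_pos_right (h2.trans_le h1) h4.le

theorem cl_sub (M : Model n m Ω) (X Y : Policy n m) : M.cl Y - M.cl X = -(M.B * (Y - X).gain) := by
  have : (Y - X).gain = Y.gain - X.gain := rfl
  rw [this, cl, cl, Matrix.mul_sub]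
  abel

theorem norm_cl_sub_le (M : Model n m Ω) (X Y : Policy n m) :
    ‖M.cl Y - M.cl X‖ ≤ ‖M.B‖ * ‖Y - X‖ := by
  rw [cl_sub, norm_neg]
  exact (Matrix.l2_opNorm_mul _ _).trans
    (mul_le_mul_of_nonneg_left (Policy.norm_gain_le _) (norm_nonneg _))

theorem xbar_sub_eq {X Y : Policy n m} (h : PowStable (M.cl X)) (hY : PowStable (M.cl Y)) :
    M.xbar Y - M.xbar X
      = M.cl Y *ᵥ (M.xbar Y - M.xbar X) + -(M.B *ᵥ ((Y - X) *ᵥ extend (M.xbar X))) := by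
  have h1 := M.xbar_eq h
  have h2 := M.xbar_eq hY
  have h3 : M.cl Y *ᵥ M.xbar X = M.cl X *ᵥ M.xbar X - M.B *ᵥ ((Y - X).gain *ᵥ M.xbar X) := by
    have : M.cl Y = M.cl X + (M.cl Y - M.cl X) := by abel
    rw [this, cl_sub, Matrix.add_mulVec, Matrix.neg_mulVec, Matrix.mulVec_mulVec]
    abel
  have h4 : (Y - X) *ᵥ extend (M.xbar X) = (Y - X).gain *ᵥ M.xbar X - (Y.offset - X.offset) := by
    rw [policy_mulVec_extend, action]
    have : (Y - X).offset = Y.offset - X.offset := rfl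
    rw [this]; abel
  have h5 : M.drift Y - M.drift X = M.B *ᵥ (Y.offset - X.offset) := by
    rw [drift, drift, Matrix.mulVec_sub]; abel
  rw [h4, Matrix.mulVec_sub (M.B), ← h5, Matrix.mulVec_sub (M.cl Y), h3]
  nth_rewrite 1 [h1, h2]
  abel

theorem cov_sub_eq {X Y : Policy n m} (h : PowStable (M.cl X)) (hY : PowStable (M.cl Y)) :
    M.cov Y - M.cov X = lyap (M.cl Y)ᵀ
      (M.cl Y * M.cov X * (M.cl Y)ᵀ - M.cl X * M.cov X * (M.cl X)ᵀ) := by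
  refine hY.transpose.lyap_unique ?_
  conv_lhs => rw [M.cov_eq h, M.cov_eq hY]
  simp only [Matrix.transpose_transpose, Matrix.mul_sub, Matrix.sub_mul]
  abel

/-- Quantitative continuity of the stationary moments. -/
theorem statΦ_perturb (hM : M.Standing) {X Y : Policy n m} (h : PowStable (M.cl X))
    {τ S d : ℝ} (hτ : ‖Y - X‖ ≤ τ) (hS : ‖lyap (M.cl X) 1‖ ≤ S) (hd : ‖M.cl X‖ ≤ d)
    (hsmall : ‖M.B‖ * τ * (2 * d + ‖M.B‖ * τ) * S ≤ 1 / 2) :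
    PowStable (M.cl Y) ∧ ‖M.statΦ Y - M.statΦ X‖
      ≤ 2 * n * S * (‖M.B‖ * τ * (2 * d + ‖M.B‖ * τ)) * ‖M.cov X‖
        + 4 * S * ‖M.B‖ * τ * euclNorm (extend (M.xbar X))
          * (2 * euclNorm (extend (M.xbar X))
            + 4 * S * ‖M.B‖ * τ * euclNorm (extend (M.xbar X))) := by
  have hτ0 : 0 ≤ τ := (norm_nonneg _).trans hτ
  have hS0 : 0 ≤ S := (norm_nonneg _).trans hS
  have hd0 : 0 ≤ d := (norm_nonneg _).trans hd
  have hδ : ‖M.cl Y - M.cl X‖ ≤ ‖M.B‖ * τ :=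
    (norm_cl_sub_le M X Y).trans (mul_le_mul_of_nonneg_left hτ (norm_nonneg _))
  have hp := h.perturb (D' := M.cl Y) (le_trans (by gcongr) hsmall)
  obtain ⟨hY, hSY⟩ := hp
  refine ⟨hY, ?_⟩
  have hSY' : ‖lyap (M.cl Y) 1‖ ≤ 2 * S := hSY.trans (by linarith)
  have hy : euclNorm (M.xbar Y - M.xbar X)
      ≤ 4 * S * ‖M.B‖ * τ * euclNorm (extend (M.xbar X)) := by
    refine (hY.euclNorm_le_of_eq (xbar_sub_eq h hY)).trans ?_
    rw [euclNorm_neg]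
    have h1 : euclNorm (M.B *ᵥ ((Y - X) *ᵥ extend (M.xbar X)))
        ≤ ‖M.B‖ * (τ * euclNorm (extend (M.xbar X))) := by
      refine (euclNorm_mulVec_le _ _).trans (mul_le_mul_of_nonneg_left ?_ (norm_nonneg _))
      exact (euclNorm_mulVec_le _ _).trans (mul_le_mul_of_nonneg_right hτ (euclNorm_nonneg _))
    have := euclNorm_nonneg (extend (M.xbar X))
    calc _ ≤ 2 * (2 * S) * (‖M.B‖ * (τ * euclNorm (extend (M.xbar X)))) := by
            gcongr; exact euclNorm_nonneg _
      _ = _ := by ring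
  have hcov : ‖M.cov Y - M.cov X‖
      ≤ 2 * n * S * (‖M.B‖ * τ * (2 * d + ‖M.B‖ * τ)) * ‖M.cov X‖ := by
    have hc := (cov_posSemidef hM h).transpose_eq
    rw [cov_sub_eq h hY]
    refine (hY.transpose.norm_lyap_le (by simp [hc, Matrix.mul_assoc])).trans ?_
    -- The covariance solves the transposed equation. The two Lyapunov matrices have the same trace,
    -- so passing from one to the other costs a factor n.
    have h1 : ‖lyap (M.cl Y)ᵀ (1 : Matrix (Fin n) (Fin n) ℝ)‖ ≤ n * (2 * S) := by
      refine (norm_le_trace (hY.transpose.lyap_posSemidef Matrix.PosSemidef.one)).trans ?_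
      rw [hY.trace_lyap_one]
      refine (trace_le_card_mul_norm _).trans ?_
      rw [Fintype.card_fin]
      gcongr
    have h2 : ‖M.cl Y * M.cov X * (M.cl Y)ᵀ - M.cl X * M.cov X * (M.cl X)ᵀ‖
        ≤ ‖M.B‖ * τ * (2 * d + ‖M.B‖ * τ) * ‖M.cov X‖ := by
      have e : M.cl Y * M.cov X * (M.cl Y)ᵀ - M.cl X * M.cov X * (M.cl X)ᵀ
          = (M.cl Y - M.cl X) * M.cov X * (M.cl Y - M.cl X)ᵀ
            + ((M.cl Y - M.cl X) * M.cov X * (M.cl X)ᵀ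
            + M.cl X * M.cov X * (M.cl Y - M.cl X)ᵀ) := by
        simp only [Matrix.transpose_sub, Matrix.mul_sub, Matrix.sub_mul]; abel
      have e3 : ∀ U V : Matrix (Fin n) (Fin n) ℝ, ‖U * M.cov X * Vᵀ‖ ≤ ‖U‖ * ‖M.cov X‖ * ‖V‖ :=
        fun U V => by
          rw [← norm_transpose V]
          exact (norm_mul_le _ _).trans (mul_le_mul_of_nonneg_right (norm_mul_le _ _)
            (norm_nonneg _))
      rw [e]
      refine (norm_add_le _ _).trans ?_
      have k1 := e3 (M.cl Y - M.cl X) (M.cl Y - M.cl X)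
      have k2 := (norm_add_le _ _).trans (add_le_add (e3 (M.cl Y - M.cl X) (M.cl X))
        (e3 (M.cl X) (M.cl Y - M.cl X)))
      refine (add_le_add k1 k2).trans ?_
      have k3 : ‖M.cl Y - M.cl X‖ * ‖M.cov X‖ * ‖M.cl Y - M.cl X‖
          + (‖M.cl Y - M.cl X‖ * ‖M.cov X‖ * ‖M.cl X‖ + ‖M.cl X‖ * ‖M.cov X‖ * ‖M.cl Y - M.cl X‖)
          = ‖M.cl Y - M.cl X‖ * (2 * ‖M.cl X‖ + ‖M.cl Y - M.cl X‖) * ‖M.cov X‖ := by ring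
      rw [k3]
      gcongr
    calc _ ≤ (‖M.B‖ * τ * (2 * d + ‖M.B‖ * τ) * ‖M.cov X‖) * (n * (2 * S)) := by gcongr
      _ = _ := by ring
  have hyn := euclNorm_nonneg (M.xbar Y - M.xbar X)
  have hen := euclNorm_nonneg (extend (M.xbar X))
  refine norm_le_of_quad ?_ (by positivity) fun z => ?_
  · rw [Matrix.transpose_sub, statΦ_transpose hM h, statΦ_transpose hM hY]
  · have e1 : M.statΦ Y - M.statΦ X = hat (M.cov Y - M.cov X)
        + (Matrix.vecMulVec (extend (M.xbar Y)) (extend (M.xbar Y))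
          - Matrix.vecMulVec (extend (M.xbar X)) (extend (M.xbar X))) := by
      rw [statΦ, statΦ, hat_sub]; abel
    rw [e1, Matrix.add_mulVec, dotProduct_add, Matrix.sub_mulVec, dotProduct_sub, quad_hat, add_mul]
    refine (abs_add_le _ _).trans (add_le_add ?_ ?_)
    · refine (abs_quad_le _ _).trans ?_
      have : (z ∘ Sum.inl) ⬝ᵥ (z ∘ Sum.inl) ≤ z ⬝ᵥ z := by
        rw [sum_dotProduct_sum z]; nlinarith [sq_nonneg (z (Sum.inr ()))]
      exact mul_le_mul hcov this (dotProduct_self_nonneg' _) (by positivity)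
    · refine (abs_quad_vecMulVec_sub_le _ _ _).trans ?_
      rw [extend_sub_extend, euclNorm_elim_zero]
      have := dotProduct_self_nonneg' z
      gcongr

theorem tendsto_perturb_bound (a b c d e f : ℝ) :
    Tendsto (fun τ : ℝ => a * (b * τ * (c + b * τ)) * d + e * τ * f * (2 * f + e * τ * f))
      (𝓝 0) (𝓝 0) := by
  have : Continuous fun τ : ℝ =>
      a * (b * τ * (c + b * τ)) * d + e * τ * f * (2 * f + e * τ * f) := by fun_prop
  simpa using this.tendsto 0

theorem eventually_powStable_and_tendsto_statΦ (hM : M.Standing) {X : Policy n m}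
    (h : PowStable (M.cl X)) :
    (∀ᶠ Y in 𝓝 X, PowStable (M.cl Y)) ∧ Tendsto M.statΦ (𝓝 X) (𝓝 (M.statΦ X)) := by
  have hnorm : Tendsto (fun Y : Policy n m => ‖Y - X‖) (𝓝 X) (𝓝 0) := by
    have : Continuous fun Y : Policy n m => ‖Y - X‖ := by fun_prop
    simpa using this.tendsto X
  have hsm : ∀ᶠ Y : Policy n m in 𝓝 X,
      ‖M.B‖ * ‖Y - X‖ * (2 * ‖M.cl X‖ + ‖M.B‖ * ‖Y - X‖) * ‖lyap (M.cl X) 1‖ ≤ 1 / 2 := by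
    have h1 : Tendsto (fun τ : ℝ => ‖M.B‖ * τ * (2 * ‖M.cl X‖ + ‖M.B‖ * τ) * ‖lyap (M.cl X) 1‖)
        (𝓝 0) (𝓝 0) := by
      have : Continuous fun τ : ℝ =>
          ‖M.B‖ * τ * (2 * ‖M.cl X‖ + ‖M.B‖ * τ) * ‖lyap (M.cl X) 1‖ := by fun_prop
      simpa using this.tendsto 0
    exact (h1.comp hnorm).eventually (ge_mem_nhds (by norm_num : (0 : ℝ) < 1 / 2))
  have hp := fun Y (hY : _ ≤ (1 / 2 : ℝ)) =>
    statΦ_perturb hM (Y := Y) h le_rfl le_rfl le_rfl hY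
  refine ⟨hsm.mono fun Y hY => (hp Y hY).1, ?_⟩
  rw [tendsto_iff_norm_sub_tendsto_zero]
  refine squeeze_zero' (Eventually.of_forall fun _ => norm_nonneg _)
    (hsm.mono fun Y hY => (hp Y hY).2) ?_
  exact (tendsto_perturb_bound (2 * n * ‖lyap (M.cl X) 1‖) ‖M.B‖ (2 * ‖M.cl X‖) ‖M.cov X‖
    (4 * ‖lyap (M.cl X) 1‖ * ‖M.B‖) (euclNorm (extend (M.xbar X)))).comp hnorm

/-- In the exact cost difference the remainder is tr(G(Y)(Y-X)ᵀ) with G(Y) → 0, by continuity of Φ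
alone. No solution of a Lyapunov equation is differentiated. -/
theorem hasFDerivAt_lagrangian (hM : M.Standing) {μ : ℝ} (hμ : 0 ≤ μ) {X : Policy n m}
    (h : PowStable (M.cl X)) : ∃ f : Policy n m →L[ℝ] ℝ, HasFDerivAt (M.lagrangian μ) f X ∧
      ∀ Δ, f Δ = (((2 : ℝ) • (M.natGrad μ X * M.statΦ X)) * Δᵀ).trace := by
  let ℓ : Policy n m →ₗ[ℝ] ℝ :=
    { toFun := fun Δ => (((2 : ℝ) • (M.natGrad μ X * M.statΦ X)) * Δᵀ).trace
      map_add' := fun a b => by rw [Matrix.transpose_add, Matrix.mul_add, Matrix.trace_add]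
      map_smul' := fun c a => by simp }
  refine ⟨LinearMap.toContinuousLinearMap ℓ, ?_, fun _ => rfl⟩
  obtain ⟨hev, hΦ⟩ := eventually_powStable_and_tendsto_statΦ hM h
  set G : Policy n m → Policy n m := fun Y =>
    M.RK μ X.gain * (Y - X) * M.statΦ Y + (2 : ℝ) • (M.natGrad μ X * M.statΦ Y)
      - (2 : ℝ) • (M.natGrad μ X * M.statΦ X) with hG
  have hG0 : Tendsto G (𝓝 X) (𝓝 0) := by
    have hsub : Tendsto (fun Y : Policy n m => Y - X) (𝓝 X) (𝓝 0) := by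
      have : Continuous fun Y : Policy n m => Y - X := by fun_prop
      simpa using this.tendsto X
    have c1 : Continuous fun p : Policy n m × Matrix (Fin n ⊕ Unit) (Fin n ⊕ Unit) ℝ =>
        M.RK μ X.gain * p.1 * p.2 + (2 : ℝ) • (M.natGrad μ X * p.2)
          - (2 : ℝ) • (M.natGrad μ X * M.statΦ X) := by
      have a1 : Continuous fun p : Policy n m × Matrix (Fin n ⊕ Unit) (Fin n ⊕ Unit) ℝ =>
          M.RK μ X.gain * p.1 * p.2 :=
        (continuous_const.matrix_mul continuous_fst).matrix_mul continuous_snd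
      have a2 : Continuous fun p : Policy n m × Matrix (Fin n ⊕ Unit) (Fin n ⊕ Unit) ℝ =>
          M.natGrad μ X * p.2 := continuous_const.matrix_mul continuous_snd
      exact (a1.add (a2.const_smul (2 : ℝ))).sub continuous_const
    have := (c1.tendsto (0, M.statΦ X)).comp (hsub.prodMk_nhds hΦ)
    simpa [Function.comp_def] using this
  have key : ∀ᶠ Y in 𝓝 X, M.lagrangian μ Y - M.lagrangian μ X - ℓ (Y - X)
      = (G Y * (Y - X)ᵀ).trace := by
    filter_upwards [hev] with Y hY
    rw [lagrangian_eq hM μ h, lagrangian_eq hM μ hY, statL_sub hM hμ h hY]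
    simp only [hG]
    generalize Y - X = Δ
    simp only [Matrix.sub_mul, Matrix.add_mul, Matrix.trace_sub, Matrix.trace_add]
    simp only [ℓ, LinearMap.coe_mk, AddHom.coe_mk, Matrix.smul_mul, Matrix.trace_smul, smul_eq_mul,
      Matrix.mul_assoc]
  rw [hasFDerivAt_iff_isLittleO]
  refine Asymptotics.IsLittleO.congr' (f₁ := fun Y => (G Y * (Y - X)ᵀ).trace) ?_
    (key.mono fun Y hY => hY.symm) (Eventually.of_forall fun _ => rfl)
  have hb : (fun Y => (G Y * (Y - X)ᵀ).trace) =O[𝓝 X] fun Y => ‖G Y‖ * ‖Y - X‖ :=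
    Asymptotics.IsBigO.of_bound (Fintype.card (Fin m)) (Eventually.of_forall fun Y => by
      simpa [mul_assoc] using abs_trace_mul_transpose_le (G Y) (Y - X))
  refine hb.trans_isLittleO ?_
  have h1 : (fun Y => ‖G Y‖) =o[𝓝 X] fun _ => (1 : ℝ) :=
    (Asymptotics.isLittleO_one_iff ℝ).2 (tendsto_norm_zero.comp hG0)
  have h2 := h1.mul_isBigO (Asymptotics.isBigO_refl (fun Y => ‖Y - X‖) (𝓝 X))
  simp only [one_mul] at h2
  exact h2.trans_isBigO (Asymptotics.isBigO_norm_left.2 (Asymptotics.isBigO_refl _ _))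

theorem grad_eq (hM : M.Standing) {μ : ℝ} (hμ : 0 ≤ μ) {X : Policy n m}
    (h : PowStable (M.cl X)) : M.grad μ X = (2 : ℝ) • (M.natGrad μ X * M.statΦ X) := by
  obtain ⟨f, hf, hf'⟩ := hasFDerivAt_lagrangian hM hμ h
  ext i j
  rw [grad, Matrix.of_apply, hf.fderiv, hf', Matrix.transpose_single, Matrix.trace_mul_single]
  simp

theorem continuousAt_lagrangian (hM : M.Standing) {μ : ℝ} (hμ : 0 ≤ μ) {X : Policy n m}
    (h : PowStable (M.cl X)) : ContinuousAt (M.lagrangian μ) X := by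
  obtain ⟨f, hf, -⟩ := hasFDerivAt_lagrangian hM hμ h
  exact hf.continuousAt

theorem wellDefinedAt [NeZero n] (hM : M.Standing) {μ : ℝ} (hμ : 0 ≤ μ) {X : Policy n m}
    (h : PowStable (M.cl X)) : M.WellDefinedAt μ X where
  cost := by
    have := tendsto_cost hM h
    rwa [← this.limUnder_eq] at this
  risk := by
    have := tendsto_risk hM h
    rwa [← this.limUnder_eq] at this
  ergodic := fun i j => by rw [Φ_eq hM h]; exact tendsto_ergodic hM h i j
  Φ_pd := by rw [Φ_eq hM h]; exact statΦ_posDef hM h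
  lyapunov := fun P => by rw [P_eq_lyap hM hμ h]; exact isLyapunovSolution_iff hM hμ h P
  RK_pd := RK_posDef hM hμ h
  diff := by
    obtain ⟨f, hf, -⟩ := hasFDerivAt_lagrangian hM hμ h
    exact hf.differentiableAt

end Model

theorem mulVec_eq_zero_of_rank {ι : Type*} [Fintype ι] {n : ℕ} {C : Matrix ι (Fin n) ℝ}
    (h : C.rank = n) {v : Fin n → ℝ} (hv : C *ᵥ v = 0) : v = 0 := by
  have h1 := LinearMap.finrank_range_add_finrank_ker C.mulVecLin
  have h2 : Module.finrank ℝ (LinearMap.range C.mulVecLin) = n := h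
  rw [h2, Module.finrank_fin_fun] at h1
  have h3 : Module.finrank ℝ (LinearMap.ker C.mulVecLin) = 0 := by omega
  rw [Submodule.finrank_eq_zero, LinearMap.ker_eq_bot'] at h3
  exact h3 v hv

/-! ### Bookkeeping with powers of one large number. -/

section PowerBounds

variable {s x y : ℝ} {a b c : ℕ}

theorem le_pow_up (hs : 16 ≤ s) (h : x ≤ s ^ a) (hab : a ≤ b) : x ≤ s ^ b :=
  h.trans (pow_le_pow_right₀ (by linarith) hab)

/-- As s ≥ 2, raising the exponent by one pays for a sum. The assumption 16 ≤ s also absorbs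
numerical constants, so each estimate ends as a single power of s. -/
theorem add_le_pow (hs : 16 ≤ s) (hx : x ≤ s ^ a) (hy : y ≤ s ^ b) (ha : a < c) (hb : b < c) :
    x + y ≤ s ^ c := by
  obtain ⟨c, rfl⟩ : ∃ k, c = k + 1 := ⟨c - 1, by omega⟩
  have h1 := le_pow_up hs hx (show a ≤ c by omega)
  have h2 := le_pow_up hs hy (show b ≤ c by omega)
  have h3 : (0 : ℝ) ≤ s ^ c := by positivity
  rw [pow_succ]
  nlinarith

theorem mul_le_pow (hs : 16 ≤ s) (hx : x ≤ s ^ a) (hy : y ≤ s ^ b) (hy0 : 0 ≤ y)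
    (h : a + b ≤ c) : x * y ≤ s ^ c := by
  refine le_pow_up hs ?_ h
  rw [pow_add]
  exact mul_le_mul hx hy hy0 (by positivity)

theorem le_pow_of_sq_le (hs : 16 ≤ s) (h : x ^ 2 ≤ s ^ a) (hab : a ≤ 2 * b) : x ≤ s ^ b := by
  have h1 := le_pow_up hs h hab
  rw [mul_comm, pow_mul] at h1
  exact (abs_le_of_sq_le_sq' h1 (by positivity)).2

theorem le_pow_of_mul_le {σ : ℝ} (hσ : 0 < σ) (hs : 16 ≤ s) (hσs : 1 / σ ≤ s)
    (h : σ * x ≤ s ^ a) (hab : a + 1 ≤ b) : x ≤ s ^ b := by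
  have h1 : x ≤ s * s ^ a := by
    calc x = 1 / σ * (σ * x) := by field_simp
      _ ≤ 1 / σ * s ^ a := by gcongr
      _ ≤ s * s ^ a := by gcongr
  rw [← pow_succ'] at h1
  exact le_pow_up hs h1 hab

end PowerBounds

section Recursion

variable {n : ℕ}

theorem euclNorm_recursion_le {A : Matrix (Fin n) (Fin n) ℝ} {s ρ : ℝ} (hs : 16 ≤ s)
    (hA : ‖A‖ ≤ s) (hρ : 0 ≤ ρ) {e r : ℕ → Fin n → ℝ} (h0 : e 0 = 0)
    (he : ∀ k, e (k + 1) = A *ᵥ e k + r k) {N : ℕ} (hr : ∀ k < N, euclNorm (r k) ≤ ρ) :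
    ∀ k ≤ N, euclNorm (e k) ≤ s ^ (2 * k) * ρ := by
  intro k
  induction k with
  | zero =>
    intro _
    rw [h0, euclNorm_eq_zero.2 rfl]; positivity
  | succ k ih =>
    intro hk
    rw [he]
    have h1 := (euclNorm_mulVec_le A (e k)).trans (mul_le_mul_of_nonneg_right hA
      (euclNorm_nonneg _))
    have h2 := mul_le_mul_of_nonneg_left (ih (by omega)) (by linarith : 0 ≤ s)
    have h3 := (euclNorm_add_le (A *ᵥ e k) (r k))
    have h4 := hr k (by omega)
    have h5 : (1 : ℝ) ≤ s ^ (2 * k) := one_le_pow₀ (by linarith)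
    have h6 : s * (s ^ (2 * k) * ρ) + ρ ≤ s ^ (2 * (k + 1)) * ρ := by
      have : s ^ (2 * (k + 1)) = s ^ (2 * k) * s ^ 2 := by ring
      rw [this]
      have h7 : s * s ^ (2 * k) + 1 ≤ s ^ (2 * k) * s ^ 2 := by
        nlinarith [mul_nonneg (sub_nonneg.2 h5) (show 0 ≤ s ^ 2 - s by nlinarith)]
      nlinarith
    linarith

theorem quad_add_le {ι : Type*} [Fintype ι] {Q : Matrix ι ι ℝ} (hQ : Q.PosSemidef)
    (v w : ι → ℝ) : (v + w) ⬝ᵥ Q *ᵥ (v + w) ≤ 2 * (v ⬝ᵥ Q *ᵥ v) + 2 * (w ⬝ᵥ Q *ᵥ w) := by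
  have h1 := hQ.quad_nonneg (v - w)
  simp only [Matrix.mulVec_add, Matrix.mulVec_sub, add_dotProduct, dotProduct_add,
      sub_dotProduct, dotProduct_sub] at h1 ⊢
  linarith

end Recursion

/-! ### Observability and uniform bounds on the sublevel set. -/

namespace Model

variable {n m : ℕ} {Ω : Type*} [MeasurableSpace Ω] {M : Model n m Ω}

theorem quad_gramian (M : Model n m Ω) (μ : ℝ) (v : Fin n → ℝ) : v ⬝ᵥ M.gramian μ *ᵥ v
    = ∑ k ∈ Finset.range n, (M.A ^ k *ᵥ v) ⬝ᵥ M.Qμ μ *ᵥ (M.A ^ k *ᵥ v) := by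
  rw [gramian, Matrix.sum_mulVec, dotProduct_sum]
  exact Finset.sum_congr rfl fun k _ => quad_conj _ _ _

/-- As Q_μ ≥ Q, a zero of the form is annihilated by Q^{1/2}Aᵏ for every k < n, and observability
makes it vanish. -/
theorem gramian_posDef (hM : M.Standing) {μ : ℝ} (hμ : 0 ≤ μ) : (M.gramian μ).PosDef := by
  have hQμ := Qμ_posSemidef hM hμ
  refine posDef_of_quad ?_ fun v hv => ?_
  · simp [gramian, Matrix.transpose_sum, hQμ.transpose_eq, Matrix.mul_assoc]
  · rw [quad_gramian]
    have hnn : ∀ k ∈ Finset.range n, 0 ≤ (M.A ^ k *ᵥ v) ⬝ᵥ M.Qμ μ *ᵥ (M.A ^ k *ᵥ v) :=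
      fun k _ => hQμ.quad_nonneg _
    refine lt_of_le_of_ne (Finset.sum_nonneg hnn) fun h0 => hv ?_
    refine mulVec_eq_zero_of_rank hM.observable ?_
    ext ki
    have h1 := (Finset.sum_eq_zero_iff_of_nonneg hnn).1 h0.symm ki.1 (Finset.mem_range.2 ki.1.2)
    have h2 := (Qμ_sub_posSemidef hM hμ).quad_nonneg (M.A ^ (ki.1 : ℕ) *ᵥ v)
    rw [Matrix.sub_mulVec, dotProduct_sub, h1] at h2
    have hC : (CFC.sqrt M.Q)ᵀ = CFC.sqrt M.Q :=
      (Matrix.nonneg_iff_posSemidef.1 (CFC.sqrt_nonneg M.Q)).transpose_eq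
    have h3 : (CFC.sqrt M.Q *ᵥ (M.A ^ (ki.1 : ℕ) *ᵥ v))
        ⬝ᵥ (CFC.sqrt M.Q *ᵥ (M.A ^ (ki.1 : ℕ) *ᵥ v)) ≤ 0 := by
      have h4 := quad_conj 1 (CFC.sqrt M.Q) (M.A ^ (ki.1 : ℕ) *ᵥ v)
      rw [hC, Matrix.mul_one, CFC.sqrt_mul_sqrt_self M.Q hM.Q_psd.nonneg, Matrix.one_mulVec] at h4
      rw [← h4]; linarith
    have h5 := dotProduct_self_eq_zero.1 (le_antisymm h3 (dotProduct_self_nonneg' _))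
    rw [Matrix.mulVec_mulVec] at h5
    exact congrFun h5 ki.2

/-- A stabilizing policy is given, so controllability enters the argument only through this
consequence. It also provides a nonempty input space and the strict inequalities for the contraction
factors. -/
theorem B_ne_zero [NeZero n] (hM : M.Standing) : M.B ≠ 0 := by
  intro h
  have h1 := hM.controllable
  rw [Controllable, h] at h1
  have h2 : (Matrix.of fun (i : Fin n) (kj : Fin n × Fin m) =>
      (M.A ^ (kj.1 : ℕ) * (0 : Matrix (Fin n) (Fin m) ℝ)) i kj.2) = 0 := by
    ext i kj; simp
  rw [h2, Matrix.rank_zero] at h1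
  exact NeZero.ne n h1.symm

theorem nonempty_inputs [NeZero n] (hM : M.Standing) : Nonempty (Fin m) := by
  by_contra hne
  rw [not_nonempty_iff] at hne
  exact B_ne_zero hM (Matrix.ext fun i j => hne.elim j)

/-- All the problem parameters, and the level `ℓ` of the Lagrangian, are at most `s`. -/
structure ParamBound (M : Model n m Ω) (μ ℓ s : ℝ) : Prop where
  sixteen_le : 16 ≤ s
  n_le : (n : ℝ) ≤ s
  A_le : ‖M.A‖ ≤ s
  B_le : ‖M.B‖ ≤ s
  Q_le : ‖M.Q‖ ≤ s
  R_le : ‖M.R‖ ≤ s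
  W_le : ‖M.W‖ ≤ s
  wbar_le : euclNorm M.wbar ≤ s
  M₃_le : euclNorm M.M₃ ≤ s
  μ_le : μ ≤ s
  tolBar_le : |M.tolBar| ≤ s
  level_le : ℓ ≤ s
  R_inv_le : 1 / minEig M.R ≤ s
  W_inv_le : 1 / minEig M.W ≤ s
  gramian_inv_le : 1 / minEig (M.gramian μ) ≤ s

variable {μ ℓ s : ℝ}

theorem norm_Qμ_le (hμ : 0 ≤ μ) (hb : M.ParamBound μ ℓ s) : ‖M.Qμ μ‖ ≤ s ^ 6 := by
  have hs := hb.sixteen_le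
  have h1 : ‖(4 * μ) • (M.Q * M.W * M.Q)‖ ≤ s ^ 5 := by
    rw [norm_smul, Real.norm_of_nonneg (by positivity)]
    have h2 : ‖M.Q * M.W * M.Q‖ ≤ s ^ 3 := by
      calc _ ≤ ‖M.Q‖ * ‖M.W‖ * ‖M.Q‖ :=
            (norm_mul_le _ _).trans (mul_le_mul_of_nonneg_right (norm_mul_le _ _) (norm_nonneg _))
        _ ≤ s * s * s := by gcongr <;> first | exact hb.Q_le | exact hb.W_le
        _ = s ^ 3 := by ring
    refine mul_le_pow hs (a := 2) ?_ h2 (norm_nonneg _) le_rfl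
    exact mul_le_pow hs (a := 1) (b := 1) (by rw [pow_one]; linarith) (by rw [pow_one]; exact hb.μ_le)
      hμ le_rfl
  exact (norm_add_le _ _).trans (add_le_pow hs (a := 1) (by rw [pow_one]; exact hb.Q_le) h1
    (by norm_num) (by norm_num))

theorem quad_Qμ_le (hμ : 0 ≤ μ) (hb : M.ParamBound μ ℓ s) (v : Fin n → ℝ) :
    v ⬝ᵥ M.Qμ μ *ᵥ v ≤ s ^ 6 * (v ⬝ᵥ v) :=
  (quad_le _ _).trans (mul_le_mul_of_nonneg_right (norm_Qμ_le hμ hb) (dotProduct_self_nonneg' v))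

theorem dotProduct_self_le_gramian [NeZero n] (hM : M.Standing) (hμ : 0 ≤ μ)
    (hb : M.ParamBound μ ℓ s) {v : Fin n → ℝ} {c : ℝ}
    (h : ∀ k < n, (M.A ^ k *ᵥ v) ⬝ᵥ M.Qμ μ *ᵥ (M.A ^ k *ᵥ v) ≤ c) : v ⬝ᵥ v ≤ s ^ 2 * c := by
  have hG := gramian_posDef hM hμ
  have hσ := minEig_pos hG
  have h1 := minEig_mul_le hG.posSemidef.transpose_eq v
  rw [quad_gramian] at h1
  have h2 := Finset.sum_le_sum fun k hk => h k (Finset.mem_range.1 hk)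
  have hc : 0 ≤ c := ((Qμ_posSemidef hM hμ).quad_nonneg _).trans (h 0 (Nat.pos_of_neZero n))
  rw [Finset.sum_const, Finset.card_range, nsmul_eq_mul] at h2
  have h3 : minEig (M.gramian μ) * (v ⬝ᵥ v) ≤ s * c :=
    (h1.trans h2).trans (mul_le_mul_of_nonneg_right hb.n_le hc)
  have hs := hb.sixteen_le
  calc v ⬝ᵥ v = 1 / minEig (M.gramian μ) * (minEig (M.gramian μ) * (v ⬝ᵥ v)) := by field_simp
    _ ≤ s * (s * c) := mul_le_mul hb.gramian_inv_le h3
        (mul_nonneg hσ.le (dotProduct_self_nonneg' v)) (by linarith)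
    _ = s ^ 2 * c := by ring

/-- Uniform observability of the closed loop through the stage cost. -/
theorem observability_ineq [NeZero n] (hM : M.Standing) (hμ : 0 ≤ μ) (hb : M.ParamBound μ ℓ s)
    (X : Policy n m) (v : Fin n → ℝ) :
    v ⬝ᵥ v ≤ s ^ (4 * n + 12) *
      ∑ j ∈ Finset.range n, (M.cl X ^ j *ᵥ v) ⬝ᵥ M.wt μ X *ᵥ (M.cl X ^ j *ᵥ v) := by
  have hs := hb.sixteen_le
  have := nonempty_inputs hM
  set Γ := ∑ j ∈ Finset.range n, (M.cl X ^ j *ᵥ v) ⬝ᵥ M.wt μ X *ᵥ (M.cl X ^ j *ᵥ v) with hΓ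
  have hterm : ∀ j < n, (M.cl X ^ j *ᵥ v) ⬝ᵥ M.wt μ X *ᵥ (M.cl X ^ j *ᵥ v) ≤ Γ := fun j hj =>
    Finset.single_le_sum (f := fun j => (M.cl X ^ j *ᵥ v) ⬝ᵥ M.wt μ X *ᵥ (M.cl X ^ j *ᵥ v))
      (fun j _ => (wt_posSemidef hM hμ X).quad_nonneg _) (Finset.mem_range.2 hj)
  have hsplit : ∀ w, w ⬝ᵥ M.wt μ X *ᵥ w
      = w ⬝ᵥ M.Qμ μ *ᵥ w + (X.gain *ᵥ w) ⬝ᵥ M.R *ᵥ (X.gain *ᵥ w) := fun w => by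
    rw [wt, Matrix.add_mulVec, dotProduct_add, quad_conj]
  have hΓ0 : 0 ≤ Γ := ((wt_posSemidef hM hμ X).quad_nonneg _).trans (hterm 0 (Nat.pos_of_neZero n))
  have hσR := minEig_pos hM.R_pd
  -- The gap between open-loop and closed-loop orbits is driven by BKx_k, and Kx_k is charged by the
  -- R part of the stage weight. Hence the comparison involves no bound on K.
  set e : ℕ → Fin n → ℝ := fun k => M.A ^ k *ᵥ v - M.cl X ^ k *ᵥ v with he
  set r : ℕ → Fin n → ℝ := fun k => M.B *ᵥ (X.gain *ᵥ (M.cl X ^ k *ᵥ v)) with hr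
  have hK : ∀ k < n, euclNorm (X.gain *ᵥ (M.cl X ^ k *ᵥ v)) ≤ Real.sqrt (s * Γ) := by
    intro k hk
    refine Real.le_sqrt_of_sq_le ?_
    rw [euclNorm_sq]
    set u := X.gain *ᵥ (M.cl X ^ k *ᵥ v)
    have h1 := minEig_mul_le hM.R_pd.posSemidef.transpose_eq u
    have h2 := hterm k hk
    rw [hsplit] at h2
    have h3 := (Qμ_posSemidef hM hμ).quad_nonneg (M.cl X ^ k *ᵥ v)
    calc u ⬝ᵥ u = 1 / minEig M.R * (minEig M.R * (u ⬝ᵥ u)) := by field_simp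
      _ ≤ s * Γ := mul_le_mul hb.R_inv_le (by linarith)
        (mul_nonneg hσR.le (dotProduct_self_nonneg' _)) (by linarith)
  have hrec := euclNorm_recursion_le (N := n) (e := e) (r := r) hs hb.A_le
    (ρ := s * Real.sqrt (s * Γ)) (by positivity) (by simp [he]) (fun k => by
      simp only [he, hr, pow_succ', ← Matrix.mulVec_mulVec]
      have : ∀ w, M.cl X *ᵥ w = M.A *ᵥ w - M.B *ᵥ (X.gain *ᵥ w) := fun w => by
        rw [cl, Matrix.sub_mulVec, Matrix.mulVec_mulVec]
      rw [this, Matrix.mulVec_sub]; abel)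
    (fun k hk => (euclNorm_mulVec_le _ _).trans
      (mul_le_mul hb.B_le (hK k hk) (euclNorm_nonneg _) (by linarith)))
  have hq : ∀ k < n, (M.A ^ k *ᵥ v) ⬝ᵥ M.Qμ μ *ᵥ (M.A ^ k *ᵥ v) ≤ s ^ (4 * n + 10) * Γ := by
    intro k hk
    have h1 : M.A ^ k *ᵥ v = M.cl X ^ k *ᵥ v + e k := by simp [he]
    rw [h1]
    refine (quad_add_le (Qμ_posSemidef hM hμ) _ _).trans ?_
    have h2 := hterm k hk
    rw [hsplit] at h2
    have h3 := hM.R_pd.posSemidef.quad_nonneg (X.gain *ᵥ (M.cl X ^ k *ᵥ v))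
    have h4 : e k ⬝ᵥ e k ≤ s ^ (4 * k + 3) * Γ := by
      rw [← euclNorm_sq]
      refine (pow_le_pow_left₀ (euclNorm_nonneg _) (hrec k hk.le) 2).trans (le_of_eq ?_)
      rw [mul_pow, mul_pow, Real.sq_sqrt (by positivity)]
      ring
    have h5 : e k ⬝ᵥ M.Qμ μ *ᵥ e k ≤ s ^ (4 * k + 9) * Γ := by
      refine (quad_Qμ_le hμ hb _).trans ?_
      refine (mul_le_mul_of_nonneg_left h4 (by positivity)).trans (le_of_eq ?_)
      ring
    have h6 : 2 + 2 * s ^ (4 * k + 9) ≤ s ^ (4 * n + 10) := by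
      have h7 : s ^ (4 * k + 9) * s ≤ s ^ (4 * n + 10) := by
        rw [← pow_succ]; exact pow_le_pow_right₀ (by linarith) (by omega)
      have h8 : (1 : ℝ) ≤ s ^ (4 * k + 9) := one_le_pow₀ (by linarith)
      nlinarith
    nlinarith
  refine (dotProduct_self_le_gramian hM hμ hb hq).trans (le_of_eq ?_)
  ring

theorem powStable_of_value_le [NeZero n] (hM : M.Standing) (hμ : 0 ≤ μ)
    (hb : M.ParamBound μ ℓ s) {X : Policy n m} {P : Matrix (Fin n) (Fin n) ℝ} (hP : P.PosSemidef)
    (h : (P - (M.cl X)ᵀ * P * M.cl X - M.wt μ X).PosSemidef) : PowStable (M.cl X) := by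
  have hs := hb.sixteen_le
  have hc : 0 < s ^ (4 * n + 12) := by positivity
  refine powStable_of_lyapunov (N := n) (c := (s ^ (4 * n + 12))⁻¹) hP (wt_posSemidef hM hμ X) h
    (inv_pos.2 hc) fun v => ?_
  rw [inv_mul_le_iff₀ hc]
  exact observability_ineq hM hμ hb X v

theorem trace_mul_hat (Z : Matrix (Fin n ⊕ Unit) (Fin n ⊕ Unit) ℝ) (C : Matrix (Fin n) (Fin n) ℝ) :
    (Z * hat C).trace = (Z.toBlocks₁₁ * C).trace := by
  conv_lhs => rw [← Matrix.fromBlocks_toBlocks Z, hat, Matrix.fromBlocks_multiply]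
  simp [Matrix.trace, Fintype.sum_sum_type]

theorem statL_eq (M : Model n m Ω) (μ : ℝ) (X : Policy n m) :
    M.statL μ X = (M.wt μ X * M.cov X).trace + M.stageCost X (M.xbar X)
      + μ * M.stageRisk (M.xbar X) - μ * M.tolBar := by
  have h1 : (M.augQ μ + Xᵀ * M.R * X).toBlocks₁₁ = M.wt μ X := by
    ext i j
    simp only [Matrix.toBlocks₁₁, Matrix.of_apply, Matrix.add_apply, augQ,
      Matrix.fromBlocks_apply₁₁, wt]
    congr 1
  have h2 : ((M.augQ μ + Xᵀ * M.R * X) * Matrix.vecMulVec (extend (M.xbar X))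
      (extend (M.xbar X))).trace = M.stageCost X (M.xbar X)
      + μ * M.stageRisk (M.xbar X) - μ * M.tolBar := by
    rw [Matrix.mul_vecMulVec, Matrix.trace_vecMulVec, dotProduct_comm, stageCost_eq, stageRisk_eq,
      augQ_eq]
    simp only [Matrix.add_mulVec, Matrix.sub_mulVec, dotProduct_add, dotProduct_sub,
      Matrix.smul_mulVec, dotProduct_smul, smul_eq_mul]
    have h3 : extend (M.xbar X) ⬝ᵥ Matrix.single (Sum.inr ()) (Sum.inr ()) 1 *ᵥ
        extend (M.xbar X) = 1 := by
      rw [Matrix.single_mulVec]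
      change extend (M.xbar X) ⬝ᵥ Pi.single (Sum.inr ()) (1 * extend (M.xbar X) (Sum.inr ())) = 1
      rw [dotProduct_single]; simp [extend]
    rw [h3]; ring
  rw [statL, statΦ, Matrix.mul_add, Matrix.trace_add, trace_mul_hat, h1, h2]
  ring

/-- The linear risk term has no sign. It is absorbed by half of the form of Q through ½ (x +
4μM₃)ᵀQ(x + 4μM₃) ≥ 0, at the price 8μ² M₃ᵀQM₃. -/
theorem statL_lower (hM : M.Standing) (X : Policy n m) :
    (M.wt μ X * M.cov X).trace + 1 / 2 * (M.xbar X ⬝ᵥ M.Qμ μ *ᵥ M.xbar X)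
      + action X (M.xbar X) ⬝ᵥ M.R *ᵥ action X (M.xbar X)
      + 1 / 2 * (4 * μ * (M.xbar X ⬝ᵥ (M.Q * M.W * M.Q) *ᵥ M.xbar X))
      ≤ M.statL μ X + 8 * μ ^ 2 * (M.M₃ ⬝ᵥ M.Q *ᵥ M.M₃) + μ * M.tolBar := by
  rw [statL_eq, stageCost, stageRisk]
  set x := M.xbar X
  have h1 := hM.Q_psd.quad_nonneg (x + (4 * μ) • M.M₃)
  have h2 := bilin_symm hM.Q_psd.transpose_eq M.M₃ x
  simp only [Matrix.mulVec_add, Matrix.mulVec_smul, add_dotProduct, dotProduct_add,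
    smul_dotProduct, dotProduct_smul, smul_eq_mul, h2] at h1
  have h3 : x ⬝ᵥ M.Qμ μ *ᵥ x = x ⬝ᵥ M.Q *ᵥ x + 4 * μ * (x ⬝ᵥ (M.Q * M.W * M.Q) *ᵥ x) := by
    rw [Qμ, Matrix.add_mulVec, dotProduct_add, Matrix.smul_mulVec, dotProduct_smul, smul_eq_mul]
  rw [h3]
  linarith

theorem level_bounds (hM : M.Standing) (hμ : 0 ≤ μ) (hb : M.ParamBound μ ℓ s) {X : Policy n m}
    (h : PowStable (M.cl X)) :
    (M.statL μ X ≤ s → (M.wt μ X * M.cov X).trace ≤ s ^ 7 ∧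
      M.xbar X ⬝ᵥ M.Qμ μ *ᵥ M.xbar X ≤ s ^ 8 ∧
      action X (M.xbar X) ⬝ᵥ M.R *ᵥ action X (M.xbar X) ≤ s ^ 7) ∧ -s ^ 7 ≤ M.statL μ X := by
  have hs := hb.sixteen_le
  have h1 := statL_lower (μ := μ) hM X
  have t1 := trace_mul_nonneg (wt_posSemidef hM hμ X) (cov_posSemidef hM h)
  have t2 := (Qμ_posSemidef hM hμ).quad_nonneg (M.xbar X)
  have t3 := hM.R_pd.posSemidef.quad_nonneg (action X (M.xbar X))
  have t4 : 0 ≤ 4 * μ * (M.xbar X ⬝ᵥ (M.Q * M.W * M.Q) *ᵥ M.xbar X) := by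
    have := hM.W_pd.posSemidef.conj M.Q
    rw [hM.Q_psd.transpose_eq] at this
    exact mul_nonneg (by positivity) (this.quad_nonneg _)
  have u1 : 8 * μ ^ 2 * (M.M₃ ⬝ᵥ M.Q *ᵥ M.M₃) ≤ 8 * s ^ 5 := by
    have : M.M₃ ⬝ᵥ M.Q *ᵥ M.M₃ ≤ s * s ^ 2 := by
      refine (quad_le _ _).trans ?_
      rw [← euclNorm_sq]
      exact mul_le_mul hb.Q_le (pow_le_pow_left₀ (euclNorm_nonneg _) hb.M₃_le 2) (by positivity)
        (by linarith)
    calc _ ≤ 8 * s ^ 2 * (s * s ^ 2) := by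
          gcongr
          · exact hM.Q_psd.quad_nonneg _
          · exact hb.μ_le
      _ = _ := by ring
  have u2 : μ * M.tolBar ≤ s * s :=
    mul_le_mul_of_nonneg hb.μ_le ((le_abs_self _).trans hb.tolBar_le) hμ (by linarith)
  have p1 : s + 8 * s ^ 5 + s * s ≤ s ^ 7 := by
    have a1 : s ≤ s ^ 5 := le_pow_up hs (a := 1) (by simp) (by norm_num)
    have a2 : s * s ≤ s ^ 5 := le_pow_up hs (a := 2) (by rw [pow_two]) (by norm_num)
    have a3 : s ^ 5 * 16 ≤ s ^ 6 := by rw [pow_succ s 5]; gcongr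
    have a4 : s ^ 6 ≤ s ^ 7 := pow_le_pow_right₀ (by linarith) (by norm_num)
    nlinarith
  refine ⟨fun hX => ⟨by linarith, ?_, by linarith⟩, by linarith⟩
  have : 2 * s ^ 7 ≤ s ^ 8 := by rw [pow_succ s 7]; nlinarith [pow_nonneg (by linarith : 0 ≤ s) 7]
  linarith

theorem cov_sub_conj_posSemidef (hM : M.Standing) {X : Policy n m} (h : PowStable (M.cl X))
    (j : ℕ) : (M.cov X - M.cl X ^ j * M.cov X * (M.cl X ^ j)ᵀ).PosSemidef := by
  induction j with
  | zero => simpa using Matrix.PosSemidef.zero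
  | succ j ih =>
    have := hM.W_pd.posSemidef.add (ih.conj' (M.cl X))
    convert this using 1
    nth_rewrite 1 [M.cov_eq h]
    rw [pow_succ', Matrix.transpose_mul]
    simp only [Matrix.mul_sub, Matrix.sub_mul, Matrix.mul_assoc]
    abel

/-- Observability bounds tr cov by the weights along n closed-loop steps. Since cov ≥ Dʲ cov (Dʲ)ᵀ,
where D = A - BK, each of these n terms is at most the stationary stage weight, which the level
bounds. -/
theorem trace_cov_le [NeZero n] (hM : M.Standing) (hμ : 0 ≤ μ) (hb : M.ParamBound μ ℓ s)
    {X : Policy n m} (h : PowStable (M.cl X)) (hX : M.statL μ X ≤ s) :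
    (M.cov X).trace ≤ s ^ (4 * n + 20) := by
  have hs := hb.sixteen_le
  have hc : 0 < s ^ (4 * n + 12) := by positivity
  set G := ∑ j ∈ Finset.range n, (M.cl X ^ j)ᵀ * M.wt μ X * M.cl X ^ j with hG
  have hGq : ∀ v, v ⬝ᵥ G *ᵥ v
      = ∑ j ∈ Finset.range n, (M.cl X ^ j *ᵥ v) ⬝ᵥ M.wt μ X *ᵥ (M.cl X ^ j *ᵥ v) := fun v => by
    rw [hG, Matrix.sum_mulVec, dotProduct_sum]
    exact Finset.sum_congr rfl fun k _ => quad_conj _ _ _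
  have h1 := mul_trace_le (cov_posSemidef hM h) (N := G) (c := (s ^ (4 * n + 12))⁻¹) (by
      simp [hG, Matrix.transpose_sum, (wt_posSemidef hM hμ X).transpose_eq, Matrix.mul_assoc])
    (fun v => by rw [inv_mul_le_iff₀ hc, hGq]; exact observability_ineq hM hμ hb X v)
  have h2 : (M.cov X * G).trace ≤ n * (M.wt μ X * M.cov X).trace := by
    rw [hG, Matrix.mul_sum, Matrix.trace_sum]
    have : ∀ j ∈ Finset.range n, (M.cov X * ((M.cl X ^ j)ᵀ * M.wt μ X * M.cl X ^ j)).trace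
        ≤ (M.wt μ X * M.cov X).trace := fun j _ => by
      have h3 := trace_mul_mono (wt_posSemidef hM hμ X) (cov_sub_conj_posSemidef hM h j)
      refine (le_of_eq ?_).trans h3
      rw [Matrix.trace_mul_comm]
      simp only [Matrix.mul_assoc]
      rw [Matrix.trace_mul_comm]
      simp only [Matrix.mul_assoc]
    refine (Finset.sum_le_sum this).trans ?_
    simp
  have h3 := ((level_bounds hM hμ hb h).1 hX).1
  rw [inv_mul_le_iff₀ hc] at h1
  have h4 : (M.cov X * G).trace ≤ s ^ 8 := h2.trans (mul_le_pow hs (a := 1) (b := 7)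
    (by rw [pow_one]; exact hb.n_le) h3
    (trace_mul_nonneg (wt_posSemidef hM hμ X) (cov_posSemidef hM h)) le_rfl)
  refine h1.trans ?_
  calc _ ≤ s ^ (4 * n + 12) * s ^ 8 := by gcongr
    _ = _ := by ring

/-- From W ≥ σ·1, with σ the minimum eigenvalue of W, the covariance dominates σ times the Lyapunov
matrix of the transposed closed loop. So a bound on the cost is a uniform stability margin. -/
theorem norm_lyap_one_le [NeZero n] (hM : M.Standing) (hμ : 0 ≤ μ) (hb : M.ParamBound μ ℓ s)
    {X : Policy n m} (h : PowStable (M.cl X)) (hX : M.statL μ X ≤ s) :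
    ‖lyap (M.cl X) 1‖ ≤ s ^ (4 * n + 21) := by
  have hs := hb.sixteen_le
  have hσ := minEig_pos hM.W_pd
  refine (norm_le_trace (h.lyap_posSemidef Matrix.PosSemidef.one)).trans ?_
  rw [← h.trace_lyap_one]
  have h1 : (M.cov X - minEig M.W • lyap (M.cl X)ᵀ 1).PosSemidef := by
    have hT := h.transpose.lyap_posSemidef (F := 1) Matrix.PosSemidef.one
    refine h.transpose.posSemidef ?_ ?_
    · simp [(cov_posSemidef hM h).transpose_eq, hT.transpose_eq]
    · have e1 := M.cov_eq h
      have e2 := h.transpose.lyap_eq (1 : Matrix (Fin n) (Fin n) ℝ)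
      have e3 : M.cov X - minEig M.W • lyap (M.cl X)ᵀ 1
          - (M.cl X)ᵀᵀ * (M.cov X - minEig M.W • lyap (M.cl X)ᵀ 1) * (M.cl X)ᵀ
          = M.W - minEig M.W • 1 := by
        nth_rewrite 1 [e1, e2]
        simp only [Matrix.transpose_transpose, Matrix.mul_sub, Matrix.sub_mul, smul_add,
          Matrix.mul_smul, Matrix.smul_mul]
        abel
      rw [e3]
      refine posSemidef_of_quad (by simp [W_transpose hM]) fun v => ?_
      rw [Matrix.sub_mulVec, dotProduct_sub, quad_one]
      linarith [minEig_mul_le (W_transpose hM) v]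
  have h2 := h1.trace_nonneg
  rw [Matrix.trace_sub, Matrix.trace_smul, smul_eq_mul] at h2
  exact le_pow_of_mul_le hσ hs hb.W_inv_le
    ((by linarith : _ ≤ (M.cov X).trace).trans (trace_cov_le hM hμ hb h hX)) (by omega)

theorem norm_cl_le [NeZero n] (hM : M.Standing) (hμ : 0 ≤ μ) (hb : M.ParamBound μ ℓ s)
    {X : Policy n m} (h : PowStable (M.cl X)) (hX : M.statL μ X ≤ s) :
    ‖M.cl X‖ ≤ s ^ (4 * n + 21) :=
  le_pow_of_sq_le hb.sixteen_le (h.norm_sq_le.trans (norm_lyap_one_le hM hμ hb h hX)) (by omega)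

theorem euclNorm_action_le [NeZero n] (hM : M.Standing) (hμ : 0 ≤ μ) (hb : M.ParamBound μ ℓ s)
    {X : Policy n m} (h : PowStable (M.cl X)) (hX : M.statL μ X ≤ s) :
    euclNorm (action X (M.xbar X)) ≤ s ^ 4 := by
  have := nonempty_inputs hM
  have h1 := ((level_bounds hM hμ hb h).1 hX).2.2
  have h2 := minEig_mul_le hM.R_pd.posSemidef.transpose_eq (action X (M.xbar X))
  refine le_pow_of_sq_le (a := 8) hb.sixteen_le ?_ (by norm_num)
  rw [euclNorm_sq]
  exact le_pow_of_mul_le (minEig_pos hM.R_pd) hb.sixteen_le hb.R_inv_le (h2.trans h1) (by norm_num)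

/-- The mean satisfies x̄ = A x̄ + d, where d = Bū + w̄ is bounded because R charges the mean action
ū. So Aᵏx̄ stays near x̄, whose Q_μ form is bounded by the level, and the Gramian bounds x̄. -/
theorem euclNorm_xbar_le [NeZero n] (hM : M.Standing) (hμ : 0 ≤ μ) (hb : M.ParamBound μ ℓ s)
    {X : Policy n m} (h : PowStable (M.cl X)) (hX : M.statL μ X ≤ s) :
    euclNorm (M.xbar X) ≤ s ^ (2 * n + 11) := by
  have hs := hb.sixteen_le
  set x := M.xbar X with hx
  set d := M.B *ᵥ action X x + M.wbar with hd
  have hd' : euclNorm d ≤ s ^ 6 := by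
    refine (euclNorm_add_le _ _).trans (add_le_pow hs (a := 5) (b := 1) ?_ (by
      rw [pow_one]; exact hb.wbar_le) (by norm_num) (by norm_num))
    exact (euclNorm_mulVec_le _ _).trans (mul_le_pow hs (a := 1) (b := 4)
      (by rw [pow_one]; exact hb.B_le) (euclNorm_action_le hM hμ hb h hX) (euclNorm_nonneg _) le_rfl)
  have hfix : x = M.A *ᵥ x + d := by
    have h1 := M.xbar_eq h
    rw [← hx] at h1
    conv_lhs => rw [h1]
    rw [hd, action, cl, drift, Matrix.sub_mulVec, Matrix.mulVec_add, Matrix.mulVec_neg,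
      Matrix.mulVec_mulVec]
    abel
  set e : ℕ → Fin n → ℝ := fun k => x - M.A ^ k *ᵥ x with he
  have hrec := euclNorm_recursion_le (N := n) (e := e) (r := fun _ => d) hs hb.A_le
    (ρ := s ^ 6) (by positivity) (by simp [he]) (fun k => by
      simp only [he, pow_succ', ← Matrix.mulVec_mulVec, Matrix.mulVec_sub]
      nth_rewrite 1 [hfix]
      abel) (fun k _ => hd')
  have hq : ∀ k < n, (M.A ^ k *ᵥ x) ⬝ᵥ M.Qμ μ *ᵥ (M.A ^ k *ᵥ x) ≤ s ^ (4 * n + 20) := by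
    intro k hk
    have h1 : M.A ^ k *ᵥ x = x + -e k := by simp [he]
    rw [h1]
    refine (quad_add_le (Qμ_posSemidef hM hμ) _ _).trans ?_
    have h2 := ((level_bounds hM hμ hb h).1 hX).2.1
    have h3 : (-e k) ⬝ᵥ M.Qμ μ *ᵥ (-e k) ≤ s ^ (4 * k + 18) := by
      refine (quad_Qμ_le hμ hb _).trans ?_
      rw [neg_dotProduct_neg, ← euclNorm_sq]
      refine (mul_le_mul_of_nonneg_left (pow_le_pow_left₀ (euclNorm_nonneg _) (hrec k hk.le) 2)
        (by positivity)).trans (le_of_eq ?_)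
      ring
    have t2 : (2 : ℝ) ≤ s ^ 1 := by rw [pow_one]; linarith
    refine add_le_pow hs (a := 9) (b := 4 * k + 19) ?_ ?_ (by omega) (by omega)
    · exact mul_le_pow hs t2 h2 ((Qμ_posSemidef hM hμ).quad_nonneg _) (by omega)
    · exact mul_le_pow hs t2 h3 ((Qμ_posSemidef hM hμ).quad_nonneg _) (by omega)
  refine le_pow_of_sq_le (a := 4 * n + 22) hs ?_ (by omega)
  rw [euclNorm_sq]
  refine (dotProduct_self_le_gramian hM hμ hb hq).trans (le_of_eq ?_)
  ring

/-- As cov ≥ W, the level bounds the trace of Q_μ + KᵀRK, and R > 0 then bounds K. -/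
theorem norm_gain_le [NeZero n] (hM : M.Standing) (hμ : 0 ≤ μ) (hb : M.ParamBound μ ℓ s)
    {X : Policy n m} (h : PowStable (M.cl X)) (hX : M.statL μ X ≤ s) : ‖X.gain‖ ≤ s ^ 5 := by
  have hs := hb.sixteen_le
  have := nonempty_inputs hM
  have hwt := wt_posSemidef hM hμ X
  have h1 := ((level_bounds hM hμ hb h).1 hX).1
  have h2 := trace_mul_mono hwt (cov_sub_W_posSemidef hM h)
  have h3 := mul_trace_le hwt (W_transpose hM) (minEig_mul_le (W_transpose hM))
  have h4 : (M.wt μ X).trace ≤ s ^ 8 :=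
    le_pow_of_mul_le (minEig_pos hM.W_pd) hs hb.W_inv_le ((h3.trans h2).trans h1) (by norm_num)
  refine norm_le_of_mulVec (by positivity) fun v => ?_
  refine abs_le_of_sq_le_sq' ?_ (mul_nonneg (by positivity) (euclNorm_nonneg _)) |>.2
  rw [mul_pow, euclNorm_sq, euclNorm_sq]
  have h5 := quad_le_trace hwt v
  rw [wt, Matrix.add_mulVec, dotProduct_add, quad_conj] at h5
  have h6 := minEig_mul_le hM.R_pd.posSemidef.transpose_eq (X.gain *ᵥ v)
  have h7 := (Qμ_posSemidef hM hμ).quad_nonneg v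
  have hσR := minEig_pos hM.R_pd
  have hv := dotProduct_self_nonneg' v
  have h8 : minEig M.R * (X.gain *ᵥ v ⬝ᵥ X.gain *ᵥ v) ≤ s ^ 8 * (v ⬝ᵥ v) := by
    have := mul_le_mul_of_nonneg_right h4 hv
    rw [wt] at this
    linarith
  calc X.gain *ᵥ v ⬝ᵥ X.gain *ᵥ v
      = 1 / minEig M.R * (minEig M.R * (X.gain *ᵥ v ⬝ᵥ X.gain *ᵥ v)) := by field_simp
    _ ≤ s * (s ^ 8 * (v ⬝ᵥ v)) := mul_le_mul hb.R_inv_le h8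
        (mul_nonneg hσR.le (dotProduct_self_nonneg' _)) (by linarith)
    _ = s ^ 9 * (v ⬝ᵥ v) := by ring
    _ ≤ (s ^ 5) ^ 2 * (v ⬝ᵥ v) := by
        rw [← pow_mul]
        gcongr
        · linarith
        · norm_num

theorem norm_policy_le [NeZero n] (hM : M.Standing) (hμ : 0 ≤ μ) (hb : M.ParamBound μ ℓ s)
    {X : Policy n m} (h : PowStable (M.cl X)) (hX : M.statL μ X ≤ s) :
    ‖X‖ ≤ s ^ (2 * n + 18) := by
  have hs := hb.sixteen_le
  have hK := norm_gain_le hM hμ hb h hX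
  have hl : euclNorm X.offset ≤ s ^ (2 * n + 17) := by
    have : X.offset = action X (M.xbar X) + X.gain *ᵥ M.xbar X := by rw [action]; abel
    rw [this]
    refine (euclNorm_add_le _ _).trans (add_le_pow hs (euclNorm_action_le hM hμ hb h hX)
      (b := 2 * n + 16) ?_ (by omega) (by omega))
    exact (euclNorm_mulVec_le _ _).trans (mul_le_pow hs hK (euclNorm_xbar_le hM hμ hb h hX)
      (euclNorm_nonneg _) (by omega))
  refine norm_le_of_mulVec (by positivity) fun z => ?_
  have e1 : X *ᵥ z = X.gain *ᵥ (z ∘ Sum.inl) + z (Sum.inr ()) • X.offset := by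
    ext i
    simp [Policy.gain, Policy.offset, Matrix.mulVec, dotProduct, Fintype.sum_sum_type, mul_comm]
  have e2 : euclNorm (z ∘ Sum.inl) ≤ euclNorm z := by
    refine abs_le_of_sq_le_sq' ?_ (euclNorm_nonneg _) |>.2
    rw [euclNorm_sq, euclNorm_sq, sum_dotProduct_sum z]
    nlinarith [sq_nonneg (z (Sum.inr ()))]
  have e3 : euclNorm (z (Sum.inr ()) • X.offset) ≤ euclNorm z * s ^ (2 * n + 17) := by
    have : euclNorm (z (Sum.inr ()) • X.offset) = |z (Sum.inr ())| * euclNorm X.offset :=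
      norm_smul (z (Sum.inr ())) (WithLp.toLp 2 X.offset)
    rw [this]
    exact mul_le_mul (abs_apply_le_euclNorm z _) hl (euclNorm_nonneg _) (euclNorm_nonneg _)
  rw [e1]
  refine (euclNorm_add_le _ _).trans ?_
  have e4 : euclNorm (X.gain *ᵥ (z ∘ Sum.inl)) ≤ s ^ 5 * euclNorm z :=
    (euclNorm_mulVec_le _ _).trans (mul_le_mul hK e2 (euclNorm_nonneg _) (by positivity))
  have e5 : s ^ 5 + s ^ (2 * n + 17) ≤ s ^ (2 * n + 18) :=
    add_le_pow hs le_rfl le_rfl (by omega) (by omega)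
  nlinarith [euclNorm_nonneg z]

theorem trace_P_mul_W (hM : M.Standing) (hμ : 0 ≤ μ) {X : Policy n m}
    (h : PowStable (M.cl X)) :
    (M.P μ X.gain * M.W).trace = (M.wt μ X * M.cov X).trace := by
  rw [P_eq_lyap hM hμ h, h.trace_lyap_mul, cov]

theorem norm_RK_le [NeZero n] (hM : M.Standing) (hμ : 0 ≤ μ) (hb : M.ParamBound μ ℓ s)
    {X : Policy n m} (h : PowStable (M.cl X)) (hX : M.statL μ X ≤ s) :
    ‖M.RK μ X.gain‖ ≤ s ^ 11 := by
  have hs := hb.sixteen_le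
  have hP := P_posSemidef hM hμ h
  have h1 := ((level_bounds hM hμ hb h).1 hX).1
  rw [← trace_P_mul_W hM hμ h] at h1
  have h2 := mul_trace_le hP (W_transpose hM) (minEig_mul_le (W_transpose hM))
  have h3 : ‖M.P μ X.gain‖ ≤ s ^ 8 := (norm_le_trace hP).trans
    (le_pow_of_mul_le (minEig_pos hM.W_pd) hs hb.W_inv_le (h2.trans h1) (by norm_num))
  refine (norm_add_le _ _).trans (add_le_pow hs (a := 1) (b := 10)
    (by rw [pow_one]; exact hb.R_le) ?_ (by norm_num) (by norm_num))
  refine (Matrix.l2_opNorm_mul _ _).trans ?_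
  have hB : ‖M.B‖ ≤ s ^ 1 := by rw [pow_one]; exact hb.B_le
  refine mul_le_pow hs (a := 9) ?_ hB (norm_nonneg _) (by norm_num)
  refine (Matrix.l2_opNorm_mul _ _).trans ?_
  rw [norm_transpose]
  exact mul_le_pow hs hB h3 (norm_nonneg _) (by norm_num)

theorem dotProduct_self_le_pow_mul_statΦ [NeZero n] (hM : M.Standing) (hμ : 0 ≤ μ)
    (hb : M.ParamBound μ ℓ s) {X : Policy n m} (h : PowStable (M.cl X)) (hX : M.statL μ X ≤ s)
    (z : Fin n ⊕ Unit → ℝ) : z ⬝ᵥ z ≤ s ^ (4 * n + 26) * (z ⬝ᵥ M.statΦ X *ᵥ z) := by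
  have hs := hb.sixteen_le
  refine (dotProduct_self_le_statΦ hM h z).trans (mul_le_mul_of_nonneg_right ?_
    ((statΦ_posDef hM h).posSemidef.quad_nonneg z))
  have hx := euclNorm_xbar_le hM hμ hb h hX
  have t1 : euclNorm (M.xbar X) ^ 2 ≤ s ^ (4 * n + 22) := by
    refine (pow_le_pow_left₀ (euclNorm_nonneg _) hx 2).trans (le_of_eq ?_)
    ring
  refine add_le_pow hs (a := 4 * n + 25) (b := 1) ?_ (by rw [pow_one]; linarith) (by omega)
    (by omega)
  rw [div_eq_mul_one_div]
  refine mul_le_pow hs (a := 4 * n + 24) (b := 1) ?_ (by rw [pow_one]; exact hb.W_inv_le)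
    (by have := minEig_pos hM.W_pd; positivity) (by omega)
  refine add_le_pow hs (a := 0) (b := 4 * n + 23) (by simp) ?_ (by omega) (by omega)
  exact mul_le_pow hs (a := 1) (by rw [pow_one]; linarith) t1 (by positivity) (by omega)

theorem euclNorm_extend_xbar_le [NeZero n] (hM : M.Standing) (hμ : 0 ≤ μ)
    (hb : M.ParamBound μ ℓ s) {X : Policy n m} (h : PowStable (M.cl X)) (hX : M.statL μ X ≤ s) :
    euclNorm (extend (M.xbar X)) ≤ s ^ (2 * n + 12) := by
  have hs := hb.sixteen_le
  refine le_pow_of_sq_le hs (a := 4 * n + 23) ?_ (by omega)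
  rw [euclNorm_extend_sq]
  refine add_le_pow hs (a := 4 * n + 22) (b := 0) ?_ (by simp) (by omega) (by omega)
  refine (pow_le_pow_left₀ (euclNorm_nonneg _) (euclNorm_xbar_le hM hμ hb h hX) 2).trans
    (le_of_eq ?_)
  ring

theorem norm_statΦ_le [NeZero n] (hM : M.Standing) (hμ : 0 ≤ μ) (hb : M.ParamBound μ ℓ s)
    {X : Policy n m} (h : PowStable (M.cl X)) (hX : M.statL μ X ≤ s) :
    ‖M.statΦ X‖ ≤ s ^ (4 * n + 25) := by
  have hs := hb.sixteen_le
  refine (norm_le_trace (statΦ_posDef hM h).posSemidef).trans ?_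
  have : (M.statΦ X).trace = (M.cov X).trace + euclNorm (extend (M.xbar X)) ^ 2 := by
    rw [statΦ, Matrix.trace_add, Matrix.trace_vecMulVec, euclNorm_sq]
    congr 1
    simp [Matrix.trace, Fintype.sum_sum_type, hat]
  rw [this]
  refine add_le_pow hs (trace_cov_le hM hμ hb h hX) (b := 4 * n + 24) ?_ (by omega) (by omega)
  refine (pow_le_pow_left₀ (euclNorm_nonneg _) (euclNorm_extend_xbar_le hM hμ hb h hX) 2).trans
    (le_of_eq ?_)
  ring

end Model

/-! ### Gradient dominance and preconditioned steps. -/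

section Weighted

variable {ι κ : Type*} [Fintype ι] [Fintype κ] [DecidableEq ι] [DecidableEq κ]

theorem trace_conj_le {N : Matrix κ κ ℝ} (hN : N.PosSemidef) (E : Matrix κ ι ℝ) {Φ : Matrix ι ι ℝ}
    (hΦ : Φᵀ = Φ) {c : ℝ} (h : ∀ z, z ⬝ᵥ Φ *ᵥ z ≤ c * (z ⬝ᵥ z)) :
    (N * (E * Φ * Eᵀ)).trace ≤ c * (N * (E * Eᵀ)).trace := by
  have h1 : (c • 1 - Φ).PosSemidef := by
    refine posSemidef_of_quad (by simp [hΦ]) fun z => ?_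
    rw [Matrix.sub_mulVec, dotProduct_sub, quad_one]
    linarith [h z]
  have h2 := trace_mul_nonneg hN (h1.conj' E)
  simp only [Matrix.mul_sub, Matrix.sub_mul, Matrix.trace_sub, Matrix.mul_smul, Matrix.smul_mul,
    Matrix.mul_one, Matrix.trace_smul, smul_eq_mul] at h2
  linarith

theorem le_trace_conj {N : Matrix κ κ ℝ} (hN : N.PosSemidef) (E : Matrix κ ι ℝ) {Φ : Matrix ι ι ℝ}
    (hΦ : Φᵀ = Φ) {c : ℝ} (h : ∀ z, c * (z ⬝ᵥ z) ≤ z ⬝ᵥ Φ *ᵥ z) :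
    c * (N * (E * Eᵀ)).trace ≤ (N * (E * Φ * Eᵀ)).trace := by
  have := trace_conj_le hN E (Φ := -Φ) (c := -c) (by simp [hΦ]) fun z => by
    rw [Matrix.neg_mulVec, dotProduct_neg]; linarith [h z]
  simp only [Matrix.mul_neg, Matrix.neg_mul, Matrix.trace_neg] at this
  linarith

omit [DecidableEq ι] [DecidableEq κ] in
theorem mul_transpose_self_posSemidef (E : Matrix κ ι ℝ) : (E * Eᵀ).PosSemidef := by
  simpa [Matrix.conjTranspose_eq_transpose_of_trivial]
    using Matrix.posSemidef_self_mul_conjTranspose E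

theorem inv_quad_le {R : Matrix ι ι ℝ} (hR : R.PosDef) {σ : ℝ} (hσ : 0 < σ)
    (h : ∀ v, σ * (v ⬝ᵥ v) ≤ v ⬝ᵥ R *ᵥ v) (v : ι → ℝ) : v ⬝ᵥ R⁻¹ *ᵥ v ≤ σ⁻¹ * (v ⬝ᵥ v) := by
  set u := R⁻¹ *ᵥ v with hu
  have h1 : R *ᵥ u = v := by
    rw [hu, Matrix.mulVec_mulVec, Matrix.mul_nonsing_inv _ ((Matrix.isUnit_iff_isUnit_det _).1
      hR.isUnit), Matrix.one_mulVec]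
  have h2 := h u
  rw [h1, dotProduct_comm u v] at h2
  have h3 := dotProduct_self_nonneg' (v - σ • u)
  simp only [sub_dotProduct, dotProduct_sub, smul_dotProduct, dotProduct_smul, smul_eq_mul,
    dotProduct_comm u v] at h3
  rw [inv_mul_eq_div, le_div_iff₀ hσ]
  nlinarith

omit [DecidableEq ι] in
/-- Completing the square in the cost difference. -/
theorem neg_le_quadratic {R : Matrix κ κ ℝ} (hR : R.PosDef) {Φ : Matrix ι ι ℝ} (hΦ : Φ.PosSemidef)
    (E Δ : Matrix κ ι ℝ) : -(R⁻¹ * (E * Φ * Eᵀ)).trace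
      ≤ (R * (Δ * Φ * Δᵀ)).trace + 2 * (E * Φ * Δᵀ).trace := by
  have h1 := trace_mul_nonneg hR.posSemidef (hΦ.conj' (Δ + R⁻¹ * E))
  have hdet := (Matrix.isUnit_iff_isUnit_det _).1 hR.isUnit
  have hRi : (R⁻¹)ᵀ = R⁻¹ := hR.inv.posSemidef.transpose_eq
  have e1 : (R * (R⁻¹ * E * Φ * Δᵀ)).trace = (E * Φ * Δᵀ).trace := by
    rw [Matrix.mul_assoc, Matrix.mul_assoc, ← Matrix.mul_assoc R, Matrix.mul_nonsing_inv _ hdet,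
      Matrix.one_mul, Matrix.mul_assoc]
  have e2 : (R * (Δ * Φ * (R⁻¹ * E)ᵀ)).trace = (E * Φ * Δᵀ).trace := by
    rw [← Matrix.trace_transpose]
    simp only [Matrix.transpose_mul, Matrix.transpose_transpose, hRi, hΦ.transpose_eq,
      hR.posSemidef.transpose_eq]
    rw [Matrix.trace_mul_comm, ← e1]
    simp only [Matrix.mul_assoc]
  have e3 : (R * (R⁻¹ * E * Φ * (R⁻¹ * E)ᵀ)).trace = (R⁻¹ * (E * Φ * Eᵀ)).trace := by
    rw [Matrix.transpose_mul, hRi, Matrix.mul_assoc (R⁻¹ * E), Matrix.mul_assoc R⁻¹,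
      ← Matrix.mul_assoc R, Matrix.mul_nonsing_inv _ hdet, Matrix.one_mul, Matrix.trace_mul_comm,
      Matrix.trace_mul_comm R⁻¹]
    rw [Matrix.trace_mul_comm]
    simp only [Matrix.mul_assoc]
  simp only [Matrix.transpose_add, Matrix.mul_add, Matrix.add_mul, Matrix.trace_add] at h1
  rw [e1, e2, e3] at h1
  linarith

end Weighted

namespace Model

variable {n m : ℕ} {Ω : Type*} [MeasurableSpace Ω] {M : Model n m Ω} {μ ℓ s : ℝ}

/-- The cost difference is a quadratic in Y - X once Φ_Y is regarded as fixed. Its minimum over all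
displacements leaves Φ_Y as the only trace of Y. -/
theorem gradient_dominance (hM : M.Standing) (hμ : 0 ≤ μ) [NeZero n] {X Y : Policy n m}
    (h : PowStable (M.cl X)) (hY : PowStable (M.cl Y)) :
    M.statL μ X - M.statL μ Y ≤ ‖M.statΦ Y‖ *
      ((M.RK μ X.gain)⁻¹ * (M.natGrad μ X * (M.natGrad μ X)ᵀ)).trace := by
  have h1 := statL_sub hM hμ h hY
  have hR := RK_posDef hM hμ h
  have h2 := neg_le_quadratic hR (statΦ_posDef hM hY).posSemidef (M.natGrad μ X) (Y - X)
  have h3 := trace_conj_le hR.inv.posSemidef (M.natGrad μ X) (statΦ_transpose hM hY) (quad_le _)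
  linarith

theorem trace_inv_RK_le [NeZero n] (hM : M.Standing) (hμ : 0 ≤ μ) {X : Policy n m}
    (h : PowStable (M.cl X)) {F : Matrix (Fin m) (Fin m) ℝ} (hF : F.PosSemidef) :
    minEig M.R * ((M.RK μ X.gain)⁻¹ * F).trace ≤ F.trace := by
  have := nonempty_inputs hM
  have hσ := minEig_pos hM.R_pd
  have hR := RK_posDef hM hμ h
  have h1 := trace_mul_le hF hR.inv.posSemidef.transpose_eq (inv_quad_le hR hσ fun v => by
    have h2 := minEig_mul_le hM.R_pd.posSemidef.transpose_eq v
    have h3 := ((P_posSemidef hM hμ h).conj M.B).quad_nonneg v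
    rw [RK, Matrix.add_mulVec, dotProduct_add]
    linarith)
  rw [Matrix.trace_mul_comm]
  calc _ ≤ minEig M.R * ((minEig M.R)⁻¹ * F.trace) := by gcongr
    _ = F.trace := by field_simp

/-- The gain part involves P_K but not `valueVec`, so the gain moves as in the problem without
offset. This is why P_K can certify the new gain. -/
theorem gain_natGrad (M : Model n m Ω) (μ : ℝ) (X : Policy n m) : (M.natGrad μ X).gain
    = M.RK μ X.gain * X.gain - M.Bᵀ * M.P μ X.gain * M.A := by
  have h1 : M.augBᵀ * M.augP μ X * M.augA = Matrix.fromCols (M.Bᵀ * M.P μ X.gain * M.A)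
      (M.augBᵀ * M.augP μ X * M.augA).toCols₂ := by
    conv_lhs => rw [← Matrix.fromCols_toCols (M.augBᵀ * M.augP μ X * M.augA)]
    congr 1
    rw [augB, augP, augA, Matrix.transpose_fromRows, Matrix.fromCols_mul_fromBlocks,
      Matrix.fromCols_mul_fromBlocks, Matrix.toCols₁_fromCols]
    simp
  ext i j
  have h2 := congrFun (congrFun h1 i) (Sum.inl j)
  rw [Matrix.fromCols_apply_inl] at h2
  change (M.RK μ X.gain * X) i (Sum.inl j) - (M.augBᵀ * M.augP μ X * M.augA) i (Sum.inl j) = _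
  rw [h2]
  rfl

/-- A preconditioned natural gradient step keeps stability, decreases the value matrix and the
Lagrangian. -/
theorem preconditioned_step [NeZero n] (hM : M.Standing) (hμ : 0 ≤ μ) (hb : M.ParamBound μ ℓ s)
    {X : Policy n m} (h : PowStable (M.cl X)) {N : Matrix (Fin m) (Fin m) ℝ} {η : ℝ} (hη : 0 ≤ η)
    (hN : N.PosSemidef) (hNR : (N - (2 * η) • (N * M.RK μ X.gain * N)).PosSemidef)
    {X' : Policy n m} (hX' : X' = X - (2 * η) • (N * M.natGrad μ X)) :
    PowStable (M.cl X') ∧ (M.P μ X.gain - M.P μ X'.gain).PosSemidef ∧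
      M.statL μ X' - M.statL μ X
        ≤ -(2 * η) * (N * (M.natGrad μ X * M.statΦ X' * (M.natGrad μ X)ᵀ)).trace := by
  have hP := P_posSemidef hM hμ h
  set R := M.RK μ X.gain with hR
  have hRt : Rᵀ = R := (RK_posDef hM hμ h).posSemidef.transpose_eq
  set E := M.natGrad μ X with hE
  have hNR' : (N - η • (N * R * N)).PosSemidef := by
    -- The certificate needs only half of the stepsize condition, hence the average of that
    -- condition with N ≥ 0.
    have : N - η • (N * R * N) = (1 / 2 : ℝ) • (N - (2 * η) • (N * R * N)) + (1 / 2 : ℝ) • N := by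
      rw [smul_sub, smul_smul, sub_add_eq_add_sub, ← add_smul]
      congr 1
      · norm_num
      · congr 1; ring
    rw [this]
    exact (hNR.smul (by norm_num)).add (hN.smul (by norm_num))
  have hΔ : X' - X = -((2 * η) • (N * E)) := by rw [hX']; abel
  have hcert : (M.P μ X.gain - (M.cl X')ᵀ * M.P μ X.gain * M.cl X' - M.wt μ X').PosSemidef := by
    have hsq := completion_of_square hM.R_pd.posSemidef.transpose_eq hP.transpose_eq M.A M.B
      X.gain X'.gain
    have hgain : X'.gain - X.gain = -((2 * η) • (N * E.gain)) := congrArg Policy.gain hΔ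
    change _ = (X'.gain - X.gain)ᵀ * R * (X'.gain - X.gain)
      + (X'.gain - X.gain)ᵀ * (R * X.gain - M.Bᵀ * M.P μ X.gain * M.A)
      + (R * X.gain - M.Bᵀ * M.P μ X.gain * M.A)ᵀ * (X'.gain - X.gain) at hsq
    rw [hR, ← gain_natGrad, ← hR, ← hE, hgain] at hsq
    have hPe := P_eq hM hμ h
    have e1 : M.P μ X.gain - (M.cl X')ᵀ * M.P μ X.gain * M.cl X' - M.wt μ X'
        = -(X'.gainᵀ * M.R * X'.gain + (M.A - M.B * X'.gain)ᵀ * M.P μ X.gain *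
            (M.A - M.B * X'.gain) - (X.gainᵀ * M.R * X.gain
            + (M.A - M.B * X.gain)ᵀ * M.P μ X.gain * (M.A - M.B * X.gain))) := by
      nth_rewrite 1 [hPe]
      simp only [wt, cl]
      abel
    -- By the completed square, P_K decreases along the new closed loop by the new stage weight plus
    -- a nonnegative surplus. This is a Lyapunov inequality for X'.
    have e2 : M.P μ X.gain - (M.cl X')ᵀ * M.P μ X.gain * M.cl X' - M.wt μ X'
        = (4 * η) • (E.gainᵀ * (N - η • (N * R * N)) * E.gain) := by
      rw [e1, hsq]
      simp only [Matrix.transpose_neg, Matrix.transpose_smul, Matrix.transpose_mul,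
        hN.transpose_eq, Matrix.mul_sub, Matrix.sub_mul, Matrix.mul_neg, Matrix.neg_mul,
        Matrix.mul_smul, Matrix.smul_mul, Matrix.mul_assoc, smul_sub]
      module
    rw [e2]
    exact (hNR'.conj _).smul (by positivity)
  have hst := powStable_of_value_le hM hμ hb hP hcert
  refine ⟨hst, ?_, ?_⟩
  · rw [P_eq_lyap hM hμ hst]
    exact hst.sub_lyap_posSemidef (wt_posSemidef hM hμ X').transpose_eq hP.transpose_eq hcert
  · have h1 := statL_sub hM hμ h hst
    set Φ := M.statΦ X'
    have hΦ : (E * Φ * Eᵀ).PosSemidef := (statΦ_posDef hM hst).posSemidef.conj' E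
    rw [hΔ] at h1
    have e3 : (R * (-((2 * η) • (N * E)) * Φ * (-((2 * η) • (N * E)))ᵀ)).trace
        = 4 * η * (η * ((N * R * N) * (E * Φ * Eᵀ)).trace) := by
      simp only [Matrix.transpose_neg, Matrix.transpose_smul, Matrix.transpose_mul,
        hN.transpose_eq, Matrix.mul_neg, Matrix.neg_mul, smul_neg, neg_neg, Matrix.mul_smul,
        Matrix.smul_mul, Matrix.trace_smul, smul_eq_mul]
      have : (R * (N * E * Φ * (Eᵀ * N))).trace = (N * R * N * (E * Φ * Eᵀ)).trace := by
        rw [show N * R * N * (E * Φ * Eᵀ) = N * (R * (N * (E * Φ * Eᵀ))) by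
          simp only [Matrix.mul_assoc], Matrix.trace_mul_comm N]
        simp only [Matrix.mul_assoc]
      rw [this]; ring
    have e4 : (E * Φ * (-((2 * η) • (N * E)))ᵀ).trace = -(2 * η) * (N * (E * Φ * Eᵀ)).trace := by
      simp only [Matrix.transpose_neg, Matrix.transpose_smul, Matrix.transpose_mul,
        hN.transpose_eq, Matrix.mul_neg, Matrix.mul_smul, Matrix.trace_smul, smul_eq_mul,
        Matrix.trace_neg]
      rw [← Matrix.mul_assoc, Matrix.trace_mul_comm _ N]; ring
    rw [← hR, ← hE, e3, e4] at h1
    -- The condition 2η N R_K N ≤ N lets the second-order term use up half of the first-order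
    -- decrease 4η tr(N E Φ Eᵀ).
    have h2 := trace_mul_nonneg hNR hΦ
    rw [Matrix.sub_mul, Matrix.trace_sub, Matrix.smul_mul, Matrix.trace_smul, smul_eq_mul] at h2
    have h3 := mul_nonneg hη h2
    rw [h1]
    linarith

/-! ### Compactness, the minimizer and its uniqueness. -/

theorem mem_sublevel_iff [NeZero n] (hM : M.Standing) {X X₀ : Policy n m} :
    X ∈ M.sublevel μ X₀ ↔ PowStable (M.cl X) ∧ M.statL μ X ≤ M.lagrangian μ X₀ := by
  rw [sublevel, Set.mem_ofPred_eq, mem_stabilizing_iff]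
  exact and_congr_right fun h => by rw [lagrangian_eq hM μ h]

theorem isCompact_sublevel [NeZero n] (hM : M.Standing) (hμ : 0 ≤ μ) {X₀ : Policy n m}
    (hb : M.ParamBound μ (M.lagrangian μ X₀) s) : IsCompact (M.sublevel μ X₀) := by
  have hs := hb.sixteen_le
  have : ProperSpace (Policy n m) := FiniteDimensional.proper_real _
  refine Metric.isCompact_of_isClosed_isBounded ?_ ?_
  · refine isClosed_of_closure_subset fun X hX => ?_
    have hst : PowStable (M.cl X) := by
      set a := 4 * n + 21
      -- A limit of stabilizing policies might be unstable, but the Lyapunov matrices on the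
      -- sublevel set are at most sᵃ, which gives a uniform radius of stability. With ‖B‖ ≤ s, this
      -- distance makes the perturbation at most 3/s² ≤ 1/2.
      obtain ⟨Y, hY, hXY⟩ := Metric.mem_closure_iff.1 hX (s ^ (2 * a + 3))⁻¹ (by positivity)
      rw [mem_sublevel_iff hM] at hY
      have hYs := hY.2.trans hb.level_le
      refine (hY.1.perturb (D' := M.cl X) ?_).1
      have h1 : ‖M.cl X - M.cl Y‖ ≤ s * (s ^ (2 * a + 3))⁻¹ :=
        (norm_cl_sub_le M Y X).trans (mul_le_mul hb.B_le (by
          rw [← dist_eq_norm]; exact hXY.le) (norm_nonneg _) (by linarith))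
      have h2 : s * (s ^ (2 * a + 3))⁻¹ = (s ^ (2 * a + 2))⁻¹ := by
        rw [pow_succ s (2 * a + 2)]; field_simp
      rw [h2] at h1
      have h3 := norm_cl_le hM hμ hb hY.1 hYs
      have h4 := norm_lyap_one_le hM hμ hb hY.1 hYs
      have h5 : (s ^ (2 * a + 2))⁻¹ ≤ s ^ a :=
        (inv_le_one_of_one_le₀ (one_le_pow₀ (by linarith))).trans (one_le_pow₀ (by linarith))
      calc _ ≤ (s ^ (2 * a + 2))⁻¹ * (2 * s ^ a + s ^ a) * s ^ a := by
            gcongr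
            exact h1.trans h5
        _ = 3 / s ^ 2 := by
            field_simp
            ring
        _ ≤ 1 / 2 := by
            rw [div_le_div_iff₀ (by positivity) (by norm_num)]; nlinarith
    refine ⟨M.mem_stabilizing_iff.2 hst, ?_⟩
    have hne := mem_closure_iff_nhdsWithin_neBot.1 hX
    exact le_of_tendsto ((continuousAt_lagrangian hM hμ hst).tendsto.mono_left nhdsWithin_le_nhds)
      (eventually_nhdsWithin_of_forall fun Y (hY : Y ∈ M.sublevel μ X₀) => hY.2)
  · refine (Metric.isBounded_closedBall (x := (0 : Policy n m)) (r := s ^ (2 * n + 18))).subset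
      fun X hX => ?_
    rw [mem_sublevel_iff hM] at hX
    rw [mem_closedBall_zero_iff]
    exact norm_policy_le hM hμ hb hX.1 (hX.2.trans hb.level_le)

theorem continuousAt_minEig_Φ [NeZero n] (hM : M.Standing) {X : Policy n m}
    (h : PowStable (M.cl X)) : ContinuousAt (fun Y => minEig (M.Φ Y)) X := by
  obtain ⟨hev, hΦ⟩ := eventually_powStable_and_tendsto_statΦ hM h
  rw [ContinuousAt, tendsto_iff_dist_tendsto_zero]
  refine squeeze_zero' (Eventually.of_forall fun _ => dist_nonneg) ?_
    (tendsto_iff_norm_sub_tendsto_zero.1 hΦ)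
  filter_upwards [hev] with Y hY
  rw [Φ_eq hM h, Φ_eq hM hY, Real.dist_eq, abs_le]
  have h1 := minEig_sub_norm_le (statΦ_transpose hM h) (statΦ_transpose hM hY)
  have h2 := minEig_sub_norm_le (statΦ_transpose hM hY) (statΦ_transpose hM h)
  rw [norm_sub_rev] at h2
  constructor <;> linarith

theorem natGrad_eq_zero [NeZero n] (hM : M.Standing) (hμ : 0 ≤ μ) {X : Policy n m}
    (h : PowStable (M.cl X)) (hg : M.grad μ X = 0) : M.natGrad μ X = 0 := by
  rw [grad_eq hM hμ h, smul_eq_zero] at hg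
  have h1 := hg.resolve_left (by norm_num)
  have hdet := (Matrix.isUnit_iff_isUnit_det _).1 (statΦ_posDef hM h).isUnit
  calc M.natGrad μ X = M.natGrad μ X * M.statΦ X * (M.statΦ X)⁻¹ := by
        rw [Matrix.mul_assoc, Matrix.mul_nonsing_inv _ hdet, Matrix.mul_one]
    _ = 0 := by rw [h1, Matrix.zero_mul]

/-- At a critical point only the quadratic term of the cost difference survives. It is positive for
Y ≠ X because R_K and Φ_Y are positive definite. -/
theorem eq_of_grad_eq_zero [NeZero n] (hM : M.Standing) (hμ : 0 ≤ μ) {X Y : Policy n m}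
    (h : PowStable (M.cl X)) (hY : PowStable (M.cl Y)) (hg : M.grad μ X = 0)
    (hle : M.statL μ Y ≤ M.statL μ X) : Y = X := by
  have := nonempty_inputs hM
  have h1 := statL_sub hM hμ h hY
  rw [natGrad_eq_zero hM hμ h hg] at h1
  simp only [Matrix.zero_mul, Matrix.trace_zero, mul_zero, add_zero] at h1
  have hR := RK_posDef hM hμ h
  have hΦ := statΦ_posDef hM hY
  have h2 := mul_trace_le (hΦ.posSemidef.conj' (Y - X)) hR.posSemidef.transpose_eq
    (minEig_mul_le hR.posSemidef.transpose_eq)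
  rw [Matrix.trace_mul_comm _ (M.RK μ X.gain), ← h1] at h2
  have h3 : ((Y - X) * M.statΦ Y * (Y - X)ᵀ).trace ≤ 0 := by
    by_contra! h4
    have := mul_pos (minEig_pos hR) h4
    linarith
  rw [trace_mul_conj] at h3
  have h5 := (Finset.sum_eq_zero_iff_of_nonneg fun i _ => hΦ.posSemidef.quad_nonneg _).1
    (le_antisymm h3 (Finset.sum_nonneg fun i _ => hΦ.posSemidef.quad_nonneg _))
  refine sub_eq_zero.1 (Matrix.ext fun i j => ?_)
  by_contra hij
  have h6 : (Y - X) i ≠ 0 := fun h0 => hij (congrFun h0 j)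
  exact (hΦ.quad_pos h6).ne' (h5 i (Finset.mem_univ i))

theorem exists_minimizer [NeZero n] (hM : M.Standing) (hμ : 0 ≤ μ) {X₀ : Policy n m}
    (h₀ : X₀ ∈ M.stabilizing) (hb : M.ParamBound μ (M.lagrangian μ X₀) s) :
    ∃ Xs ∈ M.stabilizing, (∀ X ∈ M.stabilizing, M.grad μ X = 0 ↔ X = Xs) ∧
      ∀ X ∈ M.stabilizing, M.lagrangian μ Xs ≤ M.lagrangian μ X := by
  have hcont : ContinuousOn (M.lagrangian μ) (M.sublevel μ X₀) := fun X hX =>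
    (continuousAt_lagrangian hM hμ (M.mem_stabilizing_iff.1 hX.1)).continuousWithinAt
  obtain ⟨Xs, hXs, hmin⟩ := (isCompact_sublevel hM hμ hb).exists_isMinOn ⟨X₀, h₀, le_rfl⟩ hcont
  have hglob : ∀ X ∈ M.stabilizing, M.lagrangian μ Xs ≤ M.lagrangian μ X := fun X hX => by
    by_cases hl : M.lagrangian μ X ≤ M.lagrangian μ X₀
    · exact hmin ⟨hX, hl⟩
    · exact hXs.2.trans (not_le.1 hl).le
  have hs := M.mem_stabilizing_iff.1 hXs.1
  refine ⟨Xs, hXs.1, fun X hX => ⟨fun hg => ?_, ?_⟩, hglob⟩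
  · have hX' := M.mem_stabilizing_iff.1 hX
    have := hglob X hX
    rw [lagrangian_eq hM μ hs, lagrangian_eq hM μ hX'] at this
    exact (eq_of_grad_eq_zero hM hμ hX' hs hg this).symm
  · rintro rfl
    have hloc : IsLocalMin (M.lagrangian μ) X := by
      filter_upwards [(eventually_powStable_and_tendsto_statΦ hM hs).1] with Y hY
      exact hglob Y (M.mem_stabilizing_iff.2 hY)
    ext i j
    rw [grad, Matrix.of_apply, hloc.fderiv_eq_zero]
    rfl

/-! ### Strictness of the contraction factors. -/

theorem one_le_norm_statΦ (X : Policy n m) : 1 ≤ ‖M.statΦ X‖ := by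
  have h1 := (abs_apply_le_euclNorm (M.statΦ X (Sum.inr ())) (Sum.inr ())).trans
    (euclNorm_row_le _ _)
  rwa [statΦ_inr_inr, abs_one] at h1

theorem minEig_statΦ_le_one [NeZero n] (hM : M.Standing) {X : Policy n m}
    (h : PowStable (M.cl X)) : minEig (M.statΦ X) ≤ 1 := by
  have h1 := minEig_mul_le (statΦ_transpose hM h) (Pi.single (Sum.inr ()) 1)
  simpa [statΦ_inr_inr] using h1

/-- The test vector (0, 1) gives the value 1. Tilting it to (εx̄, 1) changes the form at first order
by -2ε|x̄|², so a small ε brings the Rayleigh quotient below 1. -/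
theorem minEig_statΦ_lt_one [NeZero n] (hM : M.Standing) {X : Policy n m}
    (h : PowStable (M.cl X)) (hx : M.xbar X ≠ 0) : minEig (M.statΦ X) < 1 := by
  set x := M.xbar X
  set a := x ⬝ᵥ M.cov X *ᵥ x with ha
  set b := x ⬝ᵥ x with hbd
  have ha0 : 0 ≤ a := (cov_posSemidef hM h).quad_nonneg x
  have hb0 : 0 < b := dotProduct_self_pos hx
  -- Small enough that ε(a + b²) < 2b, so the second-order terms do not undo the gain; the summand 1
  -- keeps the denominator positive.
  set ε := b / (a + b ^ 2 + 1)
  have hε : 0 < ε := by positivity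
  have hε' : ε * (a + b ^ 2 + 1) = b := by
    simp only [ε]; field_simp
  have h1 := minEig_mul_le (statΦ_transpose hM h) (Sum.elim (ε • x) fun _ => 1)
  rw [quad_statΦ, sum_dotProduct_sum] at h1
  simp only [Sum.elim_comp_inl, Sum.elim_inr, smul_dotProduct, dotProduct_smul, Matrix.mulVec_smul,
    smul_eq_mul, one_pow] at h1
  change _ * (ε * (ε * b) + 1) ≤ ε * (ε * a) + (ε * b - 1) ^ 2 at h1
  have h2 : ε * (ε * a) + (ε * b - 1) ^ 2 < ε * (ε * b) + 1 := by
    have h3 : ε * (a + b ^ 2) < 2 * b := by nlinarith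
    nlinarith [mul_pos hε hb0, mul_lt_mul_of_pos_left h3 hε, mul_pos hε (mul_pos hε hb0)]
  by_contra! hge
  have : 0 < ε * (ε * b) + 1 := by positivity
  nlinarith

/-- The optimal policy serves unless its stationary mean is zero. In that case a small change of the
offset along u with Bu ≠ 0 moves the mean away from zero, and the strict inequality of levels leaves
room for it. -/
theorem exists_mem_sublevel_minEig_lt [NeZero n] (hM : M.Standing) (hμ : 0 ≤ μ)
    {X₀ Xs : Policy n m} (hs : PowStable (M.cl Xs))
    (hlt : M.lagrangian μ Xs < M.lagrangian μ X₀) :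
    ∃ X ∈ M.sublevel μ X₀, minEig (M.Φ X) < 1 := by
  by_cases hx : M.xbar Xs = 0
  · obtain ⟨u, hu⟩ : ∃ u, M.B *ᵥ u ≠ 0 := by
      by_contra! hu
      refine B_ne_zero hM (Matrix.ext fun i j => ?_)
      have := congrFun (hu (Pi.single j 1)) i
      simpa using this
    let Z : Policy n m := Matrix.fromCols 0 (Matrix.replicateCol Unit u)
    have hXt : Tendsto (fun t : ℝ => Xs + t • Z) (𝓝 0) (𝓝 Xs) := by
      have : Continuous fun t : ℝ => Xs + t • Z := by fun_prop
      simpa using this.tendsto 0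
    have hev := hXt.eventually (((eventually_powStable_and_tendsto_statΦ hM hs).1).and
      ((continuousAt_lagrangian hM hμ hs).eventually (gt_mem_nhds hlt)))
    have hev' : ∀ᶠ t in 𝓝[≠] (0 : ℝ), t ≠ 0 ∧ PowStable (M.cl (Xs + t • Z)) ∧
        M.lagrangian μ (Xs + t • Z) < M.lagrangian μ X₀ :=
      (eventually_mem_nhdsWithin).and (hev.filter_mono nhdsWithin_le_nhds)
    obtain ⟨t, ht, hst, hL⟩ := hev'.exists
    refine ⟨Xs + t • Z, ⟨M.mem_stabilizing_iff.2 hst, hL.le⟩, ?_⟩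
    rw [Φ_eq hM hst]
    refine minEig_statΦ_lt_one hM hst fun h0 => hu ?_
    have hg : Xs + t • Z - Xs = t • Z := by abel
    have h1 := xbar_sub_eq hs hst
    rw [hg, h0, hx, sub_zero, Matrix.mulVec_zero, zero_add, eq_comm, neg_eq_zero,
      Matrix.smul_mulVec, Matrix.mulVec_smul, smul_eq_zero] at h1
    have h2 := h1.resolve_left ht
    have h3 : Z *ᵥ extend (0 : Fin n → ℝ) = -u := by
      simp only [Z, extend, Matrix.fromCols_mulVec]
      ext i
      simp [Matrix.mulVec, dotProduct, Matrix.replicateCol_apply]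
    rw [h3, Matrix.mulVec_neg, neg_eq_zero] at h2
    exact h2
  · exact ⟨Xs, ⟨M.mem_stabilizing_iff.2 hs, hlt.le⟩, by
      rw [Φ_eq hM hs]; exact minEig_statΦ_lt_one hM hs hx⟩

/-- If the form vanished at v, every stage weight along the closed-loop orbit of v would vanish,
against observability. -/
theorem P_quad_pos [NeZero n] (hM : M.Standing) (hμ : 0 ≤ μ) (hb : M.ParamBound μ ℓ s)
    {X : Policy n m} (h : PowStable (M.cl X)) {v : Fin n → ℝ} (hv : v ≠ 0) :
    0 < v ⬝ᵥ M.P μ X.gain *ᵥ v := by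
  have hP := P_posSemidef hM hμ h
  refine lt_of_le_of_ne (hP.quad_nonneg v) fun h0 => hv ?_
  have hwt := wt_posSemidef hM hμ X
  have hstep : ∀ w, w ⬝ᵥ M.P μ X.gain *ᵥ w = w ⬝ᵥ M.wt μ X *ᵥ w
      + (M.cl X *ᵥ w) ⬝ᵥ M.P μ X.gain *ᵥ (M.cl X *ᵥ w) := fun w => by
    conv_lhs => rw [P_eq hM hμ h, Matrix.add_mulVec, dotProduct_add, quad_conj]
  have hPj : ∀ j : ℕ, (M.cl X ^ j *ᵥ v) ⬝ᵥ M.P μ X.gain *ᵥ (M.cl X ^ j *ᵥ v) = 0 := by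
    intro j
    induction j with
    | zero => simpa using h0.symm
    | succ j ih =>
      have h1 := hstep (M.cl X ^ j *ᵥ v)
      have h2 := hwt.quad_nonneg (M.cl X ^ j *ᵥ v)
      have h3 := hP.quad_nonneg (M.cl X *ᵥ (M.cl X ^ j *ᵥ v))
      rw [pow_succ', ← Matrix.mulVec_mulVec]
      linarith
  have h4 := observability_ineq hM hμ hb X v
  rw [Finset.sum_eq_zero, mul_zero] at h4
  · exact dotProduct_self_eq_zero.1 (le_antisymm h4 (dotProduct_self_nonneg' v))
  · intro j _
    have h1 := hstep (M.cl X ^ j *ᵥ v)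
    have h2 := hwt.quad_nonneg (M.cl X ^ j *ᵥ v)
    have h3 := hP.quad_nonneg (M.cl X *ᵥ (M.cl X ^ j *ᵥ v))
    linarith [hPj j]

theorem minEig_R_lt_norm_RK [NeZero n] (hM : M.Standing) (hμ : 0 ≤ μ) (hb : M.ParamBound μ ℓ s)
    {X : Policy n m} (h : PowStable (M.cl X)) : minEig M.R < ‖M.RK μ X.gain‖ := by
  have := nonempty_inputs hM
  obtain ⟨u, hu⟩ : ∃ u, M.B *ᵥ u ≠ 0 := by
    by_contra! hu
    refine B_ne_zero hM (Matrix.ext fun i j => ?_)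
    have := congrFun (hu (Pi.single j 1)) i
    simpa using this
  have hu0 : u ≠ 0 := by rintro rfl; simp at hu
  have h1 := P_quad_pos hM hμ hb h hu
  have h2 := minEig_mul_le hM.R_pd.posSemidef.transpose_eq u
  have h3 := quad_le (M.RK μ X.gain) u
  rw [RK, Matrix.add_mulVec, dotProduct_add, quad_conj, ← RK] at h3
  exact lt_of_mul_lt_mul_right (by linarith : minEig M.R * (u ⬝ᵥ u)
    < ‖M.RK μ X.gain‖ * (u ⬝ᵥ u)) (dotProduct_self_nonneg' u)

end Model

/-! ### The natural gradient and policy gradient steps. -/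

section Rows

variable {ι κ : Type*} [Fintype ι] [Fintype κ] [DecidableEq ι] [DecidableEq κ]

theorem norm_sq_le_trace (E : Matrix κ ι ℝ) : ‖E‖ ^ 2 ≤ (E * Eᵀ).trace := by
  have h1 := Matrix.l2_opNorm_conjTranspose_mul_self Eᵀ
  rw [Matrix.conjTranspose_eq_transpose_of_trivial, Matrix.transpose_transpose,
    norm_transpose] at h1
  rw [pow_two, ← h1]
  exact norm_le_trace (mul_transpose_self_posSemidef E)

omit [DecidableEq ι] in
theorem euclNorm_le_of_quad {Φ : Matrix ι ι ℝ} {c : ℝ} (hc : 0 ≤ c) {z : ι → ℝ}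
    (h : z ⬝ᵥ z ≤ c * (z ⬝ᵥ Φ *ᵥ z)) : euclNorm z ≤ c * euclNorm (Φ *ᵥ z) := by
  have h1 := (le_abs_self _).trans (abs_dotProduct_le z (Φ *ᵥ z))
  rw [← euclNorm_sq] at h
  rcases (euclNorm_nonneg z).eq_or_lt with h0 | h0
  · rw [← h0]
    exact mul_nonneg hc (euclNorm_nonneg _)
  · refine le_of_mul_le_mul_left ?_ h0
    nlinarith [mul_le_mul_of_nonneg_left h1 hc]

omit [Fintype κ] [DecidableEq ι] [DecidableEq κ] in
theorem mul_row {Φ : Matrix ι ι ℝ} (hΦ : Φᵀ = Φ) (E : Matrix κ ι ℝ) (i : κ) :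
    (E * Φ) i = Φ *ᵥ E i := by
  conv_rhs => rw [← hΦ, Matrix.mulVec_transpose]
  rfl

omit [DecidableEq κ] in
theorem sq_mul_trace_le {Φ : Matrix ι ι ℝ} (hΦ : Φᵀ = Φ) {σ : ℝ} (hσ : 0 < σ)
    (h : ∀ z, σ * (z ⬝ᵥ z) ≤ z ⬝ᵥ Φ *ᵥ z) (E : Matrix κ ι ℝ) :
    σ ^ 2 * (E * Eᵀ).trace ≤ (E * Φ * (E * Φ)ᵀ).trace := by
  rw [trace_mul_transpose, trace_mul_transpose, Finset.mul_sum]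
  refine Finset.sum_le_sum fun i _ => ?_
  rw [mul_row hΦ, ← euclNorm_sq, ← euclNorm_sq, ← mul_pow]
  have h1 := euclNorm_le_of_quad (inv_nonneg.2 hσ.le) (z := E i) (Φ := Φ) (by
    rw [inv_mul_eq_div, le_div_iff₀ hσ, mul_comm]; exact h _)
  rw [inv_mul_eq_div, le_div_iff₀ hσ, mul_comm] at h1
  exact pow_le_pow_left₀ (mul_nonneg hσ.le (euclNorm_nonneg _)) h1 2

omit [DecidableEq κ] in
-- The error has to be small relative to EΦ. Each row satisfies |E_i| ≤ c |ΦE_i|, so the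
-- perturbation costs at most a quarter of the main term.
theorem le_trace_perturb {Φ Φ' : Matrix ι ι ℝ} (hΦ : Φᵀ = Φ) {c : ℝ} (hc : 0 ≤ c)
    (h : ∀ z, z ⬝ᵥ z ≤ c * (z ⬝ᵥ Φ *ᵥ z)) (hd : ‖Φ' - Φ‖ * c ≤ 1 / 4) (E : Matrix κ ι ℝ) :
    3 / 4 * (E * Φ * (E * Φ)ᵀ).trace ≤ (E * Φ' * (E * Φ)ᵀ).trace := by
  have h1 : (E * Φ' * (E * Φ)ᵀ).trace
      = (E * Φ * (E * Φ)ᵀ).trace + (E * (Φ' - Φ) * (E * Φ)ᵀ).trace := by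
    rw [← Matrix.trace_add, ← Matrix.add_mul, ← Matrix.mul_add, add_sub_cancel]
  have h2 : -(1 / 4) * (E * Φ * (E * Φ)ᵀ).trace ≤ (E * (Φ' - Φ) * (E * Φ)ᵀ).trace := by
    rw [trace_mul_conj E (E * Φ) (Φ' - Φ), trace_mul_transpose, Finset.mul_sum]
    refine Finset.sum_le_sum fun i _ => ?_
    have h3 := (abs_le.1 (abs_bilin_le (Φ' - Φ) (E i) ((E * Φ) i))).1
    have h4 := euclNorm_le_of_quad hc (h (E i))
    rw [← mul_row hΦ] at h4
    have h5 := euclNorm_nonneg ((E * Φ) i)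
    have h6 : ‖Φ' - Φ‖ * (euclNorm (E i) * euclNorm ((E * Φ) i))
        ≤ 1 / 4 * euclNorm ((E * Φ) i) ^ 2 := by
      calc _ ≤ ‖Φ' - Φ‖ * (c * euclNorm ((E * Φ) i) * euclNorm ((E * Φ) i)) := by gcongr
        _ = ‖Φ' - Φ‖ * c * euclNorm ((E * Φ) i) ^ 2 := by ring
        _ ≤ _ := by gcongr
    rw [← euclNorm_sq]
    linarith
  linarith

end Rows

namespace Model

variable {n m : ℕ} {Ω : Type*} [MeasurableSpace Ω] {M : Model n m Ω} {μ ℓ s : ℝ}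

theorem posSemidef_one_sub_RK [NeZero n] (hM : M.Standing) (hμ : 0 ≤ μ) {X : Policy n m}
    (h : PowStable (M.cl X)) {η : ℝ} (hη : 0 ≤ η) (hle : 2 * η * ‖M.RK μ X.gain‖ ≤ 1) :
    ((1 : Matrix (Fin m) (Fin m) ℝ) - (2 * η) • (1 * M.RK μ X.gain * 1)).PosSemidef := by
  rw [Matrix.one_mul, Matrix.mul_one]
  refine posSemidef_of_quad ?_ fun v => ?_
  · rw [Matrix.transpose_sub, Matrix.transpose_smul, Matrix.transpose_one,
      (RK_posDef hM hμ h).posSemidef.transpose_eq]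
  · have h1 := mul_le_mul_of_nonneg_left (quad_le (M.RK μ X.gain) v)
      (by positivity : 0 ≤ 2 * η)
    have h2 := mul_le_mul_of_nonneg_right hle (dotProduct_self_nonneg' v)
    rw [Matrix.sub_mulVec, dotProduct_sub, Matrix.one_mulVec, Matrix.smul_mulVec, dotProduct_smul,
      smul_eq_mul]
    linarith

theorem natural_step [NeZero n] (hM : M.Standing) (hμ : 0 ≤ μ) (hb : M.ParamBound μ ℓ s)
    {X : Policy n m} (h : PowStable (M.cl X)) {η : ℝ} (hη : 0 ≤ η)
    (hle : 2 * η * ‖M.RK μ X.gain‖ ≤ 1) {X' : Policy n m}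
    (hX' : X' = X - (2 * η) • M.natGrad μ X) :
    PowStable (M.cl X') ∧ (M.P μ X.gain - M.P μ X'.gain).PosSemidef ∧
      M.statL μ X' - M.statL μ X
        ≤ -(2 * η) * (M.natGrad μ X * M.statΦ X' * (M.natGrad μ X)ᵀ).trace := by
  have := preconditioned_step hM hμ hb h hη Matrix.PosSemidef.one
    (posSemidef_one_sub_RK hM hμ h hη hle) (X' := X') (by rw [hX', Matrix.one_mul])
  rwa [Matrix.one_mul] at this

theorem norm_RK_pos [NeZero n] (hM : M.Standing) (hμ : 0 ≤ μ) {X : Policy n m}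
    (h : PowStable (M.cl X)) : 0 < ‖M.RK μ X.gain‖ := by
  have := nonempty_inputs hM
  have hR := RK_posDef hM hμ h
  exact (minEig_pos hR).trans_le (minEig_le_norm hR.posSemidef.transpose_eq)

/-- As the value matrix decreases along natural gradient steps, so does the norm of R_K, and the
initial stepsize condition persists. -/
theorem norm_RK_le_of_P_le [NeZero n] (hM : M.Standing) (hμ : 0 ≤ μ) {X Y : Policy n m}
    (hY : PowStable (M.cl Y))
    (hP : (M.P μ X.gain - M.P μ Y.gain).PosSemidef) : ‖M.RK μ Y.gain‖ ≤ ‖M.RK μ X.gain‖ := by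
  have hRY := RK_posDef hM hμ hY
  refine norm_le_of_quad hRY.posSemidef.transpose_eq (norm_nonneg _) fun v => ?_
  rw [abs_of_nonneg (hRY.posSemidef.quad_nonneg v)]
  refine le_trans ?_ (quad_le _ v)
  have h1 := (hP.conj M.B).quad_nonneg v
  simp only [Matrix.mul_sub, Matrix.sub_mul, Matrix.sub_mulVec, dotProduct_sub] at h1
  simp only [RK, Matrix.add_mulVec, dotProduct_add]
  linarith

/-- An auxiliary natural gradient step lowers the Lagrangian in proportion to the size of the
gradient, but the Lagrangian is at least -s⁷ on stabilizing policies. So the gradient cannot be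
large. -/
theorem trace_natGrad_le [NeZero n] (hM : M.Standing) (hμ : 0 ≤ μ) (hb : M.ParamBound μ ℓ s)
    {X : Policy n m} (h : PowStable (M.cl X)) (hX : M.statL μ X ≤ s) :
    (M.natGrad μ X * (M.natGrad μ X)ᵀ).trace ≤ s ^ (4 * n + 45) := by
  have hs := hb.sixteen_le
  have hR := norm_RK_pos hM hμ h
  set r := ‖M.RK μ X.gain‖ with hr
  -- The largest stepsize allowed by 2η‖R_K‖ ≤ 1.
  have hη : 0 ≤ 1 / (2 * r) := by positivity
  obtain ⟨hst, -, hdec⟩ := natural_step hM hμ hb h hη (by rw [← hr]; field_simp; rfl) rfl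
  set X' := X - (2 * (1 / (2 * r))) • M.natGrad μ X
  set t := (M.natGrad μ X * M.statΦ X' * (M.natGrad μ X)ᵀ).trace
  have hΦ' := (statΦ_posDef hM hst).posSemidef
  have ht0 : 0 ≤ t := (hΦ'.conj' (M.natGrad μ X)).trace_nonneg
  have hX' : M.statL μ X' ≤ s := by
    have : 0 ≤ 2 * (1 / (2 * r)) * t := by positivity
    linarith
  have hlow := (level_bounds hM hμ hb hst).2
  have ht : t ≤ s ^ 19 := by
    have h1 : t = r * (2 * (1 / (2 * r)) * t) := by field_simp
    rw [h1]
    refine mul_le_pow hs (norm_RK_le hM hμ hb h hX) (b := 8) ?_ (by positivity) le_rfl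
    have h2 : s + s ^ 7 ≤ s ^ 8 := add_le_pow hs (pow_one s).ge le_rfl (by norm_num) (by norm_num)
    linarith
  have h3 : (M.natGrad μ X * (M.natGrad μ X)ᵀ).trace ≤ s ^ (4 * n + 26) * t := by
    rw [trace_mul_transpose]
    simp only [t]
    rw [trace_mul_conj, Finset.mul_sum]
    exact Finset.sum_le_sum fun i _ => dotProduct_self_le_pow_mul_statΦ hM hμ hb hst hX' _
  exact h3.trans (mul_le_pow hs le_rfl ht ht0 (by omega))

theorem norm_natGrad_mul_statΦ_le [NeZero n] (hM : M.Standing) (hμ : 0 ≤ μ)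
    (hb : M.ParamBound μ ℓ s) {X : Policy n m} (h : PowStable (M.cl X)) (hX : M.statL μ X ≤ s) :
    ‖M.natGrad μ X * M.statΦ X‖ ≤ s ^ (6 * n + 48) := by
  have hs := hb.sixteen_le
  have h1 : ‖M.natGrad μ X‖ ≤ s ^ (2 * n + 23) :=
    le_pow_of_sq_le hs ((norm_sq_le_trace _).trans (trace_natGrad_le hM hμ hb h hX)) (by omega)
  exact (Matrix.l2_opNorm_mul _ _).trans
    (mul_le_pow hs h1 (norm_statΦ_le hM hμ hb h hX) (norm_nonneg _) (by omega))

/-- Each of the two terms in the perturbation bound is at most s^(12n+66) τ, and the factor 4n + 26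
comes from the lower bound on Φ. The exponent 16n + 94 exceeds their sum, which makes the relative
change of Φ small. -/
theorem statΦ_near [NeZero n] (hM : M.Standing) (hμ : 0 ≤ μ) (hb : M.ParamBound μ ℓ s)
    {X Y : Policy n m} (h : PowStable (M.cl X)) (hX : M.statL μ X ≤ s)
    (hXY : ‖Y - X‖ ≤ (s ^ (16 * n + 94))⁻¹) :
    PowStable (M.cl Y) ∧ ‖M.statΦ Y - M.statΦ X‖ * s ^ (4 * n + 26) ≤ 1 / 4 := by
  have hs := hb.sixteen_le
  have hs0 : 0 < s := by linarith
  have hs1 : 1 ≤ s := by linarith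
  set τ := (s ^ (16 * n + 94))⁻¹ with hτ
  have hτ0 : 0 < τ := by positivity
  have hτs : ∀ k, k < 16 * n + 94 → s ^ k * τ ≤ 1 / s := fun k hk => by
    have : s ^ (k + 1) ≤ s ^ (16 * n + 94) := pow_le_pow_right₀ hs1 hk
    rw [hτ, le_div_iff₀ hs0, mul_right_comm, ← pow_succ, mul_inv_le_iff₀ (by positivity), one_mul]
    exact this
  set a := 4 * n + 21 with ha
  have hS := norm_lyap_one_le hM hμ hb h hX
  have hd := norm_cl_le hM hμ hb h hX
  have he := euclNorm_extend_xbar_le hM hμ hb h hX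
  have hcov : ‖M.cov X‖ ≤ s ^ (4 * n + 20) :=
    (norm_le_trace (cov_posSemidef hM h)).trans (trace_cov_le hM hμ hb h hX)
  set e := euclNorm (extend (M.xbar X))
  have he0 : 0 ≤ e := euclNorm_nonneg _
  have hn := hb.n_le
  have hsi : 1 / s ≤ 1 := by rw [div_le_one hs0]; exact hs1
  have ht : ‖M.B‖ * τ ≤ s * τ := by gcongr; exact hb.B_le
  have ht1 : ‖M.B‖ * τ ≤ s ^ a := by
    have := hτs 1 (by omega)
    rw [pow_one] at this
    exact ht.trans (this.trans (hsi.trans (one_le_pow₀ hs1)))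
  have h3s : 3 ≤ s := by linarith
  have h1 : ‖M.B‖ * τ * (2 * s ^ a + ‖M.B‖ * τ) ≤ s ^ (a + 2) * τ := by
    calc _ ≤ s * τ * (2 * s ^ a + s ^ a) := by gcongr
      _ = 3 * (s * s ^ a * τ) := by ring
      _ ≤ s * (s * s ^ a * τ) := by gcongr
      _ = s ^ (a + 2) * τ := by ring
  have hsmall : ‖M.B‖ * τ * (2 * s ^ a + ‖M.B‖ * τ) * s ^ a ≤ 1 / 2 := by
    calc _ ≤ s ^ (a + 2) * τ * s ^ a := by gcongr
      _ = s ^ (2 * a + 2) * τ := by ring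
      _ ≤ 1 / s := hτs _ (by omega)
      _ ≤ 1 / 2 := by gcongr; linarith
  obtain ⟨hst, hpert⟩ := statΦ_perturb hM h hXY hS hd hsmall
  refine ⟨hst, ?_⟩
  have h2 : 2 * n * s ^ a * (‖M.B‖ * τ * (2 * s ^ a + ‖M.B‖ * τ)) * ‖M.cov X‖
      ≤ s ^ (12 * n + 66) * τ := by
    calc _ ≤ s * s * s ^ a * (s ^ (a + 2) * τ) * s ^ (4 * n + 20) := by
          gcongr
          linarith
      _ = s ^ (12 * n + 66) * τ := by rw [ha]; ring
  have h3 : 4 * s ^ a * ‖M.B‖ * τ ≤ s ^ (a + 2) * τ := by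
    calc _ ≤ s * s ^ a * s * τ := by
          gcongr
          · linarith
          · exact hb.B_le
      _ = _ := by ring
  have h4 : 4 * s ^ a * ‖M.B‖ * τ ≤ 1 := h3.trans ((hτs _ (by omega)).trans hsi)
  have h5 : 4 * s ^ a * ‖M.B‖ * τ * e * (2 * e + 4 * s ^ a * ‖M.B‖ * τ * e)
      ≤ s ^ (12 * n + 66) * τ := by
    calc _ ≤ s ^ (a + 2) * τ * e * (2 * e + 1 * e) := by gcongr
      _ = 3 * (s ^ (a + 2) * τ * e * e) := by ring
      _ ≤ s * (s ^ (a + 2) * τ * s ^ (2 * n + 12) * s ^ (2 * n + 12)) := by gcongr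
      _ = s ^ (8 * n + 48) * τ := by rw [ha]; ring
      _ ≤ s ^ (12 * n + 66) * τ := by
        gcongr 1
        exact pow_le_pow_right₀ hs1 (by omega)
  calc _ ≤ (s ^ (12 * n + 66) * τ + s ^ (12 * n + 66) * τ) * s ^ (4 * n + 26) := by
        gcongr
        exact hpert.trans (add_le_add h2 h5)
    _ = 2 * (s ^ (16 * n + 92) * τ) := by ring
    _ ≤ 2 * (1 / s) := by gcongr; exact hτs _ (by omega)
    _ ≤ 2 * (1 / 16) := by gcongr
    _ ≤ 1 / 4 := by norm_num

theorem pow_mul_stepsize_le {η : ℝ} {k N : ℕ} (hs : 1 ≤ s) (hη : 0 ≤ η) (hle : η ≤ 1 / s ^ N)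
    (hk : k < N) : s ^ k * η ≤ 1 / s := by
  have hs0 : 0 < s := by linarith
  rw [le_div_iff₀ hs0]
  calc s ^ k * η * s = s ^ (k + 1) * η := by ring
    _ ≤ s ^ N * (1 / s ^ N) :=
      mul_le_mul (pow_le_pow_right₀ hs hk) hle hη (by positivity)
    _ = 1 := by field_simp

theorem norm_gradient_step_le [NeZero n] (hM : M.Standing) (hμ : 0 ≤ μ) (hb : M.ParamBound μ ℓ s)
    {X : Policy n m} (h : PowStable (M.cl X)) (hX : M.statL μ X ≤ s) {η : ℝ} (hη : 0 ≤ η)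
    (hle : η ≤ 1 / s ^ (22 * n + 150)) :
    ‖(2 * η) • (M.natGrad μ X * M.statΦ X)‖ ≤ (s ^ (16 * n + 94))⁻¹ := by
  have hs := hb.sixteen_le
  have hs0 : 0 < s := by linarith
  rw [norm_smul, Real.norm_of_nonneg (by positivity), ← one_div, le_div_iff₀ (by positivity)]
  have h1 := norm_natGrad_mul_statΦ_le hM hμ hb h hX
  have h2 : 2 * η ≤ s * η := mul_le_mul_of_nonneg_right (by linarith) hη
  calc 2 * η * ‖M.natGrad μ X * M.statΦ X‖ * s ^ (16 * n + 94)
      ≤ s * η * s ^ (6 * n + 48) * s ^ (16 * n + 94) := by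
        refine mul_le_mul_of_nonneg_right ?_ (by positivity)
        exact mul_le_mul h2 h1 (norm_nonneg _) (by positivity)
    _ = s ^ (22 * n + 143) * η := by ring
    _ ≤ 1 / s := pow_mul_stepsize_le (by linarith) hη hle (by omega)
    _ ≤ 1 := by rw [div_le_one hs0]; linarith

/-- With G = EΦ, the first-order term is at most -3η tr(GGᵀ), because Φ changes little. The
second-order term is at most η tr(GGᵀ), by the stepsize bound. The remaining -2η tr(GGᵀ) is compared
with tr(EEᵀ) through σ. -/
theorem gradient_step [NeZero n] (hM : M.Standing) (hμ : 0 ≤ μ) (hb : M.ParamBound μ ℓ s)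
    {X : Policy n m} (h : PowStable (M.cl X)) (hX : M.statL μ X ≤ s) {η : ℝ} (hη : 0 ≤ η)
    (hle : η ≤ 1 / s ^ (22 * n + 150)) {X' : Policy n m}
    (hX' : X' = X - (2 * η) • (M.natGrad μ X * M.statΦ X)) {σ : ℝ} (hσ : 0 < σ)
    (hσΦ : ∀ z, σ * (z ⬝ᵥ z) ≤ z ⬝ᵥ M.statΦ X *ᵥ z) :
    PowStable (M.cl X') ∧ M.statL μ X' - M.statL μ X
      ≤ -(2 * η * σ ^ 2) * (M.natGrad μ X * (M.natGrad μ X)ᵀ).trace := by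
  have hs := hb.sixteen_le
  have hs1 : 1 ≤ s := by linarith
  have hR := RK_posDef hM hμ h
  have hΦ := statΦ_transpose hM h
  set G := M.natGrad μ X * M.statΦ X with hG
  have hΔ : X' - X = -((2 * η) • G) := by rw [hX']; abel
  have hnear : ‖X' - X‖ ≤ (s ^ (16 * n + 94))⁻¹ := by
    rw [hΔ, norm_neg]
    exact norm_gradient_step_le hM hμ hb h hX hη hle
  obtain ⟨hst, hpert⟩ := statΦ_near hM hμ hb h hX hnear
  refine ⟨hst, ?_⟩
  have hpow : (0 : ℝ) ≤ s ^ (4 * n + 26) := by positivity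
  have hg0 : 0 ≤ (G * Gᵀ).trace := (mul_transpose_self_posSemidef G).trace_nonneg
  have h1 := le_trace_perturb hΦ hpow (dotProduct_self_le_pow_mul_statΦ hM hμ hb h hX) hpert
    (M.natGrad μ X)
  have hΦ'n : ‖M.statΦ X'‖ ≤ s ^ (4 * n + 26) := by
    have h2 : ‖M.statΦ X' - M.statΦ X‖ ≤ 1 := by
      have h3 : (1 : ℝ) ≤ s ^ (4 * n + 26) := one_le_pow₀ hs1
      nlinarith [norm_nonneg (M.statΦ X' - M.statΦ X)]
    have h4 := norm_add_le (M.statΦ X' - M.statΦ X) (M.statΦ X)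
    rw [sub_add_cancel] at h4
    exact h4.trans (add_le_pow hs (a := 0) (by simpa using h2) (norm_statΦ_le hM hμ hb h hX)
      (by omega) (by omega))
  have h5 : (M.RK μ X.gain * (G * M.statΦ X' * Gᵀ)).trace
      ≤ s ^ (4 * n + 37) * (G * Gᵀ).trace := by
    have h6 := trace_conj_le hR.posSemidef G (statΦ_transpose hM hst) (quad_le _)
    have h7 := trace_mul_le (mul_transpose_self_posSemidef G) hR.posSemidef.transpose_eq
      (quad_le (M.RK μ X.gain))
    rw [Matrix.trace_mul_comm] at h7
    have h8 := mul_le_mul_of_nonneg_right (norm_RK_le hM hμ hb h hX) hg0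
    calc _ ≤ ‖M.statΦ X'‖ * (s ^ 11 * (G * Gᵀ).trace) :=
          h6.trans (mul_le_mul_of_nonneg_left (h7.trans h8) (norm_nonneg _))
      _ ≤ s ^ (4 * n + 26) * (s ^ 11 * (G * Gᵀ).trace) :=
        mul_le_mul_of_nonneg_right hΦ'n (mul_nonneg (pow_nonneg (by linarith) _) hg0)
      _ = s ^ (4 * n + 37) * (G * Gᵀ).trace := by
        rw [← mul_assoc, ← pow_add]
  have h8 := statL_sub hM hμ h hst
  rw [hΔ] at h8
  simp only [Matrix.transpose_neg, Matrix.transpose_smul, Matrix.mul_neg, Matrix.neg_mul,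
    Matrix.mul_smul, Matrix.smul_mul, smul_neg, neg_neg, Matrix.trace_smul, Matrix.trace_neg,
    smul_eq_mul] at h8
  have h9 : 4 * (s ^ (4 * n + 37) * η) ≤ 1 := by
    have h2 := pow_mul_stepsize_le (k := 4 * n + 37) hs1 hη hle (by omega)
    have h3 : 1 / s ≤ 1 / 16 := one_div_le_one_div_of_le (by norm_num) hs
    linarith
  have h10 := mul_le_mul_of_nonneg_left (sq_mul_trace_le hΦ hσ hσΦ (M.natGrad μ X)) hη
  have h11 := mul_le_mul_of_nonneg_left h5 (by positivity : 0 ≤ 4 * η ^ 2)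
  have h12 := mul_le_mul_of_nonneg_left h1 hη
  have h13 := mul_le_mul_of_nonneg_right h9 (mul_nonneg hη hg0)
  rw [h8]
  rw [← hG] at h10 h12
  linarith

theorem exists_isLeast_minEig [NeZero n] (hM : M.Standing) (hμ : 0 ≤ μ) {X₀ : Policy n m}
    (h₀ : X₀ ∈ M.stabilizing) (hb : M.ParamBound μ (M.lagrangian μ X₀) s) :
    ∃ σ, IsLeast ((fun X => minEig (M.Φ X)) '' M.sublevel μ X₀) σ ∧ 0 < σ := by
  have hcont : ContinuousOn (fun X => minEig (M.Φ X)) (M.sublevel μ X₀) := fun X hX =>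
    (continuousAt_minEig_Φ hM (M.mem_stabilizing_iff.1 hX.1)).continuousWithinAt
  obtain ⟨X, hX, hmin⟩ := (isCompact_sublevel hM hμ hb).exists_isMinOn ⟨X₀, h₀, le_rfl⟩ hcont
  have hst := M.mem_stabilizing_iff.1 hX.1
  refine ⟨_, ⟨⟨X, hX, rfl⟩, ?_⟩, ?_⟩
  · rintro _ ⟨Y, hY, rfl⟩
    exact hmin hY
  · change 0 < minEig (M.Φ X)
    rw [Φ_eq hM hst]
    exact minEig_pos (statΦ_posDef hM hst)

/-- Gradient dominance against Y converts a decrease measured by tr(R_K⁻¹EEᵀ) into a fraction of the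
gap to Y. -/
theorem contraction_of_decrease [NeZero n] (hM : M.Standing) (hμ : 0 ≤ μ) {X X' Y : Policy n m}
    (h : PowStable (M.cl X)) (h' : PowStable (M.cl X')) (hY : PowStable (M.cl Y)) {c : ℝ}
    (hc : 0 ≤ c) (hdec : M.statL μ X' - M.statL μ X
      ≤ -c * ((M.RK μ X.gain)⁻¹ * (M.natGrad μ X * (M.natGrad μ X)ᵀ)).trace) :
    M.lagrangian μ X' - M.lagrangian μ Y
      ≤ (1 - c / ‖M.Φ Y‖) * (M.lagrangian μ X - M.lagrangian μ Y) := by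
  rw [lagrangian_eq hM μ h, lagrangian_eq hM μ h', lagrangian_eq hM μ hY, Φ_eq hM hY]
  have h1 := gradient_dominance hM hμ h hY
  have h2 : 0 < ‖M.statΦ Y‖ := one_pos.trans_le (one_le_norm_statΦ Y)
  have h3 : c / ‖M.statΦ Y‖ * (M.statL μ X - M.statL μ Y)
      ≤ c * ((M.RK μ X.gain)⁻¹ * (M.natGrad μ X * (M.natGrad μ X)ᵀ)).trace := by
    calc _ ≤ c / ‖M.statΦ Y‖ * (‖M.statΦ Y‖ *
          ((M.RK μ X.gain)⁻¹ * (M.natGrad μ X * (M.natGrad μ X)ᵀ)).trace) := by gcongr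
      _ = _ := by field_simp
  linarith

theorem mem_sublevel_of_decrease [NeZero n] (hM : M.Standing) (hμ : 0 ≤ μ) {X X' X₀ : Policy n m}
    (hX : X ∈ M.sublevel μ X₀) (h' : PowStable (M.cl X')) {c : ℝ}
    (hc : 0 ≤ c) (hdec : M.statL μ X' - M.statL μ X
      ≤ -c * ((M.RK μ X.gain)⁻¹ * (M.natGrad μ X * (M.natGrad μ X)ᵀ)).trace) :
    X' ∈ M.sublevel μ X₀ := by
  rw [mem_sublevel_iff hM] at hX ⊢
  have h1 := mul_nonneg hc (trace_mul_nonneg (RK_posDef hM hμ hX.1).inv.posSemidef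
    (mul_transpose_self_posSemidef (M.natGrad μ X)))
  exact ⟨h', by linarith [hX.2]⟩

theorem grad_mul_inv_Φ [NeZero n] (hM : M.Standing) (hμ : 0 ≤ μ) {X : Policy n m}
    (h : PowStable (M.cl X)) : M.grad μ X * (M.Φ X)⁻¹ = (2 : ℝ) • M.natGrad μ X := by
  have hdet := (Matrix.isUnit_iff_isUnit_det _).1 (statΦ_posDef hM h).isUnit
  rw [grad_eq hM hμ h, Φ_eq hM h, Matrix.smul_mul, Matrix.mul_assoc, Matrix.mul_nonsing_inv _ hdet,
    Matrix.mul_one]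

theorem gnStep_decrease [NeZero n] (hM : M.Standing) (hμ : 0 ≤ μ) (hb : M.ParamBound μ ℓ s)
    {X : Policy n m} (h : PowStable (M.cl X)) {η : ℝ} (hη : 0 ≤ η) (hle : η ≤ 1 / 2) :
    PowStable (M.cl (M.gnStep μ η X)) ∧
      M.statL μ (M.gnStep μ η X) - M.statL μ X ≤ -(2 * η) * ((M.RK μ X.gain)⁻¹ *
        (M.natGrad μ X * M.statΦ (M.gnStep μ η X) * (M.natGrad μ X)ᵀ)).trace := by
  have hR := RK_posDef hM hμ h
  have hdet := (Matrix.isUnit_iff_isUnit_det _).1 hR.isUnit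
  have hstep : M.gnStep μ η X = X - (2 * η) • ((M.RK μ X.gain)⁻¹ * M.natGrad μ X) := by
    rw [gnStep, Matrix.mul_assoc, grad_mul_inv_Φ hM hμ h, Matrix.mul_smul, smul_smul, mul_comm η]
  have hN : ((M.RK μ X.gain)⁻¹ - (2 * η) • ((M.RK μ X.gain)⁻¹ * M.RK μ X.gain *
      (M.RK μ X.gain)⁻¹)).PosSemidef := by
    rw [Matrix.nonsing_inv_mul _ hdet, Matrix.one_mul]
    have : (M.RK μ X.gain)⁻¹ - (2 * η) • (M.RK μ X.gain)⁻¹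
        = (1 - 2 * η) • (M.RK μ X.gain)⁻¹ := by rw [sub_smul, one_smul]
    rw [this]
    exact hR.inv.posSemidef.smul (by linarith)
  obtain ⟨h1, -, h2⟩ := preconditioned_step hM hμ hb h hη hR.inv.posSemidef hN hstep
  exact ⟨h1, h2⟩

theorem npgStep_eq [NeZero n] (hM : M.Standing) (hμ : 0 ≤ μ) {X : Policy n m}
    (h : PowStable (M.cl X)) (η : ℝ) : M.npgStep μ η X = X - (2 * η) • M.natGrad μ X := by
  rw [npgStep, grad_mul_inv_Φ hM hμ h, smul_smul, mul_comm η]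

theorem pgStep_eq [NeZero n] (hM : M.Standing) (hμ : 0 ≤ μ) {X : Policy n m}
    (h : PowStable (M.cl X)) (η : ℝ) :
    M.pgStep μ η X = X - (2 * η) • (M.natGrad μ X * M.statΦ X) := by
  rw [pgStep, grad_eq hM hμ h, smul_smul, mul_comm η]

/-! ### The scale as a polynomial in the parameters. -/

/-- The number that dominates all the problem parameters. -/
def scale (M : Model n m Ω) (μ : ℝ) (X₀ : Policy n m) : ℝ :=
  16 * (n + 1) * (1 + ∑ i, M.parameters μ X₀ i)

theorem parameters_nonneg [NeZero n] (hM : M.Standing) (hμ : 0 ≤ μ) (X₀ : Policy n m) (i : Fin 13) :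
    0 ≤ M.parameters μ X₀ i := by
  have := nonempty_inputs hM
  have h1 := minEig_pos hM.R_pd
  have h2 := minEig_pos hM.W_pd
  have h3 := minEig_pos (gramian_posDef hM hμ)
  have h4 := euclNorm_nonneg M.wbar
  have h5 := euclNorm_nonneg M.M₃
  fin_cases i <;> simp only [parameters] <;> dsimp <;> positivity

theorem paramBound_scale [NeZero n] (hM : M.Standing) (hμ : 0 ≤ μ) (X₀ : Policy n m) :
    M.ParamBound μ (M.lagrangian μ X₀) (M.scale μ X₀) := by
  have hnn := parameters_nonneg hM hμ X₀
  have hsum : 0 ≤ ∑ i, M.parameters μ X₀ i := Finset.sum_nonneg fun i _ => hnn i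
  have hn : (0 : ℝ) ≤ n := Nat.cast_nonneg n
  have hmul := mul_nonneg hn hsum
  have hge : 16 + n + ∑ i, M.parameters μ X₀ i ≤ M.scale μ X₀ := by
    rw [scale]; linarith
  have hle : ∀ i, M.parameters μ X₀ i ≤ M.scale μ X₀ := fun i => by
    have := Finset.single_le_sum (fun j _ => hnn j) (Finset.mem_univ i)
    linarith
  exact
    { sixteen_le := by linarith
      n_le := by linarith
      A_le := hle 0
      B_le := hle 1
      Q_le := hle 2
      R_le := hle 3
      W_le := hle 4
      wbar_le := hle 5
      M₃_le := hle 6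
      μ_le := hle 7
      tolBar_le := hle 8
      level_le := (le_abs_self _).trans (hle 9)
      R_inv_le := hle 10
      W_inv_le := hle 11
      gramian_inv_le := hle 12 }

end Model

/-- The polynomial, in the problem parameters, that bounds the reciprocal of the stepsize of the
policy gradient method. -/
def stepPolynomial (n : ℕ) : MvPolynomial (Fin 13) ℝ≥0 :=
  (MvPolynomial.C (16 * (n + 1) : ℝ≥0) * (1 + ∑ i, MvPolynomial.X i)) ^ (22 * n + 150)

theorem Model.aeval_stepPolynomial {n m : ℕ} {Ω : Type*} [MeasurableSpace Ω] (M : Model n m Ω)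
    (μ : ℝ) (X₀ : Policy n m) : MvPolynomial.aeval (M.parameters μ X₀) (stepPolynomial n)
      = M.scale μ X₀ ^ (22 * n + 150) := by
  simp only [stepPolynomial, map_pow, map_mul, map_add, map_one, map_sum, MvPolynomial.aeval_X,
    MvPolynomial.aeval_C, scale]
  rfl

/-! ### Contraction of the three iterations. -/

namespace Model

variable {n m : ℕ} {Ω : Type*} [MeasurableSpace Ω] {M : Model n m Ω} {μ s σ : ℝ}
  {X₀ Xs : Policy n m}

theorem mul_le_quad_statΦ [NeZero n] (hM : M.Standing)
    (hσ : σ ∈ lowerBounds ((fun X => minEig (M.Φ X)) '' M.sublevel μ X₀)) {X : Policy n m}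
    (hX : X ∈ M.sublevel μ X₀) (z : Fin n ⊕ Unit → ℝ) :
    σ * (z ⬝ᵥ z) ≤ z ⬝ᵥ M.statΦ X *ᵥ z := by
  have hst := M.mem_stabilizing_iff.1 hX.1
  have h1 : σ ≤ minEig (M.Φ X) := hσ ⟨X, hX, rfl⟩
  rw [Φ_eq hM hst] at h1
  exact (le_minEig_iff (statΦ_transpose hM hst)).1 h1 z

theorem le_norm_Φ [NeZero n] (hM : M.Standing)
    (hσ : σ ∈ lowerBounds ((fun X => minEig (M.Φ X)) '' M.sublevel μ X₀)) {X : Policy n m}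
    (hX : X ∈ M.sublevel μ X₀) : σ ≤ ‖M.Φ X‖ ∧ σ ≤ 1 ∧ 1 ≤ ‖M.Φ X‖ := by
  have hst := M.mem_stabilizing_iff.1 hX.1
  have h1 : σ ≤ minEig (M.Φ X) := hσ ⟨X, hX, rfl⟩
  rw [Φ_eq hM hst] at h1 ⊢
  exact ⟨h1.trans (minEig_le_norm (statΦ_transpose hM hst)), h1.trans (minEig_statΦ_le_one hM hst),
    one_le_norm_statΦ X⟩

theorem gnStep_contraction [NeZero n] (hM : M.Standing) (hμ : 0 ≤ μ)
    (hb : M.ParamBound μ (M.lagrangian μ X₀) s) (hs : Xs ∈ M.stabilizing) (hσ0 : 0 < σ)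
    (hσ : σ ∈ lowerBounds ((fun X => minEig (M.Φ X)) '' M.sublevel μ X₀)) {η : ℝ} (hη : 0 < η)
    (hle : η ≤ 1 / 2) {X : Policy n m} (hX : X ∈ M.sublevel μ X₀) :
    M.gnStep μ η X ∈ M.sublevel μ X₀ ∧ M.lagrangian μ (M.gnStep μ η X) - M.lagrangian μ Xs
      ≤ (1 - 2 * η * σ / ‖M.Φ Xs‖) * (M.lagrangian μ X - M.lagrangian μ Xs) := by
  have h := M.mem_stabilizing_iff.1 hX.1
  obtain ⟨hst, hdec⟩ := gnStep_decrease hM hμ hb h hη.le hle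
  have hΦ := (statΦ_posDef hM hst).posSemidef
  have hN := (RK_posDef hM hμ h).inv.posSemidef
  have h1 := trace_mul_nonneg hN (hΦ.conj' (M.natGrad μ X))
  have hmem : M.gnStep μ η X ∈ M.sublevel μ X₀ := by
    rw [mem_sublevel_iff hM] at hX ⊢
    have := mul_nonneg hη.le h1
    exact ⟨hst, by linarith [hX.2]⟩
  refine ⟨hmem, contraction_of_decrease hM hμ h hst (M.mem_stabilizing_iff.1 hs)
    (by positivity) (hdec.trans ?_)⟩
  -- The decrease involves Φ at the new policy. The bound σ applies to it only because the new
  -- policy is already known to lie in the sublevel set.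
  have h2 := le_trace_conj hN (M.natGrad μ X) hΦ.transpose_eq (mul_le_quad_statΦ hM hσ hmem)
  have h3 := mul_le_mul_of_nonneg_left h2 hη.le
  linarith

theorem npgStep_decrease [NeZero n] (hM : M.Standing) (hμ : 0 ≤ μ)
    (hb : M.ParamBound μ (M.lagrangian μ X₀) s) (hσ0 : 0 < σ)
    (hσ : σ ∈ lowerBounds ((fun X => minEig (M.Φ X)) '' M.sublevel μ X₀)) {η : ℝ} (hη : 0 < η)
    {X : Policy n m} (hX : X ∈ M.sublevel μ X₀) (hle : 2 * η * ‖M.RK μ X.gain‖ ≤ 1) :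
    M.npgStep μ η X ∈ M.sublevel μ X₀ ∧
      ‖M.RK μ (M.npgStep μ η X).gain‖ ≤ ‖M.RK μ X.gain‖ ∧
      M.statL μ (M.npgStep μ η X) - M.statL μ X ≤ -(2 * η * σ * minEig M.R) *
        ((M.RK μ X.gain)⁻¹ * (M.natGrad μ X * (M.natGrad μ X)ᵀ)).trace := by
  have h := M.mem_stabilizing_iff.1 hX.1
  obtain ⟨hst, hP, hdec⟩ := natural_step hM hμ hb h hη.le hle (npgStep_eq hM hμ h η)
  have hΦ := (statΦ_posDef hM hst).posSemidef
  have h1 := (hΦ.conj' (M.natGrad μ X)).trace_nonneg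
  have hmem : M.npgStep μ η X ∈ M.sublevel μ X₀ := by
    rw [mem_sublevel_iff hM] at hX ⊢
    have := mul_nonneg hη.le h1
    exact ⟨hst, by linarith [hX.2]⟩
  refine ⟨hmem, norm_RK_le_of_P_le hM hμ hst hP, hdec.trans ?_⟩
  have h2 := le_trace_conj Matrix.PosSemidef.one (M.natGrad μ X) hΦ.transpose_eq
    (mul_le_quad_statΦ hM hσ hmem)
  rw [Matrix.one_mul, Matrix.one_mul] at h2
  have h3 := mul_le_mul_of_nonneg_left (trace_inv_RK_le hM hμ h
    (mul_transpose_self_posSemidef (M.natGrad μ X))) hσ0.le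
  have h4 := mul_le_mul_of_nonneg_left (h3.trans h2) hη.le
  linarith

theorem npgStep_iterate [NeZero n] (hM : M.Standing) (hμ : 0 ≤ μ)
    (hb : M.ParamBound μ (M.lagrangian μ X₀) s) (hσ0 : 0 < σ)
    (hσ : σ ∈ lowerBounds ((fun X => minEig (M.Φ X)) '' M.sublevel μ X₀)) {η : ℝ} (hη : 0 < η)
    {Y : Policy n m} (hY : Y ∈ M.sublevel μ X₀) (hle : 2 * η * ‖M.RK μ Y.gain‖ ≤ 1) (i : ℕ) :
    (M.npgStep μ η)^[i] Y ∈ M.sublevel μ X₀ ∧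
      2 * η * ‖M.RK μ ((M.npgStep μ η)^[i] Y).gain‖ ≤ 1 := by
  induction i with
  | zero => exact ⟨hY, hle⟩
  | succ i ih =>
    rw [Function.iterate_succ_apply']
    obtain ⟨h1, h2, -⟩ := npgStep_decrease hM hμ hb hσ0 hσ hη ih.1 ih.2
    exact ⟨h1, (mul_le_mul_of_nonneg_left h2 (by positivity)).trans ih.2⟩

theorem pgStep_contraction [NeZero n] (hM : M.Standing) (hμ : 0 ≤ μ)
    (hb : M.ParamBound μ (M.lagrangian μ X₀) s) (hs : Xs ∈ M.stabilizing) (hσ0 : 0 < σ)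
    (hσ : σ ∈ lowerBounds ((fun X => minEig (M.Φ X)) '' M.sublevel μ X₀)) {η : ℝ} (hη : 0 < η)
    (hle : η ≤ 1 / s ^ (22 * n + 150)) {X : Policy n m} (hX : X ∈ M.sublevel μ X₀) :
    M.pgStep μ η X ∈ M.sublevel μ X₀ ∧ M.lagrangian μ (M.pgStep μ η X) - M.lagrangian μ Xs
      ≤ (1 - 2 * η * σ ^ 2 * minEig M.R / ‖M.Φ Xs‖) *
        (M.lagrangian μ X - M.lagrangian μ Xs) := by
  have := nonempty_inputs hM
  have hR := minEig_pos hM.R_pd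
  have h := M.mem_stabilizing_iff.1 hX.1
  obtain ⟨hst, hdec⟩ := gradient_step hM hμ hb h
    (((mem_sublevel_iff hM).1 hX).2.trans hb.level_le) hη.le hle (pgStep_eq hM hμ h η) hσ0
    (mul_le_quad_statΦ hM hσ hX)
  have h1 := mul_le_mul_of_nonneg_left (trace_inv_RK_le hM hμ h
    (mul_transpose_self_posSemidef (M.natGrad μ X))) (by positivity : 0 ≤ 2 * η * σ ^ 2)
  have hdec' : M.statL μ (M.pgStep μ η X) - M.statL μ X ≤ -(2 * η * σ ^ 2 * minEig M.R) *
      ((M.RK μ X.gain)⁻¹ * (M.natGrad μ X * (M.natGrad μ X)ᵀ)).trace := by linarith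
  have hc : 0 ≤ 2 * η * σ ^ 2 * minEig M.R := by positivity
  exact ⟨mem_sublevel_of_decrease hM hμ hX hst hc hdec',
    contraction_of_decrease hM hμ h hst (M.mem_stabilizing_iff.1 hs) hc hdec'⟩

theorem minEig_R_le [NeZero n] (hM : M.Standing) {ℓ : ℝ} (hb : M.ParamBound μ ℓ s) :
    minEig M.R ≤ s := by
  have := nonempty_inputs hM
  exact (minEig_le_norm hM.R_pd.posSemidef.transpose_eq).trans hb.R_le

end Model

end RCLQR

end

open RCLQR Model in
/-- For every fixed multiplier `μ ≥ 0` and stabilizing `X₀`, with `𝒮₀` the sublevel set of the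
Lagrangian at `X₀`, `Xs` its minimizer (the unique critical point), and `σ₀` the smallest value on
`𝒮₀` of the minimum eigenvalue of the ergodic matrix: stability and linear convergence of the
Gauss-Newton, natural policy gradient and policy gradient iterations. The reciprocal of the stepsize
bound of the last one is a polynomial, with nonnegative coefficients that only depend on the
dimensions, in the problem parameters. -/
theorem theorem3 (n m : ℕ) [NeZero n] :
    ∃ p : MvPolynomial (Fin 13) ℝ≥0,
      ∀ {Ω : Type*} [MeasurableSpace Ω] (M : RCLQR.Model n m Ω), M.Standing →
      ∀ (μ : ℝ), 0 ≤ μ → ∀ X₀ ∈ M.stabilizing,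
        (∀ X ∈ M.stabilizing, M.WellDefinedAt μ X) ∧
        IsCompact (M.sublevel μ X₀) ∧
        ∃ Xs ∈ M.stabilizing,
          (∀ X ∈ M.stabilizing, M.grad μ X = 0 ↔ X = Xs) ∧
          (∀ X ∈ M.stabilizing, M.lagrangian μ Xs ≤ M.lagrangian μ X) ∧
          ∃ σ₀ : ℝ,
            IsLeast ((fun X => RCLQR.minEig (M.Φ X)) '' M.sublevel μ X₀) σ₀ ∧ 0 < σ₀ ∧
            -- Gauss-Newton
            (∀ η β : ℝ, 0 < η → η ≤ 1 / 2 → β = 2 * η * σ₀ / ‖M.Φ Xs‖ →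
              0 < β ∧ β ≤ 1 ∧
              (η < 1 / 2 ∨ M.lagrangian μ Xs < M.lagrangian μ X₀ → β < 1) ∧
              ∀ X ∈ M.sublevel μ X₀,
                M.gnStep μ η X ∈ M.sublevel μ X₀ ∧
                M.lagrangian μ (M.gnStep μ η X) - M.lagrangian μ Xs
                  ≤ (1 - β) * (M.lagrangian μ X - M.lagrangian μ Xs)) ∧
            -- natural policy gradient, started at any policy `Y` of the sublevel set
            (∀ Y ∈ M.sublevel μ X₀, ∀ η β : ℝ, 0 < η → η ≤ 1 / (2 * ‖M.RK μ Y.gain‖) →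
              β = 2 * η * σ₀ * RCLQR.minEig M.R / ‖M.Φ Xs‖ →
              0 < β ∧ β < 1 ∧
              ∀ i : ℕ,
                (M.npgStep μ η)^[i] Y ∈ M.sublevel μ X₀ ∧
                M.lagrangian μ ((M.npgStep μ η)^[i + 1] Y) - M.lagrangian μ Xs
                  ≤ (1 - β) * (M.lagrangian μ ((M.npgStep μ η)^[i] Y) - M.lagrangian μ Xs)) ∧
            -- policy gradient
            0 < MvPolynomial.aeval (M.parameters μ X₀) p ∧
            (∀ η β : ℝ, 0 < η → η ≤ 1 / MvPolynomial.aeval (M.parameters μ X₀) p →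
              β = 2 * η * σ₀ ^ 2 * RCLQR.minEig M.R / ‖M.Φ Xs‖ →
              0 < β ∧ β < 1 ∧
              ∀ X ∈ M.sublevel μ X₀,
                M.pgStep μ η X ∈ M.sublevel μ X₀ ∧
                M.lagrangian μ (M.pgStep μ η X) - M.lagrangian μ Xs
                  ≤ (1 - β) * (M.lagrangian μ X - M.lagrangian μ Xs)) := by
  refine ⟨stepPolynomial n, fun {Ω} _ M hM μ hμ X₀ h₀ => ?_⟩
  have := nonempty_inputs hM
  have hb := paramBound_scale hM hμ X₀
  have hs := hb.sixteen_le
  rw [aeval_stepPolynomial]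
  set s := M.scale μ X₀
  refine ⟨fun X hX => wellDefinedAt hM hμ (M.mem_stabilizing_iff.1 hX),
    isCompact_sublevel hM hμ hb, ?_⟩
  obtain ⟨Xs, hXs, hcrit, hmin⟩ := exists_minimizer hM hμ h₀ hb
  obtain ⟨σ, ⟨hσmem, hσ⟩, hσ0⟩ := exists_isLeast_minEig hM hμ h₀ hb
  have hXs' : Xs ∈ M.sublevel μ X₀ := ⟨hXs, hmin X₀ h₀⟩
  obtain ⟨hσΦ, hσ1, hΦ1⟩ := le_norm_Φ hM hσ hXs'
  have hΦ0 : 0 < ‖M.Φ Xs‖ := by linarith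
  have hR := minEig_pos hM.R_pd
  refine ⟨Xs, hXs, hcrit, hmin, σ, ⟨hσmem, hσ⟩, hσ0, ?_, ?_, by positivity, ?_⟩
  · rintro η β hη hle rfl
    refine ⟨by positivity, ?_, ?_, fun X hX => gnStep_contraction hM hμ hb hXs hσ0 hσ hη hle hX⟩
    · rw [div_le_one hΦ0]
      nlinarith
    · intro hlt
      rw [div_lt_one hΦ0]
      rcases hlt with hlt | hlt
      · nlinarith
      -- At η = 1/2 the factor is σ/‖Φ*‖; strictness comes from σ < 1 ≤ ‖Φ*‖.
      · obtain ⟨X, hX, hXlt⟩ := exists_mem_sublevel_minEig_lt hM hμ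
          (M.mem_stabilizing_iff.1 hXs) hlt
        have : σ < 1 := (hσ ⟨X, hX, rfl⟩).trans_lt hXlt
        nlinarith
  · rintro Y hY η β hη hle rfl
    have hYst := M.mem_stabilizing_iff.1 hY.1
    have hRK := norm_RK_pos hM hμ hYst
    have hle' : 2 * η * ‖M.RK μ Y.gain‖ ≤ 1 := by
      rw [le_div_iff₀ (by positivity)] at hle
      linarith
    refine ⟨by positivity, ?_, fun i => ?_⟩
    · rw [div_lt_one hΦ0]
      -- The minimum eigenvalue of R is strictly below ‖R_K‖, since BᵀP_KB is not zero; the other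
      -- factor σ/‖Φ*‖ is at most 1.
      have h1 : 2 * η * minEig M.R < 1 :=
        (mul_lt_mul_of_pos_left (minEig_R_lt_norm_RK hM hμ hb hYst) (by positivity)).trans_le hle'
      have h2 := mul_lt_mul_of_pos_right h1 hσ0
      linarith
    · obtain ⟨h1, h2⟩ := npgStep_iterate hM hμ hb hσ0 hσ hη hY hle' i
      obtain ⟨h3, -, h4⟩ := npgStep_decrease hM hμ hb hσ0 hσ hη h1 h2
      rw [Function.iterate_succ_apply']
      exact ⟨h1, contraction_of_decrease hM hμ (M.mem_stabilizing_iff.1 h1.1)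
        (M.mem_stabilizing_iff.1 h3.1) (M.mem_stabilizing_iff.1 hXs) (by positivity) h4⟩
  · rintro η β hη hle rfl
    refine ⟨by positivity, ?_, fun X hX => pgStep_contraction hM hμ hb hXs hσ0 hσ hη hle hX⟩
    rw [div_lt_one hΦ0]
    have h1 : s ^ 1 * η ≤ 1 / s :=
      pow_mul_stepsize_le (by linarith) hη.le hle (by omega)
    have h2 : 1 / s ≤ 1 / 16 := one_div_le_one_div_of_le (by norm_num) hs
    have h3 := mul_le_mul_of_nonneg_right (minEig_R_le hM hb) hη.le
    have h4 : σ ^ 2 ≤ 1 := pow_le_one₀ hσ0.le hσ1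
    have h5 : 2 * η * minEig M.R < 1 := by linarith
    have h6 : 0 < 2 * η * minEig M.R := by positivity
    nlinarith
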